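/- **Corollary 5.6.** Conventions. A monoid is a commutative cancellative semigroup with identity. Let $H$ be a monoid with unit group $H^\times$ and reduced monoid $H_{\mathrm{red}}=H/H^\times$. A *factorization* of $a\in H$ is a finite multiset of atoms (irreducible elements) of $H_{\mathrm{red}}$ with product $aH^\times$; $\mathsf Z(a)$ is the set of factorizations of $a$, and $\mathsf L(a)=\{|z| : z\in\mathsf Z(a)\}$. The distance of two factorizations is $\mathsf d(z,z')=\max\{|z\gcd(z,z')^{-1}|,|z'\gcd(z,z')^{-1}|\}$, where $\gcd(z,z')$ is the largest common sub-multiset. For $a\in H$ let $\mathsf c(a)\in\mathbb N_0\cup\{\infty\}$ be the smallest $N$ such that for all $z,z'\in\mathsf Z(a)$ there are $z=z_0,z_1,\dots,z_k=z'$ in $\mathsf Z(a)$ with $\mathsf d(z_{i-1},z_i)\le N$ for all $i\in[1,k]$. The *catenary degree* of $H$ is $\mathsf c(H)=\sup\{\mathsf c(a):a\in H\}\in\mathbb N_0\cup\{\infty\}$, and $$\daleth(H)=\sup\bigl\{\min\bigl(\mathsf L(uv)\setminus\{2\}\bigr) : u,v \text{ atoms of } H\bigr\}\in\mathbb N_0\cup\{\infty\},\qquad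 \min\emptyset=\sup\emptyset=0 .$$ A *divisor theory* for $H$ is a monoid homomorphism $\varphi\colon H\to\mathcal F(P)$ into the free abelian monoid on a set $P$ such that $\varphi(a)\mid\varphi(b)$ implies $a\mid b$ for all $a,b\in H$, and such that every $p\in P$ is the greatest common divisor of $\varphi(X)$ for some finite nonempty $X\subset H$. $H$ is a *Krull monoid* if it has a divisor theory $\varphi$; its *class group* is $\mathsf q(\mathcal F(P))/\mathsf q(\varphi(H))$ (where $\mathsf q$ denotes the quotient group), and a class *contains a prime divisor* if it is the class of some $p\in P$. $C_n$ denotes a cyclic group of order $n$. Statement. Let $H$ be a Krull monoid with class group $G$, and suppose that every class contains a prime divisor. Then $\daleth(H)$ is finite if and only if $\mathsf c(H)$ is finite, if and only if $G$ is finite. Moreover: 1. $\mathsf c(H)\le 2$ if and only if $|G|\le 2$. 2. $\mathsf c(H)=3$ if and only if $G$ is isomorphic to one of $C_3$, $C_2\oplus C_2$, $C_3\oplus C_3$. 3. $\mathsf c(H)=4$ if and only if $G$ is isomorphic to one of $C_4$, $C_2\oplus C_4$, $C_2\oplus C_2\oplus C_2$, $C_3\oplus C_3\oplus C_3$. -/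

import Mathlib

namespace KrullMonoid

noncomputable section

/-! Factorizations, catenary degree and the invariant `daleth`. In the result, monoids are
commutative and cancellative. The associated reduced monoid `H / Hˣ` is `Associates H`. -/

/-- The set `Z(a)` of factorizations of `a`: finite multisets of atoms of the reduced monoid
`Associates H` whose product is the class of `a`. -/
def factorizations {H : Type*} [CommMonoid H] (a : H) : Set (Multiset (Associates H)) :=
  {z | (∀ u ∈ z, Irreducible u) ∧ z.prod = Associates.mk a}

/-- The set of lengths `L(a)`. -/
def lengths {H : Type*} [CommMonoid H] (a : H) : Set ℕ :=
  Multiset.card '' factorizations a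

open Classical in
/-- The distance `d(z, z') = max {|z gcd(z, z')⁻¹|, |z' gcd(z, z')⁻¹|}` of two elements of a free
abelian monoid; multisets are written additively and `z ∩ z'` is their gcd. -/
def factDist {α : Type*} (z z' : Multiset α) : ℕ :=
  max (Multiset.card (z - z ∩ z')) (Multiset.card (z' - z ∩ z'))

/-- The factorizations `z` and `z'` of `a` can be concatenated by an `N`-chain: a finite sequence
of factorizations of `a` from `z` to `z'` (possibly of only one term) in which consecutive terms
have distance at most `N`. -/
def Concatenated {H : Type*} [CommMonoid H] (a : H) (N : ℕ∞)
    (z z' : factorizations a) : Prop :=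
  Relation.ReflTransGen
    (fun x y : factorizations a => (factDist x.1 y.1 : ℕ∞) ≤ N) z z'

/-- `c(a)`: the smallest `N ∈ ℕ ∪ {∞}` such that any two factorizations of `a` can be
concatenated by an `N`-chain. (`N = ∞` always works and `ℕ∞` is well-ordered, so the infimum is
attained.) -/
def catenaryDegreeAt {H : Type*} [CommMonoid H] (a : H) : ℕ∞ :=
  sInf {N : ℕ∞ | ∀ z z' : factorizations a, Concatenated a N z z'}

/-- The catenary degree `c(H) = sup {c(a) | a ∈ H}`. -/
def catenaryDegree (H : Type*) [CommMonoid H] : ℕ∞ :=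
  ⨆ a : H, catenaryDegreeAt a

/-- `daleth(H) = sup {min (L(uv) \ {2}) | u, v atoms of H}`, with `min ∅ = sup ∅ = 0`
(indeed `sInf ∅ = 0` in `ℕ` and an empty supremum in `ℕ∞` is `0`). -/
def daleth (H : Type*) [CommMonoid H] : ℕ∞ :=
  ⨆ (u : H) (v : H) (_ : Irreducible u) (_ : Irreducible v),
    ((sInf (lengths (u * v) \ {2}) : ℕ) : ℕ∞)

/-! Divisor theories and the class group. -/

/-- The free abelian monoid `F(P)` with basis `P`, written multiplicatively. -/
abbrev FreeMon (P : Type*) : Type _ := Multiplicative (P →₀ ℕ)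

/-- The basis element of `F(P)` given by `p`. -/
def prime {P : Type*} (p : P) : FreeMon P := Multiplicative.ofAdd (Finsupp.single p 1)

/-- `φ : H → F(P)` is a divisor theory for `H`: it is a divisor homomorphism, and every `p ∈ P`
is the greatest common divisor of `φ(X)` for some finite nonempty `X ⊆ H`. A monoid is a Krull
monoid if and only if it has a divisor theory. -/
structure IsDivisorTheory {H P : Type*} [CommMonoid H] (φ : H →* FreeMon P) : Prop where
  dvd_of_map_dvd : ∀ a b : H, φ a ∣ φ b → a ∣ b
  exists_gcd : ∀ p : P, ∃ X : Finset H, X.Nonempty ∧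
    ∀ d : FreeMon P, (∀ x ∈ X, d ∣ φ x) ↔ d ∣ prime p

/-- The embedding of `F(P)` into its quotient group, the free abelian group `P →₀ ℤ` (written
additively). -/
def toQuot {P : Type*} (a : FreeMon P) : P →₀ ℤ :=
  Finsupp.mapRange (fun n : ℕ => (n : ℤ)) Nat.cast_zero a.toAdd

/-- The subgroup `q(φ(H))` of `q(F(P))` generated by `φ(H)`. -/
def principal {H P : Type*} [CommMonoid H] (φ : H →* FreeMon P) : AddSubgroup (P →₀ ℤ) :=
  AddSubgroup.closure (Set.range fun a : H => toQuot (φ a))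

/-- The class group `q(F(P)) / q(φ(H))`. If `φ` is a divisor theory, this is the class group of
the Krull monoid `H`. -/
abbrev ClGroup {H P : Type*} [CommMonoid H] (φ : H →* FreeMon P) : Type _ :=
  (P →₀ ℤ) ⧸ principal φ

/-- The class `[a]` of an element `a` of `F(P)`. -/
def divisorClass {H P : Type*} [CommMonoid H] (φ : H →* FreeMon P) (a : FreeMon P) :
    ClGroup φ :=
  QuotientAddGroup.mk (toQuot a)

end

end KrullMonoid

/-! The class map identifies the reduced monoid of `H` with the monoid of zero-sum multisets over
`P`. Atoms become minimal zero-sum multisets (`zeroSum_classMap_iff`, `minZeroSum_content_iff`), so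
the problem becomes one of zero-sum combinatorics in the class group `G`. Write `D` for the
Davenport constant of `G`.

Upper bounds. If `N ≥ 2`, `N ≥ ℸ` and `2N ≥ D`, then the catenary degree is at most `N`
(`chained_of_davenportLE_of_dalethLE`). Moreover `ℸ ≤ max {2, D}`, and `D ≤ |G|` for finite `G`, so
a finite class group gives a finite catenary degree.

Lower bounds. Always `ℸ(H) ≤ c(H)` (`daleth_le_catenaryDegree`). If a zero-sum `U` has so few
coincidences among its subsums that equal subsums only come from equal or complementary parts, then
`U(-U)` has no factorization length strictly between 2 and `|U|` (`SumSeparated.card_le`). Applied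
to `g^n` with `n = ord g ≥ 3`, this gives `ℸ ≥ ord g`. Applied to a dissociated multiset `S`, `|S| ≥
2`, completed by minus its sum, it gives `ℸ ≥ |S| + 1`. An infinite group has arbitrarily large
dissociated multisets, hence `ℸ = ∞`. If `ℸ ≤ 4`, element orders are at most 4 and dissociated
multisets have at most 3 elements, which leaves the groups of order at most 2 and the seven listed
ones (`classification`).

Exact values. For `C₃`, `C₂²`, `C₄`, `C₂³` the bound by `D` suffices. For `C₃²`, `C₃³` and `C₂ ⊕ C₄`
one has `D ≤ 5, 7, 5`, and `ℸ ≤ 3, 4, 4` must be shown by hand. Over `C₃^r`, a factorization of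
`U(-V)` with at least `r + 2` atoms has linearly dependent partial sums, and the coefficients 0, 1,
2 cut `U` and `V` into three parts each, all six of the same sum (`exists_triSplit`). The parts can
then be matched in six ways, and comparing these matchings excludes that all short lengths are
missing. -/

namespace KrullMonoid

/-! ### Zero-sum multisets -/

section ZeroSum

variable {P G : Type*} [AddCommGroup G] {f : P → G}

/-- The multiset `S` over `P` has sum zero with respect to the class map `f`. -/
def ZeroSum (f : P → G) (S : Multiset P) : Prop := (S.map f).sum = 0

/-- Minimal nonempty zero-sum multisets. -/
def MinZeroSum (f : P → G) (U : Multiset P) : Prop :=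
  U ≠ 0 ∧ ZeroSum f U ∧ ∀ T ≤ U, T ≠ 0 → ZeroSum f T → T = U

/-- Multisets of minimal zero-sum multisets. -/
def IsFac (f : P → G) (z : Multiset (Multiset P)) : Prop := ∀ U ∈ z, MinZeroSum f U

theorem zeroSum_zero : ZeroSum f 0 := by simp [ZeroSum]

theorem ZeroSum.add {S T : Multiset P} (hS : ZeroSum f S) (hT : ZeroSum f T) :
    ZeroSum f (S + T) := by
  simp_all [ZeroSum]

theorem ZeroSum.of_add {S T : Multiset P} (hS : ZeroSum f S) (h : ZeroSum f (S + T)) :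
    ZeroSum f T := by
  simp_all [ZeroSum]

theorem IsFac.zero : IsFac f 0 := by simp [IsFac]

theorem IsFac.add {x y : Multiset (Multiset P)} (hx : IsFac f x) (hy : IsFac f y) :
    IsFac f (x + y) := fun U hU => (Multiset.mem_add.1 hU).elim (hx U) (hy U)

theorem IsFac.cons {U : Multiset P} {x : Multiset (Multiset P)} (hU : MinZeroSum f U)
    (hx : IsFac f x) : IsFac f (U ::ₘ x) := by
  intro V hV
  rcases Multiset.mem_cons.1 hV with rfl | h
  · exact hU
  · exact hx V h

theorem IsFac.mono {x y : Multiset (Multiset P)} (hy : IsFac f y) (h : x ≤ y) : IsFac f x :=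
  fun U hU => hy U (Multiset.mem_of_le h hU)

theorem IsFac.zeroSum {x : Multiset (Multiset P)} (hx : IsFac f x) : ZeroSum f x.sum := by
  induction x using Multiset.induction with
  | empty => simpa using zeroSum_zero
  | cons U x ih =>
    rw [Multiset.sum_cons]
    exact (hx U (by simp)).2.1.add (ih (hx.mono (Multiset.le_cons_self _ _)))

theorem IsFac.card_le {x : Multiset (Multiset P)} (hx : IsFac f x) :
    x.card ≤ x.sum.card := by
  induction x using Multiset.induction with
  | empty => simp
  | cons U x ih =>
    have h1 := ih (hx.mono (Multiset.le_cons_self _ _))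
    have h2 := Multiset.card_pos.2 (hx U (by simp)).1
    simp only [Multiset.sum_cons, Multiset.card_cons, Multiset.card_add]
    omega

theorem exists_minZeroSum_le {S : Multiset P} (hS : ZeroSum f S) (h0 : S ≠ 0) :
    ∃ U ≤ S, MinZeroSum f U := by
  induction hn : S.card using Nat.strong_induction_on generalizing S with
  | _ n ih =>
    by_cases h : MinZeroSum f S
    · exact ⟨S, le_rfl, h⟩
    · simp only [MinZeroSum, not_and, not_forall] at h
      obtain ⟨T, hT, hT0, hTz, hne⟩ := h h0 hS
      have hlt : T < S := lt_of_le_of_ne hT hne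
      obtain ⟨U, hU, hU'⟩ := ih T.card (hn ▸ Multiset.card_lt_card hlt) hTz hT0 rfl
      exact ⟨U, hU.trans hT, hU'⟩

theorem exists_isFac {S : Multiset P} (hS : ZeroSum f S) :
    ∃ z, IsFac f z ∧ z.sum = S := by
  induction hn : S.card using Nat.strong_induction_on generalizing S with
  | _ n ih =>
    by_cases h0 : S = 0
    · exact ⟨0, IsFac.zero, by simp [h0]⟩
    · obtain ⟨U, hU, hU'⟩ := exists_minZeroSum_le hS h0
      obtain ⟨R, rfl⟩ := Multiset.le_iff_exists_add.1 hU
      have := Multiset.card_pos.2 hU'.1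
      rw [Multiset.card_add] at hn
      obtain ⟨z, hz, hzs⟩ := ih R.card (by omega) (hU'.2.1.of_add hS) rfl
      exact ⟨U ::ₘ z, hz.cons hU', by simp [hzs]⟩

theorem MinZeroSum.eq_of_le {U V : Multiset P} (hU : MinZeroSum f U) (hV : MinZeroSum f V)
    (h : U ≤ V) : U = V := hV.2.2 U h hU.1 hU.2.1

/-- A minimal zero-sum multiset has only one factorization. -/
theorem IsFac.card_eq_one {x : Multiset (Multiset P)} (hx : IsFac f x)
    (h : MinZeroSum f x.sum) : x.card = 1 := by
  rcases Multiset.empty_or_exists_mem x with rfl | ⟨U, hU⟩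
  · exact absurd rfl h.1
  · obtain ⟨y, rfl⟩ := Multiset.exists_cons_of_mem hU
    have hUU := (hx U hU).eq_of_le h (by simp)
    have hy : y.sum = 0 := by
      rw [Multiset.sum_cons] at hUU
      simpa using hUU
    have hy' := (hx.mono (Multiset.le_cons_self y U)).card_le
    rw [hy] at hy'
    simp at hy' ⊢
    exact hy'

end ZeroSum

/-! ### Refinements and liftings of multiset decompositions -/

section Decomposition

variable {P : Type*}

theorem exists_add_of_le_add {S A B : Multiset P} (h : S ≤ A + B) :
    ∃ S₁ ≤ A, ∃ S₂ ≤ B, S = S₁ + S₂ := by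
  classical
  refine ⟨S ∩ A, Multiset.inter_le_right, S - A, ?_, ?_⟩
  · exact tsub_le_iff_left.2 h
  · rw [add_comm, Multiset.sub_add_inter]

/-- Each element of `S` needs at most one member of `x` to contain it. -/
theorem exists_card_le_of_le_sum {S : Multiset P} {x : Multiset (Multiset P)} (h : S ≤ x.sum) :
    ∃ y ≤ x, y.card ≤ S.card ∧ S ≤ y.sum := by
  induction x using Multiset.induction generalizing S with
  | empty => exact ⟨0, le_rfl, by simp, by simpa using h⟩
  | cons U x ih =>
    rw [Multiset.sum_cons] at h
    obtain ⟨S₁, h1, S₂, h2, rfl⟩ := exists_add_of_le_add h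
    obtain ⟨y, hy, hc, hs⟩ := ih h2
    by_cases h0 : S₁ = 0
    · subst h0
      exact ⟨y, hy.trans (Multiset.le_cons_self _ _), by simpa using hc, by simpa using hs⟩
    · have := Multiset.card_pos.2 h0
      refine ⟨U ::ₘ y, Multiset.cons_le_cons _ hy, ?_, ?_⟩
      · simp only [Multiset.card_cons, Multiset.card_add]; omega
      · rw [Multiset.sum_cons]; exact add_le_add h1 hs

/-- A common refinement of the decomposition `A + B` and of `z.sum`. -/
theorem exists_split_of_sum_eq_add {z : Multiset (Multiset P)} {A B : Multiset P}
    (h : z.sum = A + B) : ∃ w : Multiset (Multiset P × Multiset P),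
      z = w.map (fun p => p.1 + p.2) ∧ A = (w.map Prod.fst).sum ∧ B = (w.map Prod.snd).sum := by
  induction z using Multiset.induction generalizing A B with
  | empty =>
    have : A + B = 0 := by simpa using h.symm
    refine ⟨0, rfl, ?_, ?_⟩ <;> simp_all
  | cons U z ih =>
    rw [Multiset.sum_cons] at h
    obtain ⟨U₁, h1, U₂, h2, rfl⟩ := exists_add_of_le_add (h ▸ Multiset.le_add_right U z.sum)
    obtain ⟨A', rfl⟩ := Multiset.le_iff_exists_add.1 h1
    obtain ⟨B', rfl⟩ := Multiset.le_iff_exists_add.1 h2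
    have hs : z.sum = A' + B' := by
      apply add_left_cancel (a := U₁ + U₂); rw [h]; abel
    obtain ⟨w, rfl, rfl, rfl⟩ := ih hs
    exact ⟨(U₁, U₂) ::ₘ w, by simp⟩

theorem exists_map_eq_of_le_map {Q : Type*} {f : P → Q} {A : Multiset P} {T : Multiset Q}
    (h : T ≤ A.map f) : ∃ S ≤ A, S.map f = T := by
  induction A using Multiset.induction generalizing T with
  | empty => exact ⟨0, le_rfl, by simpa using (Multiset.le_zero.1 (by simpa using h)).symm⟩
  | cons a A ih =>
    rw [Multiset.map_cons, ← Multiset.singleton_add] at h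
    obtain ⟨T₁, h1, T₂, h2, rfl⟩ := exists_add_of_le_add h
    obtain ⟨S, hS, rfl⟩ := ih h2
    rcases Multiset.le_singleton.1 h1 with rfl | rfl
    · exact ⟨S, hS.trans (Multiset.le_cons_self _ _), by simp⟩
    · exact ⟨a ::ₘ S, Multiset.cons_le_cons _ hS, by simp⟩

theorem exists_map_map_eq {Q : Type*} {f : P → Q} {A : Multiset P} {z : Multiset (Multiset Q)}
    (h : z.sum = A.map f) : ∃ y : Multiset (Multiset P), y.map (Multiset.map f) = z ∧ y.sum = A := by
  induction z using Multiset.induction generalizing A with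
  | empty => exact ⟨0, rfl, by simpa [eq_comm] using h⟩
  | cons T z ih =>
    rw [Multiset.sum_cons] at h
    obtain ⟨S, hS, rfl⟩ := exists_map_eq_of_le_map (h ▸ Multiset.le_add_right T z.sum)
    obtain ⟨R, rfl⟩ := Multiset.le_iff_exists_add.1 hS
    rw [Multiset.map_add] at h
    obtain ⟨y, rfl, rfl⟩ := ih (add_left_cancel h)
    exact ⟨S ::ₘ y, by simp⟩

end Decomposition

/-! ### Chains of factorizations -/

section Distance

variable {α : Type*}

theorem factDist_comm (x y : Multiset α) : factDist x y = factDist y x := by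
  classical
  unfold factDist
  rw [max_comm]
  simp only [Multiset.inter_comm]

theorem factDist_add_left (w x y : Multiset α) : factDist (w + x) (w + y) = factDist x y := by
  classical
  have h : ∀ x y : Multiset α, w + x - (w + x) ∩ (w + y) = x - x ∩ y := fun x y =>
    Multiset.ext.2 fun a => by
      simp only [Multiset.count_sub, Multiset.count_add, Multiset.count_inter]
      omega
  have h1 := h x y
  have h2 := h y x
  rw [Multiset.inter_comm, Multiset.inter_comm y] at h2
  unfold factDist
  congr 2

theorem factDist_le_max (x y : Multiset α) : factDist x y ≤ max x.card y.card := by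
  classical
  unfold factDist
  exact max_le_max (Multiset.card_le_card (Multiset.sub_le_self _ _))
    (Multiset.card_le_card (Multiset.sub_le_self _ _))

end Distance

section Chains

variable {P G : Type*} [AddCommGroup G] {f : P → G} {N : ℕ}

/-- One step of an `N`-chain of factorizations. -/
def ChainStep (f : P → G) (N : ℕ) (x y : Multiset (Multiset P)) : Prop :=
  IsFac f x ∧ IsFac f y ∧ x.sum = y.sum ∧ factDist x y ≤ N

/-- The factorizations `x` and `y` can be concatenated by an `N`-chain. -/
def Chained (f : P → G) (N : ℕ) : Multiset (Multiset P) → Multiset (Multiset P) → Prop :=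
  Relation.ReflTransGen (ChainStep f N)

theorem Chained.trans {x y z : Multiset (Multiset P)} (h : Chained f N x y)
    (h' : Chained f N y z) : Chained f N x z := Relation.ReflTransGen.trans h h'

theorem Chained.symm {x y : Multiset (Multiset P)} (h : Chained f N x y) : Chained f N y x := by
  induction h with
  | refl => exact Relation.ReflTransGen.refl
  | tail _ h ih =>
    obtain ⟨h1, h2, h3, h4⟩ := h
    exact Relation.ReflTransGen.head ⟨h2, h1, h3.symm, factDist_comm _ _ ▸ h4⟩ ih

theorem Chained.add_left {w x y : Multiset (Multiset P)} (hw : IsFac f w) (h : Chained f N x y) :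
    Chained f N (w + x) (w + y) := by
  induction h with
  | refl => exact Relation.ReflTransGen.refl
  | tail _ h ih =>
    obtain ⟨h1, h2, h3, h4⟩ := h
    exact ih.tail ⟨hw.add h1, hw.add h2, by simp [h3], by rwa [factDist_add_left]⟩

theorem chained_of_card_le {x y : Multiset (Multiset P)} (hx : IsFac f x) (hy : IsFac f y)
    (h : x.sum = y.sum) (hxN : x.card ≤ N) (hyN : y.card ≤ N) : Chained f N x y :=
  Relation.ReflTransGen.single ⟨hx, hy, h, (factDist_le_max x y).trans (max_le hxN hyN)⟩

/-- The statement that all factorizations of `A` can be concatenated by `N`-chains, for all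
zero-sum multisets `A` of cardinality less than `n`. -/
def ChainedBelow (f : P → G) (N n : ℕ) : Prop :=
  ∀ x y : Multiset (Multiset P), IsFac f x → IsFac f y → x.sum = y.sum → x.sum.card < n →
    Chained f N x y

/-- If `U` divides `y'.sum`, write `y'.sum = U + t.sum`. Then `U ::ₘ t + w` lies between the two
factorizations: it shares `w ≠ 0` with one and `U` with the other. Cancelling the shared part leaves
a strictly smaller product, to which the induction hypothesis applies. -/
theorem chained_of_le_sum_of_lt {n : ℕ} (ih : ChainedBelow f N n) {x y' w : Multiset (Multiset P)}
    {U : Multiset P} (hx : IsFac f (U ::ₘ x)) (hy : IsFac f (y' + w)) (hw : w ≠ 0)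
    (hs : (U ::ₘ x).sum = (y' + w).sum) (hn : (U ::ₘ x).sum.card ≤ n) (hU : U ≤ y'.sum) :
    Chained f N (U ::ₘ x) (y' + w) := by
  have hUm : MinZeroSum f U := hx U (by simp)
  have hx' : IsFac f x := hx.mono (Multiset.le_cons_self _ _)
  have hy' : IsFac f y' := hy.mono (Multiset.le_add_right _ _)
  have hwf : IsFac f w := hy.mono (Multiset.le_add_left _ _)
  obtain ⟨R, hR⟩ := Multiset.le_iff_exists_add.1 hU
  obtain ⟨t, ht, rfl⟩ := exists_isFac (hUm.2.1.of_add (hR ▸ hy'.zeroSum))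
  have hwc : 0 < w.sum.card := (Multiset.card_pos.2 hw).trans_le hwf.card_le
  have hUc := Multiset.card_pos.2 hUm.1
  have hs' : x.sum = (w + t).sum := by
    apply add_left_cancel (a := U)
    rw [← Multiset.sum_cons, hs, Multiset.sum_add, hR, Multiset.sum_add]
    abel
  have hc := congrArg Multiset.card hs
  simp only [Multiset.sum_cons, Multiset.sum_add, Multiset.card_add] at hc hn
  have h1 : Chained f N (U ::ₘ t) y' :=
    ih _ _ (ht.cons hUm) hy' (by simp [hR]) (by
      rw [Multiset.sum_cons, ← hR]; omega)
  have h2 : Chained f N x (w + t) := ih _ _ hx' (hwf.add ht) hs' (by omega)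
  have h3 := h1.add_left hwf
  have h4 := h2.add_left (w := {U}) (by simpa [IsFac] using hUm)
  rw [Multiset.singleton_add, Multiset.singleton_add] at h4
  rw [Multiset.add_cons] at h3
  rw [add_comm y' w]
  exact h4.trans h3

/-- `N` bounds `min (L(UV) \ {2})` for all atoms `U`, `V`. -/
def DalethLE (f : P → G) (N : ℕ) : Prop :=
  ∀ U V : Multiset P, MinZeroSum f U → MinZeroSum f V → ∀ z : Multiset (Multiset P), IsFac f z →
    z.sum = U + V → 3 ≤ z.card → ∃ z', IsFac f z' ∧ z'.sum = U + V ∧ 3 ≤ z'.card ∧ z'.card ≤ N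

/-- Every multiset of cardinality at least `n` has a nonempty zero-sum submultiset; in other
words, `n` is at least the Davenport constant. -/
def DavenportLE (f : P → G) (n : ℕ) : Prop :=
  ∀ S : Multiset P, n ≤ S.card → ∃ T ≤ S, T ≠ 0 ∧ ZeroSum f T

/-- Pick an atom `U` of `x` and two atoms `V₁`, `V₂` of `y`, and let `Sᵢ` be the part of `Vᵢ` not
used by `U`. Either some `Vᵢ` is covered by at most `N` atoms of `x`, which leaves out an atom of
`x`, or `S₁ + S₂` is so large that it contains an atom `W`. In the latter case `V₁ + V₂` is
refactored with `W` split off. -/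
theorem chained_of_lt_card {n : ℕ} (hN : 2 ≤ N) (hD : DavenportLE f (2 * N)) (hd : DalethLE f N)
    (ih : ChainedBelow f N n) {x y : Multiset (Multiset P)} (hx : IsFac f x) (hy : IsFac f y)
    (hs : x.sum = y.sum) (hn : x.sum.card ≤ n) (hxN : N < x.card)
    (ih' : ∀ y', IsFac f y' → x.sum = y'.sum → y.card < y'.card → Chained f N x y') :
    Chained f N x y := by
  classical
  by_contra hcon
  -- `y` has at least two factors
  obtain ⟨V₁, V₂, y₂, rfl⟩ : ∃ V₁ V₂ y₂, y = V₁ ::ₘ V₂ ::ₘ y₂ := by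
    rcases Multiset.empty_or_exists_mem y with rfl | ⟨V₁, h1⟩
    · have := hx.card_le
      rw [hs] at this
      simp at this
      simp [this] at hxN
    · obtain ⟨y₁, rfl⟩ := Multiset.exists_cons_of_mem h1
      rcases Multiset.empty_or_exists_mem y₁ with rfl | ⟨V₂, h2⟩
      · have := hx.card_eq_one (by rw [hs]; simpa using hy V₁ (by simp))
        omega
      · obtain ⟨y₂, rfl⟩ := Multiset.exists_cons_of_mem h2
        exact ⟨V₁, V₂, y₂, rfl⟩
  obtain ⟨U, hU⟩ := Multiset.card_pos_iff_exists_mem.1 (show 0 < x.card by omega)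
  obtain ⟨x', rfl⟩ := Multiset.exists_cons_of_mem hU
  have hV₁ : MinZeroSum f V₁ := hy V₁ (by simp)
  have hV₂ : MinZeroSum f V₂ := hy V₂ (by simp)
  have hy₂ : IsFac f y₂ := hy.mono ((Multiset.le_cons_self _ _).trans (Multiset.le_cons_self _ _))
  have hUm : MinZeroSum f U := hx U (by simp)
  rw [Multiset.card_cons] at hxN
  have hs2 : U + x'.sum = (V₁ + V₂) + y₂.sum := by
    simpa [add_assoc] using hs
  -- refine the two decompositions
  obtain ⟨T, hTV, R, hRy, hUTR⟩ := exists_add_of_le_add (hs2 ▸ Multiset.le_add_right U x'.sum)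
  obtain ⟨T₁, hT₁, T₂, hT₂, rfl⟩ := exists_add_of_le_add hTV
  obtain ⟨S₁, rfl⟩ := Multiset.le_iff_exists_add.1 hT₁
  obtain ⟨S₂, rfl⟩ := Multiset.le_iff_exists_add.1 hT₂
  have hSx : S₁ + S₂ ≤ x'.sum := by
    obtain ⟨Q, hQ⟩ := Multiset.le_iff_exists_add.1 hRy
    refine Multiset.le_iff_exists_add.2 ⟨Q, ?_⟩
    apply add_left_cancel (a := U)
    rw [hs2, hQ, hUTR]
    abel
  -- If `S` had fewer than `N` elements, `U` and at most `N - 1` further atoms of `x` would cover `T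
  -- + S`. As `x` has more than `N` atoms, some atom is left over.
  have key : ∀ {T S : Multiset P} {z : Multiset (Multiset P)}, T ≤ U → S ≤ x'.sum →
      (T + S) ::ₘ z = (T₁ + S₁) ::ₘ (T₂ + S₂) ::ₘ y₂ → N ≤ S.card := by
    intro T S z hT hS hz
    by_contra hlt
    obtain ⟨x'', hx'', hc, hle⟩ := exists_card_le_of_le_sum hS
    obtain ⟨w, rfl⟩ := Multiset.le_iff_exists_add.1 hx''
    rw [Multiset.card_add] at hxN
    refine hcon ?_
    rw [← hz, ← Multiset.cons_add]
    refine Chained.symm (chained_of_le_sum_of_lt ih (hz ▸ hy)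
      (by rwa [Multiset.cons_add]) ?_ ?_ ?_ ?_)
    · rintro rfl
      simp at hxN; omega
    · rw [hz, Multiset.cons_add]; exact hs.symm
    · rw [hz, ← hs]; exact hn
    · rw [Multiset.sum_cons]; exact add_le_add hT hle
  have hTU : T₁ + T₂ ≤ U := hUTR ▸ Multiset.le_add_right _ _
  have hc1 : N ≤ S₁.card := key ((Multiset.le_add_right T₁ T₂).trans hTU)
    ((Multiset.le_add_right S₁ S₂).trans hSx) rfl
  have hc2 : N ≤ S₂.card := key (T := T₂) (z := (T₁ + S₁) ::ₘ y₂)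
    ((Multiset.le_add_left T₂ T₁).trans hTU)
    ((Multiset.le_add_left S₂ S₁).trans hSx) (Multiset.cons_swap _ _ _)
  obtain ⟨W₀, hW₀, hW₀0, hW₀z⟩ := hD (S₁ + S₂) (by rw [Multiset.card_add]; omega)
  obtain ⟨W, hWW, hW⟩ := exists_minZeroSum_le hW₀z hW₀0
  obtain ⟨S', hS'⟩ := Multiset.le_iff_exists_add.1 (hWW.trans hW₀)
  have hVV : (T₁ + S₁) + (T₂ + S₂) = W + (T₁ + T₂ + S') := by
    rw [show (T₁ + S₁) + (T₂ + S₂) = T₁ + T₂ + (S₁ + S₂) by abel, hS']; abel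
  have hzs : ZeroSum f (T₁ + T₂ + S') := hW.2.1.of_add (hVV ▸ hV₁.2.1.add hV₂.2.1)
  obtain ⟨t, ht, hts⟩ := exists_isFac hzs
  have hsum' : ∀ z : Multiset (Multiset P), z.sum = (T₁ + S₁) + (T₂ + S₂) →
      (U ::ₘ x').sum = (z + y₂).sum := by
    intro z hz
    rw [Multiset.sum_cons, Multiset.sum_add, hz, hs2]
  have hlink : ∀ z : Multiset (Multiset P), IsFac f z → z.sum = (T₁ + S₁) + (T₂ + S₂) →
      z.card ≤ N → Chained f N (z + y₂) ((T₁ + S₁) ::ₘ (T₂ + S₂) ::ₘ y₂) := by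
    intro z hz hzs hzc
    have := (chained_of_card_le (N := N) hz (y := {T₁ + S₁, T₂ + S₂}) (by
      simpa [IsFac] using ⟨hV₁, hV₂⟩) (by simpa using hzs) hzc (by simpa using hN)).add_left hy₂
    rw [add_comm z]
    convert this using 1
    simp [add_comm y₂]
  have hWt : (W ::ₘ t).sum = (T₁ + S₁) + (T₂ + S₂) := by rw [Multiset.sum_cons, hts, hVV]
  -- If `t` has at most one atom, `V₁V₂` and `W t` are at distance at most 2, and `U` divides the
  -- new factorization without `W`. Otherwise `V₁V₂` has a factorization of length in `[3, N]`;
  -- replacing `V₁V₂` by it lengthens `y`, so `ih'` applies.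
  rcases Nat.lt_or_ge t.card 2 with h2 | h2
  · refine hcon (Chained.trans (y := W ::ₘ t + y₂) ?_
      (hlink _ (ht.cons hW) hWt (by rw [Multiset.card_cons]; omega)))
    have e : W ::ₘ t + y₂ = (t + y₂) + {W} := by
      rw [← Multiset.singleton_add]; abel
    rw [e]
    refine chained_of_le_sum_of_lt ih hx ?_ (by simp) ?_ hn ?_
    · rw [← e]; exact (ht.cons hW).add hy₂
    · rw [← e]; exact hsum' _ hWt
    · rw [Multiset.sum_add, hts, hUTR]
      exact add_le_add (Multiset.le_add_right _ _) hRy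
  · obtain ⟨z, hz, hzs, hz3, hzN⟩ := hd _ _ hV₁ hV₂ (W ::ₘ t) (ht.cons hW) hWt
      (by rw [Multiset.card_cons]; omega)
    refine hcon (Chained.trans (ih' (z + y₂) (hz.add hy₂) (hsum' _ hzs) ?_) (hlink _ hz hzs hzN))
    simp only [Multiset.card_cons, Multiset.card_add]
    omega

/-- The bound `c ≤ max {2, ⌈D / 2⌉, ℸ}` for the monoid of zero-sum multisets. -/
theorem chained_of_davenportLE_of_dalethLE (hN : 2 ≤ N) (hD : DavenportLE f (2 * N))
    (hd : DalethLE f N) {x y : Multiset (Multiset P)} (hx : IsFac f x) (hy : IsFac f y)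
    (hs : x.sum = y.sum) : Chained f N x y := by
  have main : ∀ n, ChainedBelow f N n := by
    intro n
    induction n with
    | zero => intro x y _ _ _ h; omega
    | succ n ih =>
      intro x y hx hy hs hn
      -- Lengths are bounded by the cardinality of the product, so the inner induction can run
      -- downwards on the total length.
      induction hm : 2 * n + 1 - (x.card + y.card) using Nat.strong_induction_on
        generalizing x y with
      | _ m ihm =>
        have hxc := hx.card_le
        have hyc := hy.card_le
        have hcs := congrArg Multiset.card hs
        by_cases hxN : N < x.card
        · refine chained_of_lt_card hN hD hd ih hx hy hs (by omega) hxN fun y' hy' hs' hlt => ?_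
          have := hy'.card_le
          have := congrArg Multiset.card hs'
          exact ihm _ (by omega) x y' hx hy' hs' hn rfl
        · by_cases hyN : N < y.card
          · refine (chained_of_lt_card hN hD hd ih hy hx hs.symm (by omega) hyN
              fun x' hx' hs' hlt => ?_).symm
            have := hx'.card_le
            have := congrArg Multiset.card hs'
            exact ihm _ (by omega) y x' hy hx' hs' (by omega) rfl
          · exact chained_of_card_le hx hy hs (by omega) (by omega)
  exact main (x.sum.card + 1) x y hx hy hs (by omega)

end Chains

/-! ### From Krull monoids to zero-sum multisets -/

theorem factDist_le_iff {α : Type*} {x y : Multiset α} {n : ℕ} :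
    factDist x y ≤ n ↔ ∃ g a b, x = g + a ∧ y = g + b ∧ a.card ≤ n ∧ b.card ≤ n := by
  classical
  constructor
  · intro h
    refine ⟨x ∩ y, x - x ∩ y, y - x ∩ y, ?_, ?_, ?_⟩
    · exact (add_tsub_cancel_of_le Multiset.inter_le_left).symm
    · exact (add_tsub_cancel_of_le Multiset.inter_le_right).symm
    · unfold factDist at h
      rw [max_le_iff] at h
      convert h
  · rintro ⟨g, a, b, rfl, rfl, ha, hb⟩
    rw [factDist_add_left]
    exact (factDist_le_max _ _).trans (max_le ha hb)

theorem factDist_le_of_map {α β : Type*} {c : α → β} (hc : Function.Injective c)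
    {x y : Multiset α} {n : ℕ} (h : factDist (x.map c) (y.map c) ≤ n) : factDist x y ≤ n := by
  obtain ⟨g, a, b, h1, h2, ha, hb⟩ := factDist_le_iff.1 h
  obtain ⟨g', hg, rfl⟩ := exists_map_eq_of_le_map (h1 ▸ Multiset.le_add_right g a)
  obtain ⟨a', rfl⟩ := Multiset.le_iff_exists_add.1 hg
  obtain ⟨b', hb', rfl⟩ := exists_map_eq_of_le_map (h2 ▸ Multiset.le_add_left b (g'.map c))
  rw [Multiset.map_add] at h1
  obtain rfl := add_left_cancel h1
  rw [← Multiset.map_add] at h2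
  exact factDist_le_iff.2 ⟨g', a', b', rfl, Multiset.map_injective hc h2, by simpa using ha,
    by simpa using hb⟩

theorem toMultiset_injective {P : Type*} :
    Function.Injective (Finsupp.toMultiset : (P →₀ ℕ) → Multiset P) := by
  classical
  exact Multiset.toFinsupp.symm.injective

section Content

theorem irreducible_mk_iff {H : Type*} [CommMonoid H] {u : H} :
    Irreducible (Associates.mk u) ↔ Irreducible u := by
  simp only [irreducible_iff, Associates.isUnit_mk]
  refine and_congr Iff.rfl ⟨fun h a b hab => ?_, fun h x y hxy => ?_⟩
  · have := h (a := Associates.mk a) (b := Associates.mk b) (by rw [hab, Associates.mk_mul_mk])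
    rwa [Associates.isUnit_mk, Associates.isUnit_mk] at this
  · obtain ⟨a, rfl⟩ := Associates.mk_surjective x
    obtain ⟨b, rfl⟩ := Associates.mk_surjective y
    rw [Associates.mk_mul_mk, Associates.mk_eq_mk_iff_associated] at hxy
    obtain ⟨c, hc⟩ := hxy.symm
    simp only [Associates.isUnit_mk]
    refine (h (a := a) (b := b * c) (by rw [← hc, mul_assoc])).imp id fun hbc =>
      isUnit_of_mul_isUnit_left hbc

variable {H P : Type*} [CommMonoid H] (φ : H →* FreeMon P)

theorem FreeMon.eq_one_of_mul_eq_one {a b : FreeMon P} (h : a * b = 1) : a = 1 := by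
  have h' : a.toAdd + b.toAdd = 0 := by rw [← toAdd_mul, h]; rfl
  have := (add_eq_zero.1 h').1
  exact Multiplicative.toAdd.injective this

theorem map_eq_of_associated {a b : H} (h : Associated a b) : φ a = φ b := by
  obtain ⟨u, rfl⟩ := h
  have : φ u = 1 := FreeMon.eq_one_of_mul_eq_one (b := φ (u⁻¹ : Hˣ)) (by
    rw [← map_mul]; simp)
  rw [map_mul, this, mul_one]

/-- The multiset of prime divisors of an element of the reduced monoid. -/
noncomputable def content (x : Associates H) : Multiset P :=
  Finsupp.toMultiset (φ (Quotient.out x)).toAdd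

theorem content_mk (a : H) : content φ (Associates.mk a) = Finsupp.toMultiset (φ a).toAdd := by
  unfold content
  rw [map_eq_of_associated φ (Associates.mk_eq_mk_iff_associated.1
    (Associates.quotient_mk_eq_mk (Quotient.out (Associates.mk a)) ▸ Quotient.out_eq _))]

theorem content_one : content φ 1 = 0 := by
  rw [← Associates.mk_one, content_mk, map_one]; simp

theorem content_mul (x y : Associates H) : content φ (x * y) = content φ x + content φ y := by
  obtain ⟨a, rfl⟩ := Associates.mk_surjective x
  obtain ⟨b, rfl⟩ := Associates.mk_surjective y
  rw [Associates.mk_mul_mk, content_mk, content_mk, content_mk, map_mul, toAdd_mul,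
    map_add]

theorem content_prod (z : Multiset (Associates H)) :
    content φ z.prod = (z.map (content φ)).sum := by
  induction z using Multiset.induction with
  | empty => simp [content_one]
  | cons x z ih => simp [content_mul, ih]

variable {φ}

theorem content_injective [IsCancelMul H] (hφ : IsDivisorTheory φ) :
    Function.Injective (content φ) := by
  intro x y h
  obtain ⟨a, rfl⟩ := Associates.mk_surjective x
  obtain ⟨b, rfl⟩ := Associates.mk_surjective y
  rw [content_mk, content_mk] at h
  have h' : φ a = φ b := Multiplicative.toAdd.injective (toMultiset_injective h)
  have h1 := hφ.dvd_of_map_dvd a b (h' ▸ dvd_rfl)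
  have h2 := hφ.dvd_of_map_dvd b a (h' ▸ dvd_rfl)
  obtain ⟨c, rfl⟩ := h1
  obtain ⟨d, hd⟩ := h2
  rw [mul_assoc] at hd
  have hcd : c * d = 1 := (mul_eq_left.1 hd.symm)
  exact Associates.mk_eq_mk_iff_associated.2
    ⟨⟨c, d, hcd, by rw [mul_comm, hcd]⟩, rfl⟩

theorem toQuot_mul (a b : FreeMon P) : toQuot (a * b) = toQuot a + toQuot b := by
  ext p
  simp [toQuot]

theorem toQuot_one : toQuot (1 : FreeMon P) = 0 := by
  ext p
  simp [toQuot]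

theorem toQuot_injective : Function.Injective (toQuot : FreeMon P → P →₀ ℤ) := by
  intro a b h
  apply Multiplicative.toAdd.injective
  ext p
  have := DFunLike.congr_fun h p
  simpa [toQuot] using this

theorem exists_sub_of_mem_principal {x : P →₀ ℤ} (hx : x ∈ principal φ) :
    ∃ a b : H, x = toQuot (φ a) - toQuot (φ b) := by
  induction hx using AddSubgroup.closure_induction with
  | mem x hx =>
    obtain ⟨a, rfl⟩ := hx
    exact ⟨a, 1, by simp [toQuot_one]⟩
  | zero => exact ⟨1, 1, by simp⟩
  | add x y _ _ hx hy =>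
    obtain ⟨a, b, rfl⟩ := hx
    obtain ⟨c, d, rfl⟩ := hy
    exact ⟨a * c, b * d, by simp only [map_mul, toQuot_mul]; abel⟩
  | neg x _ hx =>
    obtain ⟨a, b, rfl⟩ := hx
    exact ⟨b, a, by abel⟩

/-- A divisor homomorphism has saturated image: `F = φ a / φ b` forces `b ∣ a`, and the cofactor
maps to `F`. -/
theorem toQuot_mem_principal_iff (hφ : IsDivisorTheory φ) {F : FreeMon P} :
    toQuot F ∈ principal φ ↔ ∃ a : H, φ a = F := by
  constructor
  · intro h
    obtain ⟨a, b, hab⟩ := exists_sub_of_mem_principal h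
    have h1 : φ a = φ b * F := toQuot_injective (by rw [toQuot_mul, hab]; abel)
    obtain ⟨c, rfl⟩ := hφ.dvd_of_map_dvd b a ⟨F, h1⟩
    exact ⟨c, mul_left_cancel ((map_mul φ b c).symm.trans h1)⟩
  · rintro ⟨a, rfl⟩
    exact AddSubgroup.subset_closure ⟨a, rfl⟩

variable (φ)

/-- The class map on primes, transported along an isomorphism of the class group. -/
noncomputable def classMap {G : Type*} [AddCommGroup G] (ψ : ClGroup φ ≃+ G) (p : P) : G :=
  ψ (divisorClass φ (prime p))

variable {φ} {G : Type*} [AddCommGroup G] {ψ : ClGroup φ ≃+ G}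

theorem sum_map_classMap (F : P →₀ ℕ) : ((Finsupp.toMultiset F).map (classMap φ ψ)).sum =
    ψ (divisorClass φ (Multiplicative.ofAdd F)) := by
  induction F using Finsupp.induction_linear with
  | zero =>
    change _ = ψ (QuotientAddGroup.mk (toQuot 1))
    rw [toQuot_one]; simp
  | add F F' h h' =>
    rw [map_add, Multiset.map_add, Multiset.sum_add, h, h', ← map_add, ofAdd_add]
    unfold divisorClass
    rw [toQuot_mul]; rfl
  | single p n =>
    induction n with
    | zero =>
      change _ = ψ (QuotientAddGroup.mk (toQuot (Multiplicative.ofAdd (Finsupp.single p 0))))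
      rw [Finsupp.single_zero, ofAdd_zero, toQuot_one]; simp
    | succ n ih =>
      rw [Finsupp.single_add, map_add, Multiset.map_add, Multiset.sum_add, ih, ofAdd_add]
      unfold divisorClass
      rw [toQuot_mul, QuotientAddGroup.mk_add, map_add]
      simp [classMap, prime, divisorClass]

theorem zeroSum_classMap_iff (hφ : IsDivisorTheory φ) {S : Multiset P} :
    ZeroSum (classMap φ ψ) S ↔ ∃ x, content φ x = S := by
  classical
  obtain ⟨F, rfl⟩ : ∃ F : P →₀ ℕ, Finsupp.toMultiset F = S :=
    ⟨Multiset.toFinsupp S, Multiset.toFinsupp_toMultiset S⟩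
  rw [ZeroSum, sum_map_classMap, EmbeddingLike.map_eq_zero_iff, divisorClass,
    QuotientAddGroup.eq_zero_iff, toQuot_mem_principal_iff hφ]
  constructor
  · rintro ⟨a, ha⟩
    exact ⟨Associates.mk a, by rw [content_mk, ha]; rfl⟩
  · rintro ⟨x, hx⟩
    obtain ⟨a, rfl⟩ := Associates.mk_surjective x
    rw [content_mk] at hx
    exact ⟨a, by rw [← (toMultiset_injective hx : (φ a).toAdd = F)]; rfl⟩

theorem minZeroSum_content_iff [IsCancelMul H] (hφ : IsDivisorTheory φ) {x : Associates H} :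
    MinZeroSum (classMap φ ψ) (content φ x) ↔ Irreducible x := by
  have hinj := content_injective hφ
  have h0 : ∀ x, content φ x = 0 ↔ x = 1 := fun x =>
    ⟨fun h => hinj (h.trans (content_one φ).symm), fun h => h ▸ content_one φ⟩
  rw [irreducible_iff]
  simp only [Associates.isUnit_iff_eq_one]
  constructor
  · rintro ⟨h1, -, h3⟩
    refine ⟨fun h => h1 ((h0 x).2 h), fun a b hab => ?_⟩
    by_contra! hne
    subst hab
    rw [content_mul] at h3
    have := h3 (content φ a) (Multiset.le_add_right _ _) (fun h => hne.1 ((h0 a).1 h))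
      ((zeroSum_classMap_iff hφ).2 ⟨a, rfl⟩)
    exact hne.2 ((h0 b).1 (by simpa using this))
  · rintro ⟨h1, h2⟩
    refine ⟨fun h => h1 ((h0 x).1 h), (zeroSum_classMap_iff hφ).2 ⟨x, rfl⟩, fun T hT hT0 hTz => ?_⟩
    obtain ⟨R, hR⟩ := Multiset.le_iff_exists_add.1 hT
    obtain ⟨b, rfl⟩ := (zeroSum_classMap_iff (ψ := ψ) hφ).1
      (hTz.of_add (hR ▸ (zeroSum_classMap_iff hφ).2 ⟨x, rfl⟩))
    obtain ⟨a, rfl⟩ := (zeroSum_classMap_iff (ψ := ψ) hφ).1 hTz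
    rw [← content_mul] at hR
    rcases h2 (hinj hR) with rfl | rfl
    · exact absurd (content_one φ) hT0
    · rw [hR, mul_one]

theorem mem_factorizations_iff [IsCancelMul H] (hφ : IsDivisorTheory φ) {a : H}
    {z : Multiset (Associates H)} : z ∈ factorizations a ↔
      IsFac (classMap φ ψ) (z.map (content φ)) ∧
        (z.map (content φ)).sum = content φ (Associates.mk a) := by
  rw [← content_prod, (content_injective hφ).eq_iff, factorizations, Set.mem_ofPred_eq]
  simp only [IsFac, Multiset.mem_map, forall_exists_index, and_imp, forall_apply_eq_imp_iff₂,
    minZeroSum_content_iff hφ]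

theorem IsFac.exists_map_content (hφ : IsDivisorTheory φ) {y : Multiset (Multiset P)}
    (hy : IsFac (classMap φ ψ) y) : ∃ z : Multiset (Associates H), z.map (content φ) = y := by
  induction y using Multiset.induction with
  | empty => exact ⟨0, rfl⟩
  | cons U y ih =>
    obtain ⟨z, rfl⟩ := ih (hy.mono (Multiset.le_cons_self _ _))
    obtain ⟨x, rfl⟩ := (zeroSum_classMap_iff (ψ := ψ) hφ).1 (hy U (by simp)).2.1
    exact ⟨x ::ₘ z, by simp⟩

theorem catenaryDegree_le_of_chained [IsCancelMul H] (hφ : IsDivisorTheory φ) {N : ℕ}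
    (h : ∀ x y : Multiset (Multiset P), IsFac (classMap φ ψ) x → IsFac (classMap φ ψ) y →
      x.sum = y.sum → Chained (classMap φ ψ) N x y) : catenaryDegree H ≤ N := by
  refine iSup_le fun a => sInf_le fun z z' => ?_
  have hz := (mem_factorizations_iff (ψ := ψ) hφ).1 z.2
  have hz' := (mem_factorizations_iff (ψ := ψ) hφ).1 z'.2
  have key : ∀ Y, Chained (classMap φ ψ) N (z.1.map (content φ)) Y →
      ∃ y : factorizations a, y.1.map (content φ) = Y ∧ Concatenated a N z y := by
    intro Y hY
    induction hY with
    | refl => exact ⟨z, rfl, Relation.ReflTransGen.refl⟩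
    | tail _ hstep ih =>
      obtain ⟨y, rfl, hy⟩ := ih
      obtain ⟨-, h2, h3, h4⟩ := hstep
      obtain ⟨w, rfl⟩ := h2.exists_map_content hφ
      have hyf := (mem_factorizations_iff (ψ := ψ) hφ).1 y.2
      refine ⟨⟨w, (mem_factorizations_iff (ψ := ψ) hφ).2 ⟨h2, h3 ▸ hyf.2⟩⟩, rfl, hy.tail ?_⟩
      exact_mod_cast factDist_le_of_map (content_injective hφ) h4
  obtain ⟨y, hy, hc⟩ := key _ (h _ _ hz.1 hz'.1 (hz.2.trans hz'.2.symm))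
  rwa [Subtype.ext (Multiset.map_injective (content_injective hφ) hy)] at hc

theorem mem_lengths_iff [IsCancelMul H] (hφ : IsDivisorTheory φ) {a : H} {n : ℕ} :
    n ∈ lengths a ↔ ∃ y, IsFac (classMap φ ψ) y ∧ y.sum = content φ (Associates.mk a) ∧
      y.card = n := by
  constructor
  · rintro ⟨z, hz, rfl⟩
    have := (mem_factorizations_iff (ψ := ψ) hφ).1 hz
    exact ⟨_, this.1, this.2, by simp⟩
  · rintro ⟨y, hy, hs, rfl⟩
    obtain ⟨z, rfl⟩ := hy.exists_map_content hφ
    exact ⟨z, (mem_factorizations_iff (ψ := ψ) hφ).2 ⟨hy, hs⟩, by simp⟩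

theorem le_daleth [IsCancelMul H] (hφ : IsDivisorTheory φ) {U V : Multiset P} {n : ℕ}
    (hU : MinZeroSum (classMap φ ψ) U) (hV : MinZeroSum (classMap φ ψ) V)
    (hex : ∃ y, IsFac (classMap φ ψ) y ∧ y.sum = U + V ∧ y.card ≠ 2)
    (hle : ∀ y, IsFac (classMap φ ψ) y → y.sum = U + V → y.card ≠ 2 → n ≤ y.card) :
    (n : ℕ∞) ≤ daleth H := by
  obtain ⟨u', rfl⟩ := (zeroSum_classMap_iff (ψ := ψ) hφ).1 hU.2.1
  obtain ⟨v', rfl⟩ := (zeroSum_classMap_iff (ψ := ψ) hφ).1 hV.2.1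
  obtain ⟨u, rfl⟩ := Associates.mk_surjective u'
  obtain ⟨v, rfl⟩ := Associates.mk_surjective v'
  rw [minZeroSum_content_iff hφ, irreducible_mk_iff] at hU hV
  have hne : (lengths (u * v) \ {2}).Nonempty := by
    obtain ⟨y, hy, hs, h2⟩ := hex
    exact ⟨y.card, (mem_lengths_iff (ψ := ψ) hφ).2
      ⟨y, hy, by rw [hs, ← Associates.mk_mul_mk, content_mul], rfl⟩, h2⟩
  have hmem := Nat.sInf_mem hne
  obtain ⟨y, hy, hs, hc⟩ := (mem_lengths_iff (ψ := ψ) hφ).1 hmem.1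
  refine le_trans ?_ (le_iSup₂_of_le u v (le_iSup₂_of_le hU hV le_rfl))
  rw [← hc]
  refine Nat.cast_le.2 (hle y hy (by rw [hs, ← Associates.mk_mul_mk, content_mul]) ?_)
  rw [hc]
  exact hmem.2

/-- A factor common to `x` and `y` would leave a single atom of `x` equal to the product of the rest
of `y`, forcing `y` to have length 2. So the gcd is trivial. -/
theorem card_le_factDist {f : P → G} {x y : Multiset (Multiset P)} (hx : IsFac f x)
    (hy : IsFac f y) (hs : x.sum = y.sum) (hx2 : x.card = 2) (hy2 : y.card ≠ 2) :
    y.card ≤ factDist x y := by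
  obtain ⟨g, a, b, rfl, rfl, -, hb⟩ := factDist_le_iff.1 (le_refl (factDist x y))
  rcases Multiset.empty_or_exists_mem g with rfl | ⟨W, hW⟩
  · simpa using hb
  · obtain ⟨g', rfl⟩ := Multiset.exists_cons_of_mem hW
    rw [Multiset.cons_add] at hx hy hs hx2 hy2
    rw [Multiset.cons_add, Multiset.sum_cons, Multiset.sum_cons] at hs
    rw [Multiset.card_cons] at hx2 hy2
    obtain ⟨W', hW'⟩ := Multiset.card_eq_one.1 (show (g' + a).card = 1 by omega)
    rw [hW', add_right_inj, Multiset.sum_singleton] at hs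
    have := (hy.mono (Multiset.le_cons_self _ _)).card_eq_one (by
      rw [← hs]; exact hx W' (by rw [hW']; simp))
    omega

/-- A chain from `uv` to a factorization of another length contains a step leaving length 2. By
`card_le_factDist`, the distance in this step is at least the new length, hence at least `min (L(uv)
\ {2})`. -/
theorem daleth_le_catenaryDegree [IsCancelMul H] (hφ : IsDivisorTheory φ) :
    daleth H ≤ catenaryDegree H := by
  refine iSup₂_le fun u v => iSup₂_le fun hu hv => ?_
  refine le_trans ?_ (le_iSup _ (u * v))
  rcases (lengths (u * v) \ {2}).eq_empty_or_nonempty with he | hne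
  · simp [he]
  obtain ⟨⟨z, hz, hzc⟩, hz2⟩ := Nat.sInf_mem hne
  refine le_sInf fun N hN => ?_
  have hz₀ : {Associates.mk u, Associates.mk v} ∈ factorizations (u * v) := by
    refine ⟨?_, by simp [Associates.mk_mul_mk]⟩
    simp only [Multiset.insert_eq_cons, Multiset.mem_cons, Multiset.mem_singleton]
    rintro w (rfl | rfl)
    · exact irreducible_mk_iff.2 hu
    · exact irreducible_mk_iff.2 hv
  have key : ∀ y : factorizations (u * v), Concatenated (u * v) N ⟨_, hz₀⟩ y → y.1.card ≠ 2 →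
      ((sInf (lengths (u * v) \ {2}) : ℕ) : ℕ∞) ≤ N := by
    intro y hy
    induction hy with
    | refl => intro h; simp at h
    | @tail x y _ hstep ih =>
      intro hy2
      by_cases hx2 : x.1.card = 2
      · refine le_trans (Nat.cast_le.2 ?_) hstep
        have hle : sInf (lengths (u * v) \ {2}) ≤ y.1.card := Nat.sInf_le ⟨⟨_, y.2, rfl⟩, hy2⟩
        refine hle.trans ?_
        have hx := (mem_factorizations_iff (ψ := AddEquiv.refl _) hφ).1 x.2
        have hy := (mem_factorizations_iff (ψ := AddEquiv.refl _) hφ).1 y.2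
        obtain ⟨g, a, b, h1, h2, ha, hb⟩ := factDist_le_iff.1 (le_refl (factDist x.1 y.1))
        have := card_le_factDist hx.1 hy.1 (hx.2.trans hy.2.symm) (by simpa using hx2)
          (by simpa using hy2)
        rw [Multiset.card_map] at this
        refine this.trans (factDist_le_iff.2 ⟨g.map (content φ), a.map (content φ),
          b.map (content φ), ?_, ?_, by simpa using ha, by simpa using hb⟩)
        · rw [h1, Multiset.map_add]
        · rw [h2, Multiset.map_add]
      · exact ih hx2
  exact key ⟨z, hz⟩ (hN _ _) (by rw [hzc]; exact hz2)

end Content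

/-! ### Lower bounds for `daleth` -/

section Refine

variable {P G : Type*} [AddCommGroup G] {f : P → G}

theorem exists_isFac_card_ge {z : Multiset (Multiset P)} (hz : ∀ S ∈ z, S ≠ 0 ∧ ZeroSum f S) :
    ∃ y, IsFac f y ∧ y.sum = z.sum ∧ z.card ≤ y.card := by
  induction z using Multiset.induction with
  | empty => exact ⟨0, IsFac.zero, rfl, le_rfl⟩
  | cons S z ih =>
    obtain ⟨y, hy, hs, hc⟩ := ih fun T hT => hz T (Multiset.mem_cons_of_mem hT)
    obtain ⟨h0, hS⟩ := hz S (by simp)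
    obtain ⟨x, hx, rfl⟩ := exists_isFac hS
    have : 0 < x.card := Multiset.card_pos.2 fun h => h0 (by simp [h])
    refine ⟨x + y, hx.add hy, by simp [hs], ?_⟩
    simp only [Multiset.card_cons, Multiset.card_add]
    omega

end Refine

section LowerBound

variable {G : Type*} [AddCommGroup G]

/-- Two submultisets of `U` with equal sum are equal or complementary. -/
def SumSeparated (U : Multiset G) : Prop :=
  ∀ X ≤ U, ∀ Y ≤ U, X.sum = Y.sum → X = Y ∨ X + Y = U

theorem card_le_sum_map_of_forall_le_one {α : Type*} {w : Multiset α} {c : α → ℕ}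
    (h : ∀ p ∈ w, c p ≤ 1) : (w.map c).sum ≤ w.card := by
  simpa using Multiset.sum_le_card_nsmul (w.map c) 1 (by simpa using h)

theorem card_sum_map {α P : Type*} (w : Multiset α) (c : α → Multiset P) :
    (w.map c).sum.card = (w.map fun p => (c p).card).sum := by
  induction w using Multiset.induction with
  | empty => simp
  | cons a w ih => simp [ih]

theorem le_sum_map_of_mem {α P : Type*} {w : Multiset α} (c : α → Multiset P) {p : α}
    (hp : p ∈ w) : c p ≤ (w.map c).sum := by
  obtain ⟨w', rfl⟩ := Multiset.exists_cons_of_mem hp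
  simp

/-- Each atom of `y` has a part from `U` and a part from `-U`, whose classes give two subsums of `U`
that agree. If every atom uses at most one element of `U`, the bound is immediate. Otherwise some
atom has disjoint, hence complementary, parts; the remaining elements then form the mirrored
situation, which admits only one further atom, so `y` would have length 2. -/
theorem SumSeparated.card_le {P : Type*} {f : P → G} {U : Multiset G} (hU : SumSeparated U)
    {U' V' : Multiset P} (hU' : U'.map f = U) (hV' : (V'.map f).map (fun g => -g) = U)
    {y : Multiset (Multiset P)} (hy : IsFac f y) (hs : y.sum = U' + V') (hy2 : y.card ≠ 2) :
    U.card ≤ y.card := by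
  obtain ⟨w, rfl, rfl, rfl⟩ := exists_split_of_sum_eq_add hs
  have hatom : ∀ p ∈ w, MinZeroSum f (p.1 + p.2) := fun p hp => hy _ (Multiset.mem_map_of_mem _ hp)
  by_cases hall : ∀ p ∈ w, p.1.card ≤ 1
  · rw [← hU', Multiset.card_map, card_sum_map, Multiset.card_map]
    exact card_le_sum_map_of_forall_le_one hall
  push Not at hall
  obtain ⟨p, hp, hp1⟩ := hall
  -- the two halves of a piece
  have hX : ∀ p ∈ w, p.1.map f ≤ U := fun p hp => by
    rw [← hU']; exact Multiset.map_le_map (le_sum_map_of_mem _ hp)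
  have hY : ∀ p ∈ w, (p.2.map f).map (fun g => -g) ≤ U := fun p hp => by
    rw [← hV']
    exact Multiset.map_le_map (Multiset.map_le_map (le_sum_map_of_mem _ hp))
  have hXY : ∀ p ∈ w, (p.1.map f).sum = ((p.2.map f).map (fun g => -g)).sum := fun p hp => by
    have h := (hatom p hp).2.1
    rw [ZeroSum, Multiset.map_add, Multiset.sum_add] at h
    rw [Multiset.sum_map_neg', eq_neg_of_add_eq_zero_left h]
  -- A common class yields a zero-sum pair inside the atom, which would be the whole atom, whereas
  -- `p.1` has two elements or more.
  have hcommon : ∀ x, x ∈ p.1.map f → x ∈ (p.2.map f).map (fun g => -g) → False := by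
    intro x h1 h2
    obtain ⟨a, ha, rfl⟩ := Multiset.mem_map.1 h1
    rw [Multiset.map_map] at h2
    obtain ⟨b, hb, hab⟩ := Multiset.mem_map.1 h2
    have hle : ({a} + {b} : Multiset P) ≤ p.1 + p.2 :=
      add_le_add (Multiset.singleton_le.2 ha) (Multiset.singleton_le.2 hb)
    have h3 := (hatom p hp).2.2 _ hle (by simp) (by
      simp only [Function.comp_apply] at hab
      simp [ZeroSum, ← hab])
    have h4 := congrArg Multiset.card h3
    have h5 : 0 < p.2.card := Multiset.card_pos_iff_exists_mem.2 ⟨b, hb⟩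
    simp only [Multiset.card_add, Multiset.card_singleton] at h4
    omega
  have hcompl : p.1.map f + (p.2.map f).map (fun g => -g) = U := by
    rcases hU _ (hX p hp) _ (hY p hp) (hXY p hp) with h | h
    · obtain ⟨a, ha⟩ := Multiset.card_pos_iff_exists_mem.1 (show 0 < p.1.card by omega)
      exact (hcommon (f a) (Multiset.mem_map_of_mem f ha)
        (h ▸ Multiset.mem_map_of_mem f ha)).elim
    · exact h
  obtain ⟨w', rfl⟩ := Multiset.exists_cons_of_mem hp
  simp only [Multiset.map_cons, Multiset.sum_cons, Multiset.map_add] at hU' hV'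
  have h1 : ((w'.map Prod.fst).sum).map f = (p.2.map f).map (fun g => -g) :=
    add_left_cancel (hU'.trans hcompl.symm)
  have h2 : (((w'.map Prod.snd).sum).map f).map (fun g => -g) = p.1.map f := by
    apply add_left_cancel (hV'.trans _)
    rw [← hcompl, add_comm]
  have hc1 := congrArg Multiset.card h1
  have hc2 := congrArg Multiset.card h2
  simp only [Multiset.card_map] at hc1 hc2
  obtain ⟨q, hq⟩ : ∃ q, q ∈ w' := by
    rcases Multiset.empty_or_exists_mem w' with rfl | h
    · simp at hc2; omega
    · exact h
  have hqw : q ∈ p ::ₘ w' := Multiset.mem_cons_of_mem hq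
  have hqle1 : q.1.map f ≤ (p.2.map f).map (fun g => -g) := by
    rw [← h1]; exact Multiset.map_le_map (le_sum_map_of_mem _ hq)
  have hqle2 : (q.2.map f).map (fun g => -g) ≤ p.1.map f := by
    rw [← h2]; exact Multiset.map_le_map (Multiset.map_le_map (le_sum_map_of_mem _ hq))
  obtain ⟨w'', rfl⟩ := Multiset.exists_cons_of_mem hq
  rcases hU _ (hX q hqw) _ (hY q hqw) (hXY q hqw) with h | h
  · rcases Multiset.empty_or_exists_mem q.1 with h0 | ⟨a, ha⟩
    · rw [h0, Multiset.map_zero] at h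
      have := congrArg Multiset.card h
      simp only [Multiset.card_map, Multiset.card_zero] at this
      exact absurd (by rw [h0, Multiset.card_eq_zero.1 this.symm]; rfl) (hatom q hqw).1
    · have ha' := Multiset.mem_map_of_mem f ha
      exact (hcommon (f a) (Multiset.mem_of_le hqle2 (h ▸ ha')) (Multiset.mem_of_le hqle1 ha')).elim
  · rcases Multiset.empty_or_exists_mem w'' with rfl | ⟨r, hr⟩
    · simp at hy2
    · have hr' := Multiset.card_pos.2 (hatom r (by simp [hr])).1
      have e1 := Multiset.card_le_card (le_sum_map_of_mem Prod.fst hr)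
      have e2 := Multiset.card_le_card (le_sum_map_of_mem Prod.snd hr)
      have e3 := congrArg Multiset.card (h.trans hcompl.symm)
      simp only [Multiset.map_cons, Multiset.sum_cons, Multiset.card_add, Multiset.card_map]
        at hc1 hc2 e3 hr'
      omega

theorem SumSeparated.card_le_daleth {H P : Type*} [CommMonoid H] [IsCancelMul H]
    {φ : H →* FreeMon P} (hφ : IsDivisorTheory φ) {ψ : ClGroup φ ≃+ G}
    (hsurj : Function.Surjective (classMap φ ψ)) {U : Multiset G} (hU : SumSeparated U)
    (hs : U.sum = 0) (h3 : 3 ≤ U.card) : (U.card : ℕ∞) ≤ daleth H := by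
  obtain ⟨σ, hσ⟩ := hsurj.hasRightInverse
  set f := classMap φ ψ
  have hσ' : f ∘ σ = id := funext hσ
  have hU0 : U ≠ 0 := by rintro rfl; simp at h3
  have hmin : ∀ X ≤ U, X ≠ 0 → X.sum = 0 → X = U := by
    intro X hX hX0 hXs
    rcases hU X hX 0 (Multiset.zero_le _) (by simpa using hXs) with h | h
    · exact absurd h hX0
    · simpa using h
  have h1 : (U.map σ).map f = U := by rw [Multiset.map_map, hσ', Multiset.map_id]
  have h2' : (U.map fun g => σ (-g)).map f = U.map fun g => -g := by
    rw [Multiset.map_map]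
    exact Multiset.map_congr rfl fun g _ => hσ (-g)
  have h2 : ((U.map fun g => σ (-g)).map f).map (fun g => -g) = U := by
    rw [h2', Multiset.map_map]; simp
  refine le_daleth hφ (U := U.map σ) (V := U.map fun g => σ (-g)) ⟨?_, ?_, ?_⟩ ⟨?_, ?_, ?_⟩ ?_
    fun y hy hys hy2 => hU.card_le h1 h2 hy hys hy2
  · simpa using hU0
  · rw [ZeroSum, h1, hs]
  · intro T hT hT0 hTz
    obtain ⟨S, hS, rfl⟩ := exists_map_eq_of_le_map hT
    rw [hmin S hS (by simpa using hT0) (by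
      rwa [ZeroSum, Multiset.map_map, hσ', Multiset.map_id] at hTz)]
  · simpa using hU0
  · rw [ZeroSum, h2', Multiset.sum_map_neg, Multiset.map_id', hs, neg_zero]
  · intro T hT hT0 hTz
    obtain ⟨S, hS, rfl⟩ := exists_map_eq_of_le_map hT
    rw [hmin S hS (by simpa using hT0) ?_]
    have : (S.map fun g => σ (-g)).map f = S.map fun g => -g := by
      rw [Multiset.map_map]
      exact Multiset.map_congr rfl fun g _ => hσ (-g)
    rw [ZeroSum, this, Multiset.sum_map_neg, Multiset.map_id', neg_eq_zero] at hTz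
    exact hTz
  -- The pairs `g + (-g)` decompose `U(-U)` into `|U| ≥ 3` zero-sum parts, so a length other than 2
  -- does occur.
  · obtain ⟨y, hy, hys, hyc⟩ := exists_isFac_card_ge (f := f)
      (z := U.map fun g => {σ g} + {σ (-g)}) (by
        intro S hS
        obtain ⟨g, -, rfl⟩ := Multiset.mem_map.1 hS
        refine ⟨by simp, ?_⟩
        simp [ZeroSum, show ∀ g, f (σ g) = g from hσ])
    refine ⟨y, hy, ?_, ?_⟩
    · have h (k : G → P) : (U.map fun g => ({k g} : Multiset P)).sum = U.map k := by
        rw [← Multiset.sum_map_singleton (U.map k), Multiset.map_map]; rfl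
      rw [hys, Multiset.sum_map_add, h, h]
    · rw [Multiset.card_map] at hyc
      omega

/-- Among the multiples `i • g` with `0 ≤ i ≤ n`, the only coincidence is between `i = 0` and `i =
n`, which are complementary. -/
theorem sumSeparated_replicate {g : G} {n : ℕ} (hn : addOrderOf g = n) :
    SumSeparated (Multiset.replicate n g) := by
  intro X hX Y hY hXY
  obtain ⟨a, ha, rfl⟩ := Multiset.le_replicate_iff.1 hX
  obtain ⟨b, hb, rfl⟩ := Multiset.le_replicate_iff.1 hY
  rw [Multiset.sum_replicate, Multiset.sum_replicate, nsmul_inj_mod, hn] at hXY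
  rw [← Multiset.replicate_add]
  rcases ha.lt_or_eq with ha | rfl <;> rcases hb.lt_or_eq with hb | rfl
  · rw [Nat.mod_eq_of_lt ha, Nat.mod_eq_of_lt hb] at hXY
    exact Or.inl (by rw [hXY])
  · rw [Nat.mod_eq_of_lt ha, Nat.mod_self] at hXY
    exact Or.inr (by rw [hXY, zero_add])
  · rw [Nat.mod_eq_of_lt hb, Nat.mod_self] at hXY
    exact Or.inr (by rw [← hXY, add_zero])
  · exact Or.inl rfl

/-- All submultisets of `S` have distinct sums, and two of them have opposite sums only if they
are equal. -/
def Dissociated (S : Multiset G) : Prop :=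
  (∀ A ≤ S, ∀ B ≤ S, A.sum = B.sum → A = B) ∧ ∀ A ≤ S, ∀ B ≤ S, A.sum + B.sum = 0 → A = B

theorem dissociated_zero : Dissociated (0 : Multiset G) := by
  constructor <;>
  · intro A hA B hB _
    rw [Multiset.le_zero.1 hA, Multiset.le_zero.1 hB]

/-- If only one of the two parts contains `-S.sum`, the equation says that the other part and the
complement in `S` of the first have opposite sums. The second half of dissociation makes them equal.
-/
theorem Dissociated.sumSeparated {S : Multiset G} (hS : Dissociated S) :
    SumSeparated (S + {-S.sum}) := by
  have key : ∀ A ≤ S, ∀ B ≤ S, A.sum + -S.sum = B.sum → A + B = S := by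
    intro A hA B hB h
    obtain ⟨C, rfl⟩ := Multiset.le_iff_exists_add.1 hA
    have := hS.2 B hB C (Multiset.le_add_left _ _) (by
      rw [← h, Multiset.sum_add]; abel)
    rw [this]
  intro X hX Y hY hXY
  obtain ⟨A, hA, E, hE, rfl⟩ := exists_add_of_le_add hX
  obtain ⟨B, hB, F, hF, rfl⟩ := exists_add_of_le_add hY
  rcases Multiset.le_singleton.1 hE with rfl | rfl <;>
    rcases Multiset.le_singleton.1 hF with rfl | rfl
  · exact Or.inl (by rw [hS.1 A hA B hB (by simpa using hXY)])
  · right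
    rw [← key B hB A hA (by simpa using hXY.symm)]
    abel_nf
  · right
    rw [← key A hA B hB (by simpa using hXY)]
    abel_nf
  · exact Or.inl (by rw [hS.1 A hA B hB (by simpa using hXY)])

theorem Dissociated.add_replicate {S : Multiset G} (hS : Dissociated S) {g : G} {m : ℕ}
    (h1 : ∀ A ≤ S, ∀ B ≤ S, ∀ i, 0 < i → i ≤ m → A.sum ≠ B.sum + i • g)
    (h2 : ∀ A ≤ S, ∀ B ≤ S, ∀ i ≤ m, ∀ j ≤ m, A.sum + B.sum + (i + j) • g = 0 →
      i = j ∧ (i + j) • g = 0) : Dissociated (S + Multiset.replicate m g) := by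
  constructor
  · intro X hX Y hY hXY
    obtain ⟨A, hA, E, hE, rfl⟩ := exists_add_of_le_add hX
    obtain ⟨B, hB, F, hF, rfl⟩ := exists_add_of_le_add hY
    obtain ⟨i, hi, rfl⟩ := Multiset.le_replicate_iff.1 hE
    obtain ⟨j, hj, rfl⟩ := Multiset.le_replicate_iff.1 hF
    simp only [Multiset.sum_add, Multiset.sum_replicate] at hXY
    rcases lt_trichotomy i j with h | rfl | h
    · obtain ⟨k, rfl⟩ := Nat.exists_eq_add_of_lt h
      refine absurd ?_ (h1 A hA B hB (k + 1) (by omega) (by omega))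
      rw [add_assoc, add_nsmul] at hXY
      apply add_right_cancel (b := i • g)
      rw [hXY]; abel
    · rw [hS.1 A hA B hB (add_right_cancel hXY)]
    · obtain ⟨k, rfl⟩ := Nat.exists_eq_add_of_lt h
      refine absurd ?_ (h1 B hB A hA (k + 1) (by omega) (by omega))
      rw [add_assoc j, add_nsmul] at hXY
      apply add_right_cancel (b := j • g)
      rw [← hXY]; abel
  · intro X hX Y hY hXY
    obtain ⟨A, hA, E, hE, rfl⟩ := exists_add_of_le_add hX
    obtain ⟨B, hB, F, hF, rfl⟩ := exists_add_of_le_add hY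
    obtain ⟨i, hi, rfl⟩ := Multiset.le_replicate_iff.1 hE
    obtain ⟨j, hj, rfl⟩ := Multiset.le_replicate_iff.1 hF
    simp only [Multiset.sum_add, Multiset.sum_replicate] at hXY
    have hXY' : A.sum + B.sum + (i + j) • g = 0 := by
      rw [← hXY, add_nsmul]; abel
    obtain ⟨rfl, h0⟩ := h2 A hA B hB i hi j hj hXY'
    rw [hS.2 A hA B hB (by rwa [h0, add_zero] at hXY')]

/-- Modulo `K` all subsums of `S` vanish, so only multiples of `g` have to be controlled. -/
theorem Dissociated.add_replicate_of_notMem {S : Multiset G} (hS : Dissociated S)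
    {K : AddSubgroup G} (hK : ∀ x ∈ S, x ∈ K) {g : G} {m : ℕ}
    (h1 : ∀ i, 0 < i → i ≤ m → i • g ∉ K)
    (h2 : ∀ i ≤ m, ∀ j ≤ m, (i + j) • g ∈ K → i = j ∧ (i + j) • g = 0) :
    Dissociated (S + Multiset.replicate m g) := by
  have hsum : ∀ A ≤ S, A.sum ∈ K := fun A hA =>
    AddSubgroup.multiset_sum_mem K A fun x hx => hK x (Multiset.mem_of_le hA hx)
  refine hS.add_replicate (fun A hA B hB i h0 hi h => h1 i h0 hi ?_)
    fun A hA B hB i hi j hj h => h2 i hi j hj ?_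
  · rw [← sub_eq_iff_eq_add'.2 h]
    exact K.sub_mem (hsum A hA) (hsum B hB)
  · rw [eq_neg_of_add_eq_zero_right h]
    exact K.neg_mem (K.add_mem (hsum A hA) (hsum B hB))

theorem Dissociated.add_singleton_of_notMem {S : Multiset G} (hS : Dissociated S)
    {K : AddSubgroup G} (hK : ∀ x ∈ S, x ∈ K) {g : G} (h1 : g ∉ K)
    (h2 : 2 • g ∈ K → 2 • g = 0) : Dissociated (S + {g}) := by
  refine hS.add_replicate_of_notMem (m := 1) hK (fun i h0 hi => ?_) fun i hi j hj h => ?_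
  · obtain rfl : i = 1 := by omega
    simpa using h1
  · interval_cases i <;> interval_cases j
    · simp
    · simp [h1] at h
    · simp [h1] at h
    · exact ⟨rfl, h2 h⟩

/-- An element of order 4 modulo `K` may be adjoined twice: the only nonempty opposite sums are `2g
+ 2g = 0`, from equal parts. -/
theorem Dissociated.add_pair_of_notMem {S : Multiset G} (hS : Dissociated S)
    {K : AddSubgroup G} (hK : ∀ x ∈ S, x ∈ K) {g : G} (h1 : 2 • g ∉ K) (h4 : 4 • g = 0) :
    Dissociated (S + Multiset.replicate 2 g) := by
  have h1' : g ∉ K := fun h => h1 (K.nsmul_mem h 2)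
  have h3 : 3 • g ∉ K := fun h => h1' (by
    have : g = 4 • g - 3 • g := by abel
    rw [this, h4, zero_sub]
    exact K.neg_mem h)
  refine hS.add_replicate_of_notMem (m := 2) hK (fun i h0 hi => ?_) fun i hi j hj h => ?_
  · interval_cases i
    · simpa using h1'
    · exact h1
  · interval_cases i <;> interval_cases j <;> simp_all

theorem Dissociated.card_lt_daleth {H P : Type*} [CommMonoid H] [IsCancelMul H]
    {φ : H →* FreeMon P} (hφ : IsDivisorTheory φ) {ψ : ClGroup φ ≃+ G}
    (hsurj : Function.Surjective (classMap φ ψ)) {S : Multiset G} (hS : Dissociated S)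
    (h2 : 2 ≤ S.card) : ((S.card + 1 : ℕ) : ℕ∞) ≤ daleth H := by
  have := hS.sumSeparated.card_le_daleth hφ hsurj (by simp) (by simpa using h2)
  simpa using this

theorem exists_dissociated_card [Infinite G] (n : ℕ) :
    ∃ S : Multiset G, Dissociated S ∧ S.card = n := by
  classical
  induction n with
  | zero => exact ⟨0, dissociated_zero, rfl⟩
  | succ n ih =>
    obtain ⟨S, hS, rfl⟩ := ih
    let D : Set G := (fun p : Multiset G × Multiset G => p.1.sum - p.2.sum) ''
      (Set.Iic S ×ˢ Set.Iic S)
    let E : Set G := (fun p : Multiset G × Multiset G => -(p.1.sum + p.2.sum)) ''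
      (Set.Iic S ×ˢ Set.Iic S)
    have hfin : (Set.Iic S).Finite := (Multiset.powerset S).toFinset.finite_toSet.subset
      fun X hX => by simpa using hX
    have hDE : (D ∪ E).Finite := ((hfin.prod hfin).image _).union ((hfin.prod hfin).image _)
    -- If the 2-torsion is finite, doubling has finite fibres and `2g` can avoid the finite set too.
    -- If it is infinite, `g` is chosen inside it.
    obtain ⟨g, hg, hg2⟩ : ∃ g : G, g ∉ D ∪ E ∧ (2 • g ∈ D ∪ E → 2 • g = 0) := by
      by_cases hK : {g : G | 2 • g = 0}.Finite
      · have hpre : ((fun g : G => 2 • g) ⁻¹' (D ∪ E)).Finite := by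
          refine hDE.preimage' fun b _ => ?_
          rcases ((fun g : G => 2 • g) ⁻¹' {b}).eq_empty_or_nonempty with he | ⟨a, ha⟩
          · rw [he]; exact Set.finite_empty
          · refine (hK.image fun x => x + a).subset fun x hx => ⟨x - a, ?_, by simp⟩
            simp only [Set.mem_preimage, Set.mem_singleton_iff] at ha hx
            change 2 • (x - a) = 0
            rw [nsmul_sub, hx, ha, sub_self]
        obtain ⟨g, hg⟩ := (hDE.union hpre).exists_notMem
        exact ⟨g, fun h => hg (Or.inl h), fun h => absurd (Or.inr h) hg⟩
      · obtain ⟨g, hg, hg'⟩ := (show {g : G | 2 • g = 0}.Infinite from hK).exists_notMem_finite hDE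
        exact ⟨g, hg', fun _ => hg⟩
    refine ⟨S + {g}, hS.add_replicate (m := 1) ?_ ?_, by simp⟩
    · intro A hA B hB i h0 hi h
      obtain rfl : i = 1 := by omega
      refine hg (Or.inl ⟨(A, B), ⟨hA, hB⟩, ?_⟩)
      simp [h]
    · intro A hA B hB i hi j hj h
      have hmem : (i + j) • g ∈ E := ⟨(A, B), ⟨hA, hB⟩, (eq_neg_of_add_eq_zero_right h).symm⟩
      interval_cases i <;> interval_cases j
      · simp
      · exact absurd (Or.inr (by simpa using hmem)) hg
      · exact absurd (Or.inr (by simpa using hmem)) hg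
      · exact ⟨rfl, hg2 (Or.inr hmem)⟩

theorem addOrderOf_le_daleth {H P : Type*} [CommMonoid H] [IsCancelMul H]
    {φ : H →* FreeMon P} (hφ : IsDivisorTheory φ) {ψ : ClGroup φ ≃+ G}
    (hsurj : Function.Surjective (classMap φ ψ)) (g : G) (h3 : 3 ≤ addOrderOf g) :
    (addOrderOf g : ℕ∞) ≤ daleth H := by
  have := (sumSeparated_replicate (g := g) rfl).card_le_daleth hφ hsurj
    (by rw [Multiset.sum_replicate, addOrderOf_nsmul_eq_zero]) (by simpa using h3)
  simpa using this

theorem daleth_eq_top_of_infinite [Infinite G] {H P : Type*} [CommMonoid H] [IsCancelMul H]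
    {φ : H →* FreeMon P} (hφ : IsDivisorTheory φ) {ψ : ClGroup φ ≃+ G}
    (hsurj : Function.Surjective (classMap φ ψ)) : daleth H = ⊤ := by
  refine ENat.eq_top_iff_forall_ge.2 fun n => ?_
  obtain ⟨S, hS, hc⟩ := exists_dissociated_card (G := G) (n + 2)
  refine le_trans (Nat.cast_le.2 ?_) (hS.card_lt_daleth hφ hsurj (by omega))
  omega

end LowerBound

/-! ### Upper bounds for the Davenport constant -/

section Davenport

variable {P G : Type*} [AddCommGroup G] {f : P → G}

theorem exists_fin_map_eq {α : Type*} (S : Multiset α) :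
    ∃ s : Fin S.card → α, S = (Finset.univ : Finset (Fin S.card)).val.map s := by
  obtain ⟨l, rfl⟩ := Quot.exists_rep S
  refine ⟨l.get, ?_⟩
  have h := Fin.univ_val_map l.get
  rw [List.ofFn_get] at h
  exact h.symm

theorem val_map_le {α ι : Type*} [Fintype ι] (s : ι → α) (T : Finset ι) :
    T.val.map s ≤ (Finset.univ : Finset ι).val.map s :=
  Multiset.map_le_map (Finset.val_le_iff.2 (Finset.subset_univ T))

theorem DavenportLE.mono {m n : ℕ} (h : DavenportLE f m) (hmn : m ≤ n) : DavenportLE f n :=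
  fun S hS => h S (hmn.trans hS)

theorem davenportLE_of_id {n : ℕ} (h : DavenportLE (id : G → G) n) : DavenportLE f n := by
  intro S hS
  obtain ⟨T, hT, hT0, hTz⟩ := h (S.map f) (by simpa using hS)
  obtain ⟨R, hR, rfl⟩ := exists_map_eq_of_le_map hT
  exact ⟨R, hR, by rintro rfl; simp at hT0, by simpa [ZeroSum] using hTz⟩

theorem DavenportLE.card_le {n : ℕ} (h : DavenportLE f n) {U : Multiset P}
    (hU : MinZeroSum f U) : U.card ≤ n := by
  obtain ⟨a, ha⟩ := Multiset.exists_mem_of_ne_zero hU.1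
  obtain ⟨R, rfl⟩ := Multiset.exists_cons_of_mem ha
  by_contra hn
  rw [Multiset.card_cons] at hn
  obtain ⟨T, hT, hT0, hTz⟩ := h R (by omega)
  have := hU.2.2 T (hT.trans (Multiset.le_cons_self _ _)) hT0 hTz
  have hc := Multiset.card_le_card hT
  rw [this, Multiset.card_cons] at hc
  omega

/-- Pigeonhole on the `S.card + 1` initial partial sums: two agree, and the segment between them has
sum zero. -/
theorem davenportLE_natCard [Finite G] : DavenportLE f (Nat.card G) := by
  classical
  have := Fintype.ofFinite G
  intro S hS
  rw [Nat.card_eq_fintype_card] at hS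
  obtain ⟨s, hs⟩ := exists_fin_map_eq S
  let c : Fin (S.card + 1) → G := fun k => ∑ i : Fin S.card with i.1 < k.1, f (s i)
  obtain ⟨k, l, hkl, hc⟩ := Fintype.exists_ne_map_eq_of_card_lt c (by simpa using by omega)
  wlog h : k < l generalizing k l
  · exact this l k hkl.symm hc.symm (lt_of_le_of_ne (not_lt.1 h) hkl.symm)
  have hsub : (Finset.univ.filter fun i : Fin S.card => i.1 < k.1) ⊆
      Finset.univ.filter fun i : Fin S.card => i.1 < l.1 := fun i hi => by
    simp only [Finset.mem_filter, Finset.mem_univ, true_and] at hi ⊢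
    exact hi.trans h
  refine ⟨((Finset.univ.filter fun i : Fin S.card => i.1 < l.1) \
    (Finset.univ.filter fun i : Fin S.card => i.1 < k.1)).val.map s, ?_, ?_, ?_⟩
  · conv_rhs => rw [hs]
    exact val_map_le _ _
  · intro h0
    rw [Multiset.map_eq_zero, Finset.val_eq_zero, Finset.sdiff_eq_empty_iff_subset] at h0
    have hk : k.1 < S.card := by have := l.2; omega
    have := @h0 ⟨k.1, hk⟩ (by simpa using h)
    simp at this
  · have := Finset.sum_sdiff (f := fun i => f (s i)) hsub
    rw [ZeroSum, Multiset.map_map]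
    change (Finset.sum _ fun i => f (s i)) = 0
    change c k = c l at hc
    simp only [c] at hc
    rw [← hc] at this
    simpa using this

/-- Chevalley–Warning for the coordinates of `∑ xᵢ^(p-1) f(sᵢ)`: there are `finrank` polynomials of
degree at most `p - 1`, so beside `0` there is another common zero. Since `xᵢ^(p-1)` is 0 or 1, its
support is a zero-sum submultiset. -/
theorem davenportLE_finrank (p : ℕ) [Fact p.Prime] [Module (ZMod p) G]
    [Module.Finite (ZMod p) G] :
    DavenportLE f (Module.finrank (ZMod p) G * (p - 1) + 1) := by
  classical
  intro S hS
  obtain ⟨s, hs⟩ := exists_fin_map_eq S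
  set b := Module.finBasis (ZMod p) G
  let F : Fin (Module.finrank (ZMod p) G) → MvPolynomial (Fin S.card) (ZMod p) :=
    fun k => ∑ i, MvPolynomial.C (b.repr (f (s i)) k) * MvPolynomial.X i ^ (p - 1)
  have hdeg : ∀ k, (F k).totalDegree ≤ p - 1 := fun k => by
    refine MvPolynomial.totalDegree_finsetSum_le fun i _ => ?_
    refine (MvPolynomial.totalDegree_mul _ _).trans ?_
    rw [MvPolynomial.totalDegree_C, zero_add, MvPolynomial.totalDegree_X_pow]
  have hlt : ∑ k, (F k).totalDegree < Fintype.card (Fin S.card) := by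
    refine (Finset.sum_le_card_nsmul _ _ (p - 1) fun k _ => hdeg k).trans_lt ?_
    simpa using hS
  have hp := char_dvd_card_solutions_of_fintype_sum_lt p hlt
  have hp1 := (Fact.out : p.Prime).one_lt
  have heval : ∀ x k, MvPolynomial.eval x (F k) = ∑ i, b.repr (f (s i)) k * x i ^ (p - 1) := by
    intro x k
    simp [F, map_sum]
  have hcard : 1 < Fintype.card {x : Fin S.card → ZMod p // ∀ k, MvPolynomial.eval x (F k) = 0} := by
    refine hp1.trans_le (Nat.le_of_dvd (Fintype.card_pos_iff.2 ⟨⟨0, fun k => ?_⟩⟩) (by convert hp))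
    rw [heval]
    refine Finset.sum_eq_zero fun i _ => ?_
    rw [Pi.zero_apply, zero_pow (by omega), mul_zero]
  obtain ⟨⟨x, hx⟩, hne⟩ := Fintype.exists_ne_of_one_lt_card hcard ⟨0, fun k => by
    rw [heval]
    refine Finset.sum_eq_zero fun i _ => ?_
    rw [Pi.zero_apply, zero_pow (by omega), mul_zero]⟩
  have hx0 : x ≠ 0 := fun h => hne (Subtype.ext h)
  obtain ⟨j, hj⟩ := Function.ne_iff.1 hx0
  refine ⟨(Finset.univ.filter fun i => x i ≠ 0).val.map s, ?_, ?_, ?_⟩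
  · conv_rhs => rw [hs]
    exact val_map_le _ _
  · intro h0
    rw [Multiset.map_eq_zero, Finset.val_eq_zero, Finset.filter_eq_empty_iff] at h0
    exact h0 (Finset.mem_univ j) hj
  · rw [ZeroSum, Multiset.map_map]
    change (Finset.sum _ fun i => f (s i)) = 0
    apply b.repr.injective
    ext k
    have h := hx k
    rw [heval] at h
    rw [map_sum, Finsupp.finsetSum_apply, Finset.sum_filter, map_zero, Finsupp.zero_apply]
    refine Eq.trans ?_ h
    refine Finset.sum_congr rfl fun i _ => ?_
    split_ifs with hi
    · rw [ZMod.pow_card_sub_one_eq_one hi, mul_one]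
    · rw [not_not.1 hi, zero_pow (by omega), mul_zero]

theorem two_mul_card_le_card_sum {z : Multiset (Multiset P)} (h : ∀ W ∈ z, 2 ≤ W.card) :
    2 * z.card ≤ z.sum.card := by
  induction z using Multiset.induction with
  | empty => simp
  | cons W z ih =>
    have h1 := ih fun T hT => h T (Multiset.mem_cons_of_mem hT)
    have h2 := h W (by simp)
    simp only [Multiset.card_cons, Multiset.sum_cons, Multiset.card_add]
    omega

/-- A one-element atom would equal `U` or `V`. What remains is then an atom, and `z` would have
length 2. -/
theorem IsFac.two_le_card_of_mem {z : Multiset (Multiset P)} (hz : IsFac f z) {U V : Multiset P}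
    (hU : MinZeroSum f U) (hV : MinZeroSum f V) (hs : z.sum = U + V) (h3 : 3 ≤ z.card)
    {W : Multiset P} (hW : W ∈ z) : 2 ≤ W.card := by
  by_contra hlt
  have h0 := Multiset.card_pos.2 (hz W hW).1
  obtain ⟨a, rfl⟩ := Multiset.card_eq_one.1 (show W.card = 1 by omega)
  obtain ⟨z', rfl⟩ := Multiset.exists_cons_of_mem hW
  have hz' : IsFac f z' := hz.mono (Multiset.le_cons_self _ _)
  rw [Multiset.card_cons] at h3
  have ha : a ∈ U + V := by rw [← hs]; simp
  rw [Multiset.sum_cons] at hs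
  rcases Multiset.mem_add.1 ha with ha | ha
  · have := (hz _ hW).eq_of_le hU (Multiset.singleton_le.2 ha)
    subst this
    have := hz'.card_eq_one (by rwa [add_left_cancel hs])
    omega
  · have := (hz _ hW).eq_of_le hV (Multiset.singleton_le.2 ha)
    subst this
    rw [add_comm] at hs
    have := hz'.card_eq_one (by rwa [add_right_cancel hs])
    omega

theorem IsFac.two_mul_card_le {z : Multiset (Multiset P)} (hz : IsFac f z) {U V : Multiset P}
    (hU : MinZeroSum f U) (hV : MinZeroSum f V) (hs : z.sum = U + V) (h3 : 3 ≤ z.card) :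
    2 * z.card ≤ U.card + V.card := by
  rw [← Multiset.card_add, ← hs]
  exact two_mul_card_le_card_sum fun W hW => hz.two_le_card_of_mem hU hV hs h3 hW

theorem DavenportLE.dalethLE {N : ℕ} (h : DavenportLE f N) : DalethLE f N := by
  intro U V hU hV z hz hs h3
  have h1 := hz.two_mul_card_le hU hV hs h3
  have := h.card_le hU
  have := h.card_le hV
  exact ⟨z, hz, hs, h3, by omega⟩

theorem minZeroSum_map_iff {U : Multiset P} : MinZeroSum id (U.map f) ↔ MinZeroSum f U := by
  unfold MinZeroSum ZeroSum
  simp only [Multiset.map_id, ne_eq, Multiset.map_eq_zero]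
  refine and_congr_right fun _ => and_congr_right fun _ => ⟨fun h T hT hT0 hTz => ?_,
    fun h T hT hT0 hTz => ?_⟩
  · have := congrArg Multiset.card (h (T.map f) (Multiset.map_le_map hT) (by simpa using hT0) hTz)
    exact Multiset.eq_of_le_of_card_le hT (by simpa using this.ge)
  · obtain ⟨R, hR, rfl⟩ := exists_map_eq_of_le_map hT
    rw [h R hR (by simpa using hT0) hTz]

/-- The bound `DalethLE` only depends on the group. -/
theorem dalethLE_of_id {N : ℕ} (h : DalethLE (id : G → G) N) : DalethLE f N := by
  intro U V hU hV z hz hs h3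
  obtain ⟨z', hz', hs', h3', hN⟩ := h (U.map f) (V.map f) (minZeroSum_map_iff.2 hU)
    (minZeroSum_map_iff.2 hV) (z.map (Multiset.map f)) (by
      intro W hW
      obtain ⟨W', hW', rfl⟩ := Multiset.mem_map.1 hW
      exact minZeroSum_map_iff.2 (hz W' hW')) (by
      rw [← Multiset.map_add, ← hs]
      exact (map_multiset_sum (Multiset.mapAddMonoidHom f) z).symm) (by simpa using h3)
  rw [← Multiset.map_add] at hs'
  obtain ⟨y, rfl, hy⟩ := exists_map_map_eq hs'
  refine ⟨y, fun W hW => minZeroSum_map_iff.1 (hz' _ (Multiset.mem_map_of_mem _ hW)), hy,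
    by simpa using h3', by simpa using hN⟩

end Davenport

/-! ### Upper bounds for the catenary degree from the class group -/

section CatenaryBounds

variable {G : Type*} [AddCommGroup G] {H P : Type*} [CommMonoid H] [IsCancelMul H]
  {φ : H →* FreeMon P}

theorem catenaryDegree_le (hφ : IsDivisorTheory φ) (ψ : ClGroup φ ≃+ G) {N : ℕ} (hN : 2 ≤ N)
    (hD : DavenportLE (id : G → G) (2 * N)) (hd : DalethLE (id : G → G) N) :
    catenaryDegree H ≤ N :=
  catenaryDegree_le_of_chained (ψ := ψ) hφ fun _ _ hx hy hs =>
    chained_of_davenportLE_of_dalethLE hN (davenportLE_of_id hD) (dalethLE_of_id hd) hx hy hs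

theorem catenaryDegree_le_of_davenportLE (hφ : IsDivisorTheory φ) (ψ : ClGroup φ ≃+ G) {N : ℕ}
    (hN : 2 ≤ N) (hD : DavenportLE (id : G → G) N) : catenaryDegree H ≤ N :=
  catenaryDegree_le hφ ψ hN (hD.mono (by omega)) hD.dalethLE

end CatenaryBounds

/-! ### Factorizations of a product of two minimal zero-sum multisets -/

section Splits

variable {G : Type*} [AddCommGroup G] {U V : Multiset G}

/-- The multiset `X + (-Y)` is a sum of `n` minimal zero-sum multisets. -/
def Splits (n : ℕ) (X Y : Multiset G) : Prop :=
  ∃ z, IsFac id z ∧ z.sum = X + Y.map (fun g => -g) ∧ z.card = n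

/-- The least `n` such that `X + (-Y)` is a sum of `n` minimal zero-sum multisets. -/
noncomputable def splitMin (X Y : Multiset G) : ℕ := sInf {n | Splits n X Y}

theorem Splits.add {m n : ℕ} {X Y X' Y' : Multiset G} (h : Splits m X Y) (h' : Splits n X' Y') :
    Splits (m + n) (X + X') (Y + Y') := by
  obtain ⟨z, hz, hs, rfl⟩ := h
  obtain ⟨z', hz', hs', rfl⟩ := h'
  exact ⟨z + z', hz.add hz', by rw [Multiset.sum_add, hs, hs', Multiset.map_add]; abel, by simp⟩

theorem sum_map_neg_id (Y : Multiset G) : (Y.map fun g => -g).sum = -Y.sum := by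
  rw [Multiset.sum_map_neg, Multiset.map_id']

theorem zeroSum_add_map_neg {X Y : Multiset G} :
    ZeroSum id (X + Y.map fun g => -g) ↔ X.sum = Y.sum := by
  rw [ZeroSum, Multiset.map_id, Multiset.sum_add, sum_map_neg_id, ← sub_eq_add_neg, sub_eq_zero]

theorem splits_splitMin {X Y : Multiset G} (h : X.sum = Y.sum) : Splits (splitMin X Y) X Y := by
  obtain ⟨z, hz, hs⟩ := exists_isFac (zeroSum_add_map_neg.2 h)
  exact Nat.sInf_mem (s := {n | Splits n X Y}) ⟨z.card, z, hz, hs, rfl⟩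

theorem minZeroSum_map_neg (hU : MinZeroSum id U) :
    MinZeroSum id (U.map fun g => -g) := by
  obtain ⟨h0, h1, h2⟩ := hU
  refine ⟨by simpa using h0, ?_, fun T hT hT0 hTz => ?_⟩
  · rw [ZeroSum, Multiset.map_id, sum_map_neg_id, neg_eq_zero]
    simpa [ZeroSum] using h1
  · obtain ⟨R, hR, rfl⟩ := exists_map_eq_of_le_map hT
    rw [h2 R hR (by simpa using hT0) (by
      rw [ZeroSum, Multiset.map_id, sum_map_neg_id, neg_eq_zero] at hTz
      simpa [ZeroSum] using hTz)]

theorem map_neg_map_neg (X : Multiset G) : (X.map fun g => -g).map (fun g => -g) = X := by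
  simp

theorem Splits.symm {n : ℕ} {X Y : Multiset G} (h : Splits n X Y) : Splits n Y X := by
  obtain ⟨z, hz, hs, rfl⟩ := h
  refine ⟨z.map (Multiset.map fun g => -g), ?_, ?_, by simp⟩
  · intro W hW
    obtain ⟨W', hW', rfl⟩ := Multiset.mem_map.1 hW
    exact minZeroSum_map_neg (hz W' hW')
  · have := (map_multiset_sum (Multiset.mapAddMonoidHom fun g : G => -g) z).symm
    simp only [Multiset.coe_mapAddMonoidHom] at this
    rw [this, hs, Multiset.map_add, map_neg_map_neg, add_comm]

theorem MinZeroSum.sum_eq_zero (hU : MinZeroSum id U) : U.sum = 0 := by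
  simpa [ZeroSum] using hU.2.1

theorem MinZeroSum.eq_zero_of_le (hU : MinZeroSum id U) {X T : Multiset G} (hX : X ≤ U)
    (hX0 : X.sum ≠ 0) (hT : T ≤ X) (hT0 : T.sum = 0) : T = 0 := by
  by_contra h
  have := hU.2.2 T (hT.trans hX) h (by simpa [ZeroSum] using hT0)
  subst this
  rw [le_antisymm hX hT] at hX0
  exact hX0 hT0

/-- A decomposition into pieces which meet both sides. -/
theorem Splits.exists_pieces (hU : MinZeroSum id U) (hV : MinZeroSum id V) {n : ℕ}
    {X Y : Multiset G} (hX : X ≤ U) (hY : Y ≤ V) (hs0 : X.sum ≠ 0) (hXY : X.sum = Y.sum)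
    (h : Splits n X Y) : ∃ w : Multiset (Multiset G × Multiset G), w.card = n ∧
      X = (w.map Prod.fst).sum ∧ Y = (w.map Prod.snd).sum ∧
      ∀ p ∈ w, p.1 ≠ 0 ∧ p.2 ≠ 0 ∧ p.1.sum = p.2.sum ∧
        MinZeroSum id (p.1 + p.2.map fun g => -g) := by
  obtain ⟨z, hz, hs, rfl⟩ := h
  obtain ⟨w, rfl, hw1, hw2⟩ := exists_split_of_sum_eq_add hs
  have hY' : Y = (w.map fun p => p.2.map fun g => -g).sum := by
    rw [← map_neg_map_neg Y, hw2]
    have := map_multiset_sum (Multiset.mapAddMonoidHom fun g : G => -g) (w.map Prod.snd)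
    simp only [Multiset.coe_mapAddMonoidHom, Multiset.map_map] at this
    exact this
  refine ⟨w.map fun p => (p.1, p.2.map fun g => -g), by simp, ?_, ?_, ?_⟩
  · rw [Multiset.map_map]; exact hw1
  · rw [Multiset.map_map]; exact hY'
  · intro q hq
    obtain ⟨p, hp, rfl⟩ := Multiset.mem_map.1 hq
    have hatom := hz _ (Multiset.mem_map_of_mem _ hp)
    have hle1 : p.1 ≤ X := hw1 ▸ le_sum_map_of_mem Prod.fst hp
    have hle2 : (p.2.map fun g => -g) ≤ Y := by
      rw [hY']; exact le_sum_map_of_mem (fun p : Multiset G × Multiset G => p.2.map fun g => -g) hp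
    have hsum : p.1.sum = (p.2.map fun g => -g).sum := by
      rw [← zeroSum_add_map_neg, map_neg_map_neg]; exact hatom.2.1
    refine ⟨fun h0 => ?_, fun h0 => ?_, hsum, by rw [map_neg_map_neg]; exact hatom⟩
    -- A piece on one side only would be a zero-sum submultiset of `X` or `Y`. Having nonzero sum,
    -- these are proper parts of an atom.
    · have h1 := hV.eq_zero_of_le hY (hXY ▸ hs0) hle2 (by rw [← hsum, show p.1 = 0 from h0]; rfl)
      exact hatom.1 (by rw [show p.1 = 0 from h0]; simpa using h1)
    · have h0' : (p.2.map fun g => -g) = 0 := h0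
      have h1 := hU.eq_zero_of_le hX hs0 hle1 (by rw [hsum, h0']; rfl)
      exact hatom.1 (by rw [h1]; simpa using h0)

theorem card_le_sum_map {α : Type*} {w : Multiset α} {c : α → ℕ} {k : ℕ}
    (h : ∀ p ∈ w, k ≤ c p) : k * w.card ≤ (w.map c).sum := by
  have := Multiset.card_nsmul_le_sum (s := w.map c) (a := k) (by simpa using h)
  simpa [mul_comm] using this

theorem Splits.le_card (hU : MinZeroSum id U) (hV : MinZeroSum id V) {n : ℕ}
    {X Y : Multiset G} (hX : X ≤ U) (hY : Y ≤ V) (hs0 : X.sum ≠ 0) (hXY : X.sum = Y.sum)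
    (h : Splits n X Y) : n ≤ X.card ∧ n ≤ Y.card := by
  obtain ⟨w, rfl, rfl, rfl, hw⟩ := h.exists_pieces hU hV hX hY hs0 hXY
  rw [card_sum_map, card_sum_map]
  constructor
  · simpa using card_le_sum_map (k := 1) fun p hp => Multiset.card_pos.2 (hw p hp).1
  · simpa using card_le_sum_map (k := 1) fun p hp => Multiset.card_pos.2 (hw p hp).2.1

/-- Some piece has fewer than 3 elements, so it takes exactly one from each side, and these are
equal. -/
theorem Splits.exists_common (hU : MinZeroSum id U) (hV : MinZeroSum id V) {n : ℕ}
    {X Y : Multiset G} (hX : X ≤ U) (hY : Y ≤ V) (hs0 : X.sum ≠ 0) (hXY : X.sum = Y.sum)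
    (h : Splits n X Y) (hn : X.card + Y.card < 3 * n) : ∃ x ∈ X, x ∈ Y := by
  obtain ⟨w, rfl, rfl, rfl, hw⟩ := h.exists_pieces hU hV hX hY hs0 hXY
  rw [card_sum_map, card_sum_map, ← Multiset.sum_map_add] at hn
  by_contra! hcon
  refine absurd (card_le_sum_map (k := 3) fun p hp => ?_) (not_le.2 hn)
  obtain ⟨h1, h2, h3, -⟩ := hw p hp
  rw [← Multiset.card_pos] at h1 h2
  by_contra hlt
  obtain ⟨a, ha⟩ := Multiset.card_eq_one.1 (show p.1.card = 1 by omega)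
  obtain ⟨b, hb⟩ := Multiset.card_eq_one.1 (show p.2.card = 1 by omega)
  rw [ha, hb, Multiset.sum_singleton, Multiset.sum_singleton] at h3
  subst h3
  exact hcon a (Multiset.mem_of_le (le_sum_map_of_mem Prod.fst hp) (by rw [ha]; simp))
    (Multiset.mem_of_le (le_sum_map_of_mem Prod.snd hp) (by rw [hb]; simp))

theorem Splits.eq_of_card_le (hU : MinZeroSum id U) (hV : MinZeroSum id V) {n : ℕ}
    {X Y : Multiset G} (hX : X ≤ U) (hY : Y ≤ V) (hs0 : X.sum ≠ 0) (hXY : X.sum = Y.sum)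
    (h : Splits n X Y) (hX' : X.card ≤ n) (hY' : Y.card ≤ n) : X = Y := by
  obtain ⟨w, rfl, rfl, rfl, hw⟩ := h.exists_pieces hU hV hX hY hs0 hXY
  clear hX hY hs0 hXY h
  induction w using Multiset.induction with
  | empty => simp
  | cons p w ih =>
    simp only [Multiset.map_cons, Multiset.sum_cons, Multiset.card_add, Multiset.card_cons]
      at hX' hY' ⊢
    have hwc1 : w.card ≤ ((w.map Prod.fst).sum).card := by
      rw [card_sum_map]
      simpa using card_le_sum_map (k := 1) fun q hq =>
        Multiset.card_pos.2 (hw q (Multiset.mem_cons_of_mem hq)).1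
    have hwc2 : w.card ≤ ((w.map Prod.snd).sum).card := by
      rw [card_sum_map]
      simpa using card_le_sum_map (k := 1) fun q hq =>
        Multiset.card_pos.2 (hw q (Multiset.mem_cons_of_mem hq)).2.1
    obtain ⟨h1, h2, h3, -⟩ := hw p (by simp)
    rw [← Multiset.card_pos] at h1 h2
    obtain ⟨a, ha⟩ := Multiset.card_eq_one.1 (show p.1.card = 1 by omega)
    obtain ⟨b, hb⟩ := Multiset.card_eq_one.1 (show p.2.card = 1 by omega)
    rw [ha, hb, Multiset.sum_singleton, Multiset.sum_singleton] at h3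
    rw [ih (by omega) (fun q hq => hw q (Multiset.mem_cons_of_mem hq)) (by omega), ha, hb, h3]

theorem Splits.one_le {n : ℕ} {X Y : Multiset G} (hX : X ≠ 0) (h : Splits n X Y) : 1 ≤ n := by
  obtain ⟨z, hz, hs, rfl⟩ := h
  refine Multiset.card_pos.2 fun h0 => hX ?_
  rw [h0, Multiset.sum_zero] at hs
  exact (add_eq_zero.1 hs.symm).1

theorem Splits.not_common {X Y : Multiset G} (h : Splits 1 X Y) (hX : 2 ≤ X.card) {x : G}
    (h1 : x ∈ X) (h2 : x ∈ Y) : False := by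
  obtain ⟨z, hz, hs, hc⟩ := h
  obtain ⟨W, rfl⟩ := Multiset.card_eq_one.1 hc
  rw [Multiset.sum_singleton] at hs
  subst hs
  have hY : 0 < Y.card := Multiset.card_pos_iff_exists_mem.2 ⟨x, h2⟩
  have := (hz _ (Multiset.mem_singleton_self _)).2.2 ({x} + {-x})
    (add_le_add (Multiset.singleton_le.2 h1)
      (Multiset.singleton_le.2 (Multiset.mem_map_of_mem (fun g => -g) h2))) (by simp)
    (by simp [ZeroSum])
  have := congrArg Multiset.card this
  simp at this
  omega

/-- `U + (-V)` has no factorization of length in `[3, N]`. -/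
def NoShortSplit (N : ℕ) (U V : Multiset G) : Prop := ∀ n, 3 ≤ n → n ≤ N → ¬ Splits n U V

theorem NoShortSplit.symm {N : ℕ} (h : NoShortSplit N U V) : NoShortSplit N V U :=
  fun n h3 hN hs => h n h3 hN hs.symm

theorem one_le_splitMin {X Y : Multiset G} (hX : X ≠ 0) (h : X.sum = Y.sum) : 1 ≤ splitMin X Y :=
  (splits_splitMin h).one_le hX

theorem NoShortSplit.lt_three {N : ℕ} (h : NoShortSplit N U V)
    {X₁ X₂ X₃ Y₁ Y₂ Y₃ : Multiset G} (hU : U = X₁ + X₂ + X₃) (hV : V = Y₁ + Y₂ + Y₃)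
    (h₁ : X₁.sum = Y₁.sum) (h₂ : X₂.sum = Y₂.sum) (h₃ : X₃.sum = Y₃.sum)
    (n₁ : X₁ ≠ 0) (n₂ : X₂ ≠ 0) (n₃ : X₃ ≠ 0) :
    N < splitMin X₁ Y₁ + splitMin X₂ Y₂ + splitMin X₃ Y₃ := by
  by_contra hN
  refine h _ ?_ (not_lt.1 hN) (hU ▸ hV ▸
    ((splits_splitMin h₁).add (splits_splitMin h₂)).add (splits_splitMin h₃))
  have := one_le_splitMin n₁ h₁
  have := one_le_splitMin n₂ h₂
  have := one_le_splitMin n₃ h₃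
  omega

theorem NoShortSplit.lt_four {N : ℕ} (h : NoShortSplit N U V)
    {X₁ X₂ X₃ X₄ Y₁ Y₂ Y₃ Y₄ : Multiset G} (hU : U = X₁ + X₂ + X₃ + X₄)
    (hV : V = Y₁ + Y₂ + Y₃ + Y₄)
    (h₁ : X₁.sum = Y₁.sum) (h₂ : X₂.sum = Y₂.sum) (h₃ : X₃.sum = Y₃.sum) (h₄ : X₄.sum = Y₄.sum)
    (n₁ : X₁ ≠ 0) (n₂ : X₂ ≠ 0) (n₃ : X₃ ≠ 0) (n₄ : X₄ ≠ 0) :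
    N < splitMin X₁ Y₁ + splitMin X₂ Y₂ + splitMin X₃ Y₃ + splitMin X₄ Y₄ := by
  by_contra hN
  refine h _ ?_ (not_lt.1 hN) (hU ▸ hV ▸ (((splits_splitMin h₁).add (splits_splitMin h₂)).add
    (splits_splitMin h₃)).add (splits_splitMin h₄))
  have := one_le_splitMin n₁ h₁
  have := one_le_splitMin n₂ h₂
  have := one_le_splitMin n₃ h₃
  have := one_le_splitMin n₄ h₄
  omega

/-- A piece which is too small to be decomposed. -/
def SmallPiece (X Y : Multiset G) : Prop :=
  X.card = 1 ∨ Y.card = 1 ∨ (X.card + Y.card ≤ 5 ∧ ∀ x ∈ X, x ∉ Y)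

theorem MinZeroSum.sum_ne_zero (hU : MinZeroSum id U) {X : Multiset G} (hX : X ≤ U)
    (h0 : X ≠ 0) (hc : X.card < U.card) : X.sum ≠ 0 := fun h => by
  rw [hU.2.2 X hX h0 (by simpa [ZeroSum] using h)] at hc
  exact lt_irrefl _ hc

theorem SmallPiece.splitMin_le_one (hU : MinZeroSum id U) (hV : MinZeroSum id V)
    {X Y : Multiset G} (h : SmallPiece X Y) (hX : X ≤ U) (hY : Y ≤ V) (hs0 : X.sum ≠ 0)
    (hXY : X.sum = Y.sum) : splitMin X Y ≤ 1 := by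
  have hs := splits_splitMin hXY
  have hle := hs.le_card hU hV hX hY hs0 hXY
  rcases h with h | h | ⟨h, hdis⟩
  · omega
  · omega
  · by_contra hlt
    obtain ⟨x, hx, hy⟩ := hs.exists_common hU hV hX hY hs0 hXY (by omega)
    exact hdis x hx hy

/-- Small pieces are atoms, so the four of them would be a factorization of length 4, which is
excluded. -/
theorem NoShortSplit.false_of_four (h : NoShortSplit 4 U V) (hU : MinZeroSum id U)
    (hV : MinZeroSum id V)
    {X₁ X₂ X₃ X₄ Y₁ Y₂ Y₃ Y₄ : Multiset G} (hUX : U = X₁ + X₂ + X₃ + X₄)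
    (hVY : V = Y₁ + Y₂ + Y₃ + Y₄)
    (h₁ : X₁.sum = Y₁.sum) (h₂ : X₂.sum = Y₂.sum) (h₃ : X₃.sum = Y₃.sum) (h₄ : X₄.sum = Y₄.sum)
    (n₁ : X₁ ≠ 0) (n₂ : X₂ ≠ 0) (n₃ : X₃ ≠ 0) (n₄ : X₄ ≠ 0)
    (s₁ : SmallPiece X₁ Y₁) (s₂ : SmallPiece X₂ Y₂) (s₃ : SmallPiece X₃ Y₃)
    (s₄ : SmallPiece X₄ Y₄) : False := by
  have hlt := h.lt_four hUX hVY h₁ h₂ h₃ h₄ n₁ n₂ n₃ n₄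
  have hXc := congrArg Multiset.card hUX
  simp only [Multiset.card_add] at hXc
  have c₁ := Multiset.card_pos.2 n₁
  have c₂ := Multiset.card_pos.2 n₂
  have c₃ := Multiset.card_pos.2 n₃
  have c₄ := Multiset.card_pos.2 n₄
  have l₁ : X₁ ≤ U := Multiset.le_iff_exists_add.2 ⟨X₂ + X₃ + X₄, by rw [hUX]; abel⟩
  have l₂ : X₂ ≤ U := Multiset.le_iff_exists_add.2 ⟨X₁ + X₃ + X₄, by rw [hUX]; abel⟩
  have l₃ : X₃ ≤ U := Multiset.le_iff_exists_add.2 ⟨X₁ + X₂ + X₄, by rw [hUX]; abel⟩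
  have l₄ : X₄ ≤ U := Multiset.le_iff_exists_add.2 ⟨X₁ + X₂ + X₃, by rw [hUX]; abel⟩
  have m₁ : Y₁ ≤ V := Multiset.le_iff_exists_add.2 ⟨Y₂ + Y₃ + Y₄, by rw [hVY]; abel⟩
  have m₂ : Y₂ ≤ V := Multiset.le_iff_exists_add.2 ⟨Y₁ + Y₃ + Y₄, by rw [hVY]; abel⟩
  have m₃ : Y₃ ≤ V := Multiset.le_iff_exists_add.2 ⟨Y₁ + Y₂ + Y₄, by rw [hVY]; abel⟩
  have m₄ : Y₄ ≤ V := Multiset.le_iff_exists_add.2 ⟨Y₁ + Y₂ + Y₃, by rw [hVY]; abel⟩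
  have := s₁.splitMin_le_one hU hV l₁ m₁ (hU.sum_ne_zero l₁ n₁ (by omega)) h₁
  have := s₂.splitMin_le_one hU hV l₂ m₂ (hU.sum_ne_zero l₂ n₂ (by omega)) h₂
  have := s₃.splitMin_le_one hU hV l₃ m₃ (hU.sum_ne_zero l₃ n₃ (by omega)) h₃
  have := s₄.splitMin_le_one hU hV l₄ m₄ (hU.sum_ne_zero l₄ n₄ (by omega)) h₄
  omega

/-- When two of three pieces are atoms, the third must account for all the missing length. This is
the usual way to show that it is large enough to have an element common to both sides. -/
theorem NoShortSplit.le_splitMin_of_three {N : ℕ} (h : NoShortSplit N U V) (hU : MinZeroSum id U)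
    (hV : MinZeroSum id V) {X₁ X₂ X₃ Y₁ Y₂ Y₃ : Multiset G} (hUX : U = X₁ + X₂ + X₃)
    (hVY : V = Y₁ + Y₂ + Y₃)
    (h₁ : X₁.sum = Y₁.sum) (h₂ : X₂.sum = Y₂.sum) (h₃ : X₃.sum = Y₃.sum)
    (n₁ : X₁ ≠ 0) (n₂ : X₂ ≠ 0) (n₃ : X₃ ≠ 0)
    (s₁ : SmallPiece X₁ Y₁) (s₂ : SmallPiece X₂ Y₂) :
    N ≤ splitMin X₃ Y₃ + 1 ∧ splitMin X₃ Y₃ ≤ X₃.card ∧ splitMin X₃ Y₃ ≤ Y₃.card ∧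
      (X₃.card + Y₃.card < 3 * splitMin X₃ Y₃ → ∃ x ∈ X₃, x ∈ Y₃) := by
  have hlt := h.lt_three hUX hVY h₁ h₂ h₃ n₁ n₂ n₃
  have hXc := congrArg Multiset.card hUX
  simp only [Multiset.card_add] at hXc
  have c₁ := Multiset.card_pos.2 n₁
  have c₂ := Multiset.card_pos.2 n₂
  have c₃ := Multiset.card_pos.2 n₃
  have l₁ : X₁ ≤ U := Multiset.le_iff_exists_add.2 ⟨X₂ + X₃, by rw [hUX]; abel⟩
  have l₂ : X₂ ≤ U := Multiset.le_iff_exists_add.2 ⟨X₁ + X₃, by rw [hUX]; abel⟩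
  have l₃ : X₃ ≤ U := Multiset.le_iff_exists_add.2 ⟨X₁ + X₂, by rw [hUX]; abel⟩
  have m₁ : Y₁ ≤ V := Multiset.le_iff_exists_add.2 ⟨Y₂ + Y₃, by rw [hVY]; abel⟩
  have m₂ : Y₂ ≤ V := Multiset.le_iff_exists_add.2 ⟨Y₁ + Y₃, by rw [hVY]; abel⟩
  have m₃ : Y₃ ≤ V := Multiset.le_iff_exists_add.2 ⟨Y₁ + Y₂, by rw [hVY]; abel⟩
  have := s₁.splitMin_le_one hU hV l₁ m₁ (hU.sum_ne_zero l₁ n₁ (by omega)) h₁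
  have := s₂.splitMin_le_one hU hV l₂ m₂ (hU.sum_ne_zero l₂ n₂ (by omega)) h₂
  have hs := splits_splitMin h₃
  have hz := hU.sum_ne_zero l₃ n₃ (by omega)
  have hle := hs.le_card hU hV l₃ m₃ hz h₃
  exact ⟨by omega, hle.1, hle.2, hs.exists_common hU hV l₃ m₃ hz h₃⟩

/-! Decompositions of `U` and `V` into three parts, all of the same sum. -/

/-- Decompositions `U = A₀ + A₁ + A₂` and `V = B₀ + B₁ + B₂` such that all six parts have the
same nonzero sum `s`. -/
structure TriSplit (U V A₀ A₁ A₂ B₀ B₁ B₂ : Multiset G) (s : G) : Prop where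
  eqU : U = A₀ + A₁ + A₂
  eqV : V = B₀ + B₁ + B₂
  a₀ : A₀.sum = s
  a₁ : A₁.sum = s
  a₂ : A₂.sum = s
  b₀ : B₀.sum = s
  b₁ : B₁.sum = s
  b₂ : B₂.sum = s
  ne : s ≠ 0

namespace TriSplit

variable {A₀ A₁ A₂ B₀ B₁ B₂ : Multiset G} {s : G}

theorem symm (h : TriSplit U V A₀ A₁ A₂ B₀ B₁ B₂ s) : TriSplit V U B₀ B₁ B₂ A₀ A₁ A₂ s :=
  ⟨h.eqV, h.eqU, h.b₀, h.b₁, h.b₂, h.a₀, h.a₁, h.a₂, h.ne⟩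

theorem swap₀₁ (h : TriSplit U V A₀ A₁ A₂ B₀ B₁ B₂ s) : TriSplit U V A₁ A₀ A₂ B₀ B₁ B₂ s :=
  ⟨by rw [h.eqU]; abel, h.eqV, h.a₁, h.a₀, h.a₂, h.b₀, h.b₁, h.b₂, h.ne⟩

theorem swap₁₂ (h : TriSplit U V A₀ A₁ A₂ B₀ B₁ B₂ s) : TriSplit U V A₀ A₂ A₁ B₀ B₁ B₂ s :=
  ⟨by rw [h.eqU]; abel, h.eqV, h.a₀, h.a₂, h.a₁, h.b₀, h.b₁, h.b₂, h.ne⟩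

theorem swap₀₁' (h : TriSplit U V A₀ A₁ A₂ B₀ B₁ B₂ s) : TriSplit U V A₀ A₁ A₂ B₁ B₀ B₂ s :=
  h.symm.swap₀₁.symm

theorem swap₁₂' (h : TriSplit U V A₀ A₁ A₂ B₀ B₁ B₂ s) : TriSplit U V A₀ A₁ A₂ B₀ B₂ B₁ s :=
  h.symm.swap₁₂.symm

theorem ne_zero (h : TriSplit U V A₀ A₁ A₂ B₀ B₁ B₂ s) : A₀ ≠ 0 ∧ A₁ ≠ 0 ∧ A₂ ≠ 0 := by
  refine ⟨?_, ?_, ?_⟩ <;> rintro rfl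
  · exact h.ne h.a₀.symm
  · exact h.ne h.a₁.symm
  · exact h.ne h.a₂.symm

theorem le_left (h : TriSplit U V A₀ A₁ A₂ B₀ B₁ B₂ s) : A₀ ≤ U :=
  Multiset.le_iff_exists_add.2 ⟨A₁ + A₂, by rw [h.eqU]; abel⟩

theorem lt_sum {N : ℕ} (h : TriSplit U V A₀ A₁ A₂ B₀ B₁ B₂ s) (hN : NoShortSplit N U V) :
    N < splitMin A₀ B₀ + splitMin A₁ B₁ + splitMin A₂ B₂ :=
  hN.lt_three h.eqU h.eqV (h.a₀.trans h.b₀.symm) (h.a₁.trans h.b₁.symm) (h.a₂.trans h.b₂.symm)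
    h.ne_zero.1 h.ne_zero.2.1 h.ne_zero.2.2

theorem splitMin_bounds (h : TriSplit U V A₀ A₁ A₂ B₀ B₁ B₂ s) (hU : MinZeroSum id U)
    (hV : MinZeroSum id V) : 1 ≤ splitMin A₀ B₀ ∧ splitMin A₀ B₀ ≤ A₀.card ∧
      splitMin A₀ B₀ ≤ B₀.card := by
  have hs := h.a₀.trans h.b₀.symm
  exact ⟨one_le_splitMin h.ne_zero.1 hs,
    (splits_splitMin hs).le_card hU hV h.le_left h.symm.le_left (h.a₀ ▸ h.ne) hs⟩

theorem exists_common (h : TriSplit U V A₀ A₁ A₂ B₀ B₁ B₂ s) (hU : MinZeroSum id U)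
    (hV : MinZeroSum id V) (hc : A₀.card + B₀.card < 3 * splitMin A₀ B₀) : ∃ x ∈ A₀, x ∈ B₀ := by
  have hs := h.a₀.trans h.b₀.symm
  exact (splits_splitMin hs).exists_common hU hV h.le_left h.symm.le_left (h.a₀ ▸ h.ne) hs hc

theorem eq_of_card_le (h : TriSplit U V A₀ A₁ A₂ B₀ B₁ B₂ s) (hU : MinZeroSum id U)
    (hV : MinZeroSum id V) (h1 : A₀.card ≤ splitMin A₀ B₀) (h2 : B₀.card ≤ splitMin A₀ B₀) :
    A₀ = B₀ := by
  have hs := h.a₀.trans h.b₀.symm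
  exact (splits_splitMin hs).eq_of_card_le hU hV h.le_left h.symm.le_left (h.a₀ ▸ h.ne) hs h1 h2

/-- Any way to match the parts of `U` with the parts of `V` gives a long factorization. -/
theorem lt_sums {N : ℕ} (h : TriSplit U V A₀ A₁ A₂ B₀ B₁ B₂ s) (hN : NoShortSplit N U V) :
    N < splitMin A₀ B₀ + splitMin A₁ B₁ + splitMin A₂ B₂ ∧
    N < splitMin A₀ B₀ + splitMin A₁ B₂ + splitMin A₂ B₁ ∧
    N < splitMin A₀ B₁ + splitMin A₁ B₀ + splitMin A₂ B₂ ∧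
    N < splitMin A₀ B₁ + splitMin A₁ B₂ + splitMin A₂ B₀ ∧
    N < splitMin A₀ B₂ + splitMin A₁ B₀ + splitMin A₂ B₁ ∧
    N < splitMin A₀ B₂ + splitMin A₁ B₁ + splitMin A₂ B₀ :=
  ⟨h.lt_sum hN, h.swap₁₂'.lt_sum hN, h.swap₀₁'.lt_sum hN, h.swap₀₁'.swap₁₂'.lt_sum hN,
    h.swap₁₂'.swap₀₁'.lt_sum hN, h.swap₁₂'.swap₀₁'.swap₁₂'.lt_sum hN⟩

/-- Bounds for the entries of the matrix of the numbers `splitMin A_i B_j`. -/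
theorem bounds (h : TriSplit U V A₀ A₁ A₂ B₀ B₁ B₂ s) (hU : MinZeroSum id U)
    (hV : MinZeroSum id V) :
    (1 ≤ splitMin A₀ B₀ ∧ splitMin A₀ B₀ ≤ A₀.card ∧ splitMin A₀ B₀ ≤ B₀.card) ∧
    (1 ≤ splitMin A₀ B₁ ∧ splitMin A₀ B₁ ≤ A₀.card ∧ splitMin A₀ B₁ ≤ B₁.card) ∧
    (1 ≤ splitMin A₀ B₂ ∧ splitMin A₀ B₂ ≤ A₀.card ∧ splitMin A₀ B₂ ≤ B₂.card) ∧
    (1 ≤ splitMin A₁ B₀ ∧ splitMin A₁ B₀ ≤ A₁.card ∧ splitMin A₁ B₀ ≤ B₀.card) ∧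
    (1 ≤ splitMin A₁ B₁ ∧ splitMin A₁ B₁ ≤ A₁.card ∧ splitMin A₁ B₁ ≤ B₁.card) ∧
    (1 ≤ splitMin A₁ B₂ ∧ splitMin A₁ B₂ ≤ A₁.card ∧ splitMin A₁ B₂ ≤ B₂.card) ∧
    (1 ≤ splitMin A₂ B₀ ∧ splitMin A₂ B₀ ≤ A₂.card ∧ splitMin A₂ B₀ ≤ B₀.card) ∧
    (1 ≤ splitMin A₂ B₁ ∧ splitMin A₂ B₁ ≤ A₂.card ∧ splitMin A₂ B₁ ≤ B₁.card) ∧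
    (1 ≤ splitMin A₂ B₂ ∧ splitMin A₂ B₂ ≤ A₂.card ∧ splitMin A₂ B₂ ≤ B₂.card) := by
  have h1 := h.swap₀₁
  have h2 := h.swap₁₂.swap₀₁
  exact ⟨h.splitMin_bounds hU hV, h.swap₀₁'.splitMin_bounds hU hV,
    h.swap₁₂'.swap₀₁'.splitMin_bounds hU hV, h1.splitMin_bounds hU hV,
    h1.swap₀₁'.splitMin_bounds hU hV, h1.swap₁₂'.swap₀₁'.splitMin_bounds hU hV,
    h2.splitMin_bounds hU hV, h2.swap₀₁'.splitMin_bounds hU hV,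
    h2.swap₁₂'.swap₀₁'.splitMin_bounds hU hV⟩

theorem card_eq (h : TriSplit U V A₀ A₁ A₂ B₀ B₁ B₂ s) :
    U.card = A₀.card + A₁.card + A₂.card ∧ V.card = B₀.card + B₁.card + B₂.card := by
  constructor
  · rw [h.eqU, Multiset.card_add, Multiset.card_add]
  · rw [h.eqV, Multiset.card_add, Multiset.card_add]

/-- The parts of `U` and of `V` may be assumed to be sorted by size. -/
theorem false_of_sorted
    (H : ∀ A₀ A₁ A₂ B₀ B₁ B₂ : Multiset G, TriSplit U V A₀ A₁ A₂ B₀ B₁ B₂ s →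
      A₁.card ≤ A₀.card → A₂.card ≤ A₁.card → B₁.card ≤ B₀.card → B₂.card ≤ B₁.card → False)
    (h : TriSplit U V A₀ A₁ A₂ B₀ B₁ B₂ s) : False := by
  have key : ∀ A₀ A₁ A₂ B₀ B₁ B₂ : Multiset G, TriSplit U V A₀ A₁ A₂ B₀ B₁ B₂ s →
      A₁.card ≤ A₀.card → A₂.card ≤ A₁.card → False := by
    intro A₀ A₁ A₂ B₀ B₁ B₂ h ha hb
    rcases le_total B₁.card B₀.card with h1 | h1 <;> rcases le_total B₂.card B₁.card with h2 | h2 <;>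
      rcases le_total B₂.card B₀.card with h3 | h3
    · exact H _ _ _ _ _ _ h ha hb h1 h2
    · exact H _ _ _ _ _ _ h ha hb h1 h2
    · exact H _ _ _ _ _ _ h.swap₁₂' ha hb h3 h2
    · exact H _ _ _ _ _ _ h.swap₁₂'.swap₀₁' ha hb h3 h1
    · exact H _ _ _ _ _ _ h.swap₀₁' ha hb h1 h3
    · exact H _ _ _ _ _ _ h.swap₀₁'.swap₁₂' ha hb h2 h3
    · exact H _ _ _ _ _ _ h.swap₀₁'.swap₁₂'.swap₀₁' ha hb h2 h1
    · exact H _ _ _ _ _ _ h.swap₀₁'.swap₁₂'.swap₀₁' ha hb h2 h1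
  rcases le_total A₁.card A₀.card with h1 | h1 <;> rcases le_total A₂.card A₁.card with h2 | h2 <;>
    rcases le_total A₂.card A₀.card with h3 | h3
  · exact key _ _ _ _ _ _ h h1 h2
  · exact key _ _ _ _ _ _ h h1 h2
  · exact key _ _ _ _ _ _ h.swap₁₂ h3 h2
  · exact key _ _ _ _ _ _ h.swap₁₂.swap₀₁ h3 h1
  · exact key _ _ _ _ _ _ h.swap₀₁ h1 h3
  · exact key _ _ _ _ _ _ h.swap₀₁.swap₁₂ h2 h3
  · exact key _ _ _ _ _ _ h.swap₀₁.swap₁₂.swap₀₁ h2 h1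
  · exact key _ _ _ _ _ _ h.swap₀₁.swap₁₂.swap₀₁ h2 h1

end TriSplit

end Splits

/-! ### Groups of exponent three -/

section ExponentThree

variable {G : Type*} [AddCommGroup G] {U V : Multiset G}

theorem exists_singleton_add_of_mem {α : Type*} {A : Multiset α} {x : α} (h : x ∈ A) :
    ∃ B, A = {x} + B := by
  obtain ⟨B, rfl⟩ := Multiset.exists_cons_of_mem h
  exact ⟨B, (Multiset.singleton_add _ _).symm⟩

theorem exists_eq_pair_of_mem {A : Multiset G} {x s : G} (h : x ∈ A) (hc : A.card = 2)
    (hs : A.sum = s) : ∃ y, A = {x} + {y} ∧ x + y = s := by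
  obtain ⟨B, rfl⟩ := exists_singleton_add_of_mem h
  rw [Multiset.card_add, Multiset.card_singleton] at hc
  obtain ⟨y, rfl⟩ := Multiset.card_eq_one.1 (show B.card = 1 by omega)
  exact ⟨y, rfl, by simpa using hs⟩

theorem exists_eq_triple {A : Multiset G} {s : G} (hc : A.card = 3) (hs : A.sum = s) :
    ∃ x y z, A = {x} + {y} + {z} ∧ x + y + z = s := by
  obtain ⟨x, y, z, rfl⟩ := Multiset.card_eq_three.1 hc
  refine ⟨x, y, z, ?_, by simpa [add_assoc] using hs⟩
  simp only [Multiset.insert_eq_cons, ← Multiset.singleton_add]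
  abel

theorem exists_eq_singleton {A : Multiset G} {s : G} (hc : A.card = 1) (hs : A.sum = s) :
    A = {s} := by
  obtain ⟨x, rfl⟩ := Multiset.card_eq_one.1 hc
  rw [← hs, Multiset.sum_singleton]

theorem MinZeroSum.not_three (h3 : ∀ g : G, g + g + g = 0) (hU : MinZeroSum id U) {x : G}
    {R : Multiset G} (hc : 3 < U.card) (h : U = {x} + {x} + {x} + R) : False :=
  hU.sum_ne_zero (X := {x} + {x} + {x}) (h ▸ Multiset.le_add_right _ _) (by simp) (by simpa using hc)
    (by simpa [add_assoc] using h3 x)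

theorem MinZeroSum.not_zero_mem (hU : MinZeroSum id U) {x : G} (hc : 1 < U.card) (h : x ∈ U) :
    x ≠ 0 := fun h0 =>
  hU.sum_ne_zero (X := {x}) (Multiset.singleton_le.2 h) (by simp) (by simpa using hc) (by simpa)

/-- Let `mᵢⱼ = splitMin Aᵢ Bⱼ`. All six matchings have total at least 4 while `mᵢⱼ ≤ min(|Aᵢ|,
|Bⱼ|)`. This forces part sizes `(2, 2, 1)` on both sides and equal pairs, that is `U = V = p²q²s`
with `s = p + q`. -/
theorem TriSplit.false_of_card_le_five (h3 : ∀ g : G, g + g + g = 0)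
    {A₀ A₁ A₂ B₀ B₁ B₂ : Multiset G} {s : G}
    (h : TriSplit U V A₀ A₁ A₂ B₀ B₁ B₂ s) (hU : MinZeroSum id U) (hV : MinZeroSum id V)
    (hN : NoShortSplit 3 U V) (hUc : U.card ≤ 5) (hVc : V.card ≤ 5) : False := by
  refine TriSplit.false_of_sorted (fun A₀ A₁ A₂ B₀ B₁ B₂ h hA hA' hB hB' => ?_) h
  have hb := h.bounds hU hV
  have hl := h.lt_sums hN
  have hc := h.card_eq
  have e1 : A₀ = B₀ := h.eq_of_card_le hU hV (by omega) (by omega)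
  have e2 : A₀ = B₁ := h.swap₀₁'.eq_of_card_le hU hV (by omega) (by omega)
  have e3 : A₁ = B₀ := h.swap₀₁.eq_of_card_le hU hV (by omega) (by omega)
  have e4 := exists_eq_singleton (show A₂.card = 1 by omega) h.a₂
  have e5 := exists_eq_singleton (show B₂.card = 1 by omega) h.b₂
  obtain ⟨p, hp⟩ := Multiset.card_pos_iff_exists_mem.1 (show 0 < A₀.card by omega)
  obtain ⟨q, hq, hs⟩ := exists_eq_pair_of_mem hp (by omega) h.a₀
  have hUe := h.eqU
  have hVe := h.eqV
  rw [e3, ← e1, hq, e4] at hUe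
  rw [← e1, ← e2, hq, e5] at hVe
  -- As `3p = 0`, the part `s + p + p` sums to `q`; exchanging it against `q` gives a factorization
  -- of length 3.
  have := hN.le_splitMin_of_three hU hV (X₁ := {s} + {p} + {p}) (X₂ := {q}) (X₃ := {q})
    (Y₁ := {q}) (Y₂ := {s} + {p} + {p}) (Y₃ := {q}) (by rw [hUe]; abel) (by rw [hVe]; abel)
    (by simp; have := h3 p; grind) (by simp; have := h3 p; grind) rfl (by simp) (by simp) (by simp)
    (by simp [SmallPiece]) (by simp [SmallPiece])
  simp only [Multiset.card_singleton] at this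
  omega

/-- Since `s + 2p = q + r`, the parts `spp` and `qr` can be exchanged. They are disjoint because no
element occurs three times in an atom, so together they are atoms; with the pairs for `q` and `r`
this has length 4. -/
theorem NoShortSplit.false_of_double_triple (h3 : ∀ g : G, g + g + g = 0)
    (hN : NoShortSplit 4 U V) (hU : MinZeroSum id U)
    (hV : MinZeroSum id V) {p q r s : G} (hUe : U = {p} + {q} + {r} + ({p} + {q} + {r}) + {s})
    (hVe : V = {p} + {q} + {r} + ({p} + {q} + {r}) + {s}) (hs : p + q + r = s) : False := by
  have hc : 3 < U.card := by rw [hUe]; simp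
  have h1 : s ≠ q := by
    rintro rfl
    exact hU.not_three h3 hc (x := s) (R := {p} + {p} + {r} + {r}) (by rw [hUe]; abel)
  have h2 : s ≠ r := by
    rintro rfl
    exact hU.not_three h3 hc (x := s) (R := {p} + {p} + {q} + {q}) (by rw [hUe]; abel)
  have h4 : p ≠ q := by
    rintro rfl
    exact hU.not_three h3 hc (x := p) (R := {p} + {s} + {r} + {r}) (by rw [hUe]; abel)
  have h5 : p ≠ r := by
    rintro rfl
    exact hU.not_three h3 hc (x := p) (R := {p} + {s} + {q} + {q}) (by rw [hUe]; abel)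
  refine hN.false_of_four hU hV (X₁ := {s} + {p} + {p}) (X₂ := {q} + {r}) (X₃ := {q}) (X₄ := {r})
    (Y₁ := {q} + {r}) (Y₂ := {s} + {p} + {p}) (Y₃ := {q}) (Y₄ := {r})
    (by rw [hUe]; abel) (by rw [hVe]; abel) (by simp; have := h3 p; grind)
    (by simp; have := h3 p; grind) rfl rfl (by simp) (by simp) (by simp) (by simp)
    (by simp [SmallPiece, h1, h2, h4, h5])
    (by simp [SmallPiece, h1.symm, h2.symm, h4.symm, h5.symm])
    (by simp [SmallPiece]) (by simp [SmallPiece])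

/-- The matching inequalities force `A₁ = B₁ = B₂` and an element common to `A₁` and `B₀`. That
element occurs three times in `V`. -/
theorem TriSplit.false_of_two_one (h3 : ∀ g : G, g + g + g = 0)
    {A₀ A₁ A₂ B₀ B₁ B₂ : Multiset G} {s : G}
    (h : TriSplit U V A₀ A₁ A₂ B₀ B₁ B₂ s) (hU : MinZeroSum id U) (hV : MinZeroSum id V)
    (hN : NoShortSplit 4 U V) (hA₁ : A₁.card = 2) (hA₂ : A₂.card = 1) (hB₀ : B₀.card ≤ 3)
    (hB₁ : B₁.card = 2) (hB₂ : B₂.card = 2) : False := by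
  have hb := h.bounds hU hV
  have hl := h.lt_sums hN
  have hc := h.card_eq
  have e1 : A₁ = B₁ := h.swap₀₁.swap₀₁'.eq_of_card_le hU hV (by omega) (by omega)
  have e2 : A₁ = B₂ := h.swap₀₁.swap₁₂'.swap₀₁'.eq_of_card_le hU hV (by omega) (by omega)
  obtain ⟨x, hx, hx'⟩ := h.swap₀₁.exists_common hU hV (by omega)
  have hx1 : x ∈ B₁ := e1 ▸ hx
  have hx2 : x ∈ B₂ := e2 ▸ hx
  obtain ⟨C₀, rfl⟩ := exists_singleton_add_of_mem hx'
  obtain ⟨C₁, rfl⟩ := exists_singleton_add_of_mem hx1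
  obtain ⟨C₂, rfl⟩ := exists_singleton_add_of_mem hx2
  exact hV.not_three h3 (x := x) (R := C₀ + C₁ + C₂) (by omega) (by rw [h.eqV]; abel)

/-- Two atoms come from `s + 2x = q + r` and from `q = q`. The remaining piece must split into three
parts, and is small enough that its two sides share an element; everything outside `B₀` is excluded
as that element. -/
theorem NoShortSplit.mem_or_mem (h3 : ∀ g : G, g + g + g = 0)
    (hN : NoShortSplit 4 U V) (hU : MinZeroSum id U)
    (hV : MinZeroSum id V) {x q r s : G} {B₀ : Multiset G}
    (hUe : U = {x} + {q} + {r} + ({x} + {q} + {r}) + {s})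
    (hVe : V = B₀ + ({x} + {q + r}) + ({q} + {x + r})) (hs : x + q + r = s) (hB : B₀.sum = s)
    (hBc : B₀.card ≤ 3) (hxq : x ≠ q) : q ∈ B₀ ∨ r ∈ B₀ := by
  have hc : 3 < U.card := by rw [hUe]; simp
  have hle := hN.le_splitMin_of_three hU hV (X₁ := {s} + {x} + {x}) (X₂ := {q})
    (X₃ := {q} + {r} + {r})
    (Y₁ := {q + r}) (Y₂ := {q}) (Y₃ := {x} + {x + r} + B₀) (by rw [hUe]; abel) (by rw [hVe]; abel)
    (by simp; have := h3 x; grind) rfl (by simp [hB]; have := h3 x; grind) (by simp) (by simp) (by simp)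
    (by simp [SmallPiece]) (by simp [SmallPiece])
  obtain ⟨h4, h5, -, hcom⟩ := hle
  obtain ⟨t, ht, ht'⟩ := hcom (by
    simp only [Multiset.card_add, Multiset.card_singleton] at h5 ⊢; omega)
  simp only [Multiset.mem_add, Multiset.mem_singleton] at ht ht'
  have hx0 : x ≠ 0 := hU.not_zero_mem (by omega) (by rw [hUe]; simp)
  have hqx : q ≠ x + r := by
    intro h
    refine hU.sum_ne_zero (X := {s} + {q}) (Multiset.le_iff_exists_add.2
      ⟨{x} + {x} + {q} + {r} + {r}, by rw [hUe]; abel⟩) (by simp) (by rw [hUe]; simp) ?_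
    simp only [Multiset.sum_add, Multiset.sum_singleton]
    have := h3 q
    grind
  have hrx : r ≠ x := by
    rintro rfl
    exact hU.not_three h3 hc (x := r) (R := {r} + {s} + {q} + {q}) (by rw [hUe]; abel)
  rcases ht with (rfl | rfl) | rfl
  · rcases ht' with (h | h) | h
    · exact absurd h.symm hxq
    · exact absurd h hqx
    · exact Or.inl h
  all_goals
    rcases ht' with (h | h) | h
    · exact absurd h hrx
    · exact absurd (by simpa using h) hx0
    · exact Or.inr h

/-- The roles of `x` and `q` are symmetric, so `mem_or_mem` applies twice and yields `r ∈ B₀`. The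
rest `C` of `B₀` has sum `x + q`, and either form of `C` permits a regrouping into four small
pieces. -/
theorem NoShortSplit.false_of_double_triple_of_sums (h3 : ∀ g : G, g + g + g = 0)
    (hN : NoShortSplit 4 U V) (hU : MinZeroSum id U)
    (hV : MinZeroSum id V) {x q r s : G} {B₀ : Multiset G}
    (hUe : U = {x} + {q} + {r} + ({x} + {q} + {r}) + {s})
    (hVe : V = B₀ + ({x} + {q + r}) + ({q} + {x + r})) (hs : x + q + r = s) (hB : B₀.sum = s)
    (hBc : B₀.card ≤ 3) (hBc' : 2 ≤ B₀.card) (hxq : x ≠ q) : False := by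
  have hc : 3 < U.card := by rw [hUe]; simp
  have h1 := hN.mem_or_mem h3 hU hV hUe hVe hs hB hBc hxq
  have h2 := hN.mem_or_mem h3 hU hV (x := q) (q := x) (r := r) (s := s) (B₀ := B₀)
    (by rw [hUe]; abel) (by rw [hVe]; abel) (by rw [← hs]; abel) hB hBc hxq.symm
  have hr : r ∈ B₀ := by
    by_contra hr
    obtain ⟨C, rfl⟩ := exists_singleton_add_of_mem (h1.resolve_right hr)
    have hx := h2.resolve_right hr
    rw [Multiset.mem_add, Multiset.mem_singleton] at hx
    obtain ⟨D, rfl⟩ := exists_singleton_add_of_mem (hx.resolve_left hxq)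
    have hr0 : r ≠ 0 := hU.not_zero_mem (by omega) (by rw [hUe]; simp)
    simp only [Multiset.card_add, Multiset.card_singleton, Multiset.sum_add,
      Multiset.sum_singleton] at hBc hB
    rcases Nat.eq_zero_or_pos D.card with h0 | h0
    · rw [Multiset.card_eq_zero.1 h0, Multiset.sum_zero] at hB
      exact hr0 (by grind)
    · obtain ⟨d, rfl⟩ := Multiset.card_eq_one.1 (show D.card = 1 by omega)
      rw [Multiset.sum_singleton] at hB
      have : d = r := by grind
      simp [this] at hr
  obtain ⟨C, rfl⟩ := exists_singleton_add_of_mem hr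
  simp only [Multiset.card_add, Multiset.card_singleton, Multiset.sum_add,
    Multiset.sum_singleton] at hBc hB hBc'
  have hCs : C.sum = x + q := by grind
  by_cases hCxq : C = {x} + {q}
  · have h1 : s ≠ q := by
      rintro rfl
      exact hU.not_three h3 hc (x := s) (R := {x} + {x} + {r} + {r}) (by rw [hUe]; abel)
    have h2 : s ≠ r := by
      rintro rfl
      exact hU.not_three h3 hc (x := s) (R := {x} + {x} + {q} + {q}) (by rw [hUe]; abel)
    have h5 : x ≠ r := by
      rintro rfl
      exact hU.not_three h3 hc (x := x) (R := {x} + {s} + {q} + {q}) (by rw [hUe]; abel)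
    refine hN.false_of_four hU hV (X₁ := {s} + {x} + {x}) (X₂ := {q} + {r}) (X₃ := {q})
      (X₄ := {r}) (Y₁ := {q} + {r}) (Y₂ := {q + r}) (Y₃ := {q}) (Y₄ := {x} + {x} + {x + r})
      (by rw [hUe]; abel) (by rw [hVe, hCxq]; abel) (by simp; have := h3 x; grind)
      (by simp) rfl (by simp; have := h3 x; grind) (by simp) (by simp) (by simp) (by simp)
      (by simp [SmallPiece, h1, h2, hxq, h5]) (by simp [SmallPiece]) (by simp [SmallPiece])
      (by simp [SmallPiece])
  · have hsmall : SmallPiece ({x} + {q}) C := by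
      by_cases hC1 : C.card = 1
      · exact Or.inr (Or.inl hC1)
      · refine Or.inr (Or.inr ⟨by simp only [Multiset.card_add, Multiset.card_singleton]; omega,
          fun t ht htC => ?_⟩)
        obtain ⟨c, rfl, hc⟩ := exists_eq_pair_of_mem htC (by omega) hCs
        rw [Multiset.mem_add, Multiset.mem_singleton, Multiset.mem_singleton] at ht
        rcases ht with rfl | rfl
        · exact hCxq (by rw [add_left_cancel hc])
        · exact hCxq (by rw [add_comm x, add_right_inj] at hc; rw [hc, add_comm])
    refine hN.false_of_four hU hV (X₁ := {q} + {r}) (X₂ := {x} + {r}) (X₃ := {s})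
      (X₄ := {x} + {q}) (Y₁ := {q + r}) (Y₂ := {x + r}) (Y₃ := {x} + {q} + {r}) (Y₄ := C)
      (by rw [hUe]; abel) (by rw [hVe]; abel) (by simp) (by simp) (by simp; grind) (by simp [hCs])
      (by simp) (by simp) (by simp) (by simp) (by simp [SmallPiece]) (by simp [SmallPiece])
      (by simp [SmallPiece]) hsmall

/-- Each of the pairs `B₁`, `B₂` meets both triples `A₀`, `A₁`, and must do so in one and the same
element. If the two pairs share this element, a direct regrouping works; otherwise `A₀ = A₁` and
`false_of_double_triple_of_sums` applies. -/
theorem TriSplit.false_of_three_one (h3 : ∀ g : G, g + g + g = 0)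
    {A₀ A₁ A₂ B₀ B₁ B₂ : Multiset G} {s : G}
    (h : TriSplit U V A₀ A₁ A₂ B₀ B₁ B₂ s) (hU : MinZeroSum id U) (hV : MinZeroSum id V)
    (hN : NoShortSplit 4 U V) (hA₀ : A₀.card = 3) (hA₁ : A₁.card = 3) (hA₂ : A₂.card = 1)
    (hB₀ : B₀.card ≤ 3) (hB₀' : 2 ≤ B₀.card) (hB₁ : B₁.card = 2) (hB₂ : B₂.card = 2) : False := by
  have hb := h.bounds hU hV
  have hl := h.lt_sums hN
  have hc := h.card_eq
  have e2 := exists_eq_singleton hA₂ h.a₂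
  subst e2
  -- Otherwise the six elements regroup into a part `x + y` of size 2 and one of size 4, and
  -- `false_of_two_one` applies.
  have key : ∀ x ∈ A₀, ∀ y ∈ A₁, x + y ≠ s := by
    intro x hx y hy hxy
    obtain ⟨C₀, rfl⟩ := exists_singleton_add_of_mem hx
    obtain ⟨C₁, rfl⟩ := exists_singleton_add_of_mem hy
    have h' : TriSplit U V (C₀ + C₁) ({x} + {y}) {s} B₀ B₁ B₂ s := by
      refine ⟨by rw [h.eqU]; abel, h.eqV, ?_, by simpa using hxy, h.a₂, h.b₀, h.b₁, h.b₂, h.ne⟩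
      have e1 := h.a₀
      have e2 := h.a₁
      simp only [Multiset.sum_add, Multiset.sum_singleton] at e1 e2 ⊢
      grind
    exact h'.false_of_two_one h3 hU hV hN (by simp) (by simp) hB₀ hB₁ hB₂
  have pick : ∀ B : Multiset G, B.card = 2 → B.sum = s → (∃ t ∈ A₀, t ∈ B) → (∃ t ∈ A₁, t ∈ B) →
      ∃ x y, B = {x} + {y} ∧ x + y = s ∧ x ∈ A₀ ∧ x ∈ A₁ := by
    rintro B hBc hBs ⟨x, hx, hxB⟩ ⟨t, ht, htB⟩
    obtain ⟨y, rfl, hxy⟩ := exists_eq_pair_of_mem hxB hBc hBs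
    rw [Multiset.mem_add, Multiset.mem_singleton, Multiset.mem_singleton] at htB
    rcases htB with rfl | rfl
    · exact ⟨t, y, rfl, hxy, hx, ht⟩
    · exact absurd hxy (key x hx t ht)
  obtain ⟨x, y, rfl, hxy, hx0, hx1⟩ := pick B₁ hB₁ h.b₁
    (h.swap₀₁'.exists_common hU hV (by omega)) (h.swap₀₁.swap₀₁'.exists_common hU hV (by omega))
  obtain ⟨z, w, rfl, hzw, hz0, hz1⟩ := pick B₂ hB₂ h.b₂
    (h.swap₁₂'.swap₀₁'.exists_common hU hV (by omega))
    (h.swap₀₁.swap₁₂'.swap₀₁'.exists_common hU hV (by omega))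
  obtain ⟨C₀, rfl⟩ := exists_singleton_add_of_mem hx0
  obtain ⟨C₁, rfl⟩ := exists_singleton_add_of_mem hx1
  have e0 := h.a₀
  have e1 := h.a₁
  simp only [Multiset.sum_add, Multiset.sum_singleton] at e0 e1
  rw [Multiset.card_add, Multiset.card_singleton] at hA₀ hA₁
  by_cases hzx : z = x
  · subst hzx
    obtain rfl : y = w := add_left_cancel (hxy.trans hzw.symm)
    have := hN.le_splitMin_of_three hU hV (X₁ := {s} + {z} + {z}) (X₂ := C₀) (X₃ := C₁)
      (Y₁ := {y}) (Y₂ := {y}) (Y₃ := {z} + {z} + B₀) (by rw [h.eqU]; abel) (by rw [h.eqV]; abel)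
      (by simp; have := h3 z; grind) (by simp; grind) (by simp [h.b₀]; have := h3 z; grind)
      (by simp) (by rintro rfl; simp at hA₀) (by rintro rfl; simp at hA₁)
      (by simp [SmallPiece]) (by simp [SmallPiece])
    omega
  · rw [Multiset.mem_add, Multiset.mem_singleton] at hz0 hz1
    obtain ⟨r, rfl, hr⟩ := exists_eq_pair_of_mem (s := y) (hz0.resolve_left hzx) (by omega)
      (by grind)
    obtain ⟨r', rfl, hr'⟩ := exists_eq_pair_of_mem (s := y) (hz1.resolve_left hzx) (by omega)
      (by grind)
    obtain rfl : r = r' := add_left_cancel (hr.trans hr'.symm)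
    subst hr
    obtain rfl : w = x + r := by grind
    exact hN.false_of_double_triple_of_sums h3 hU hV (x := x) (q := z) (r := r) (s := s) (B₀ := B₀)
      (by rw [h.eqU]; abel) h.eqV (by rw [← hxy]; abel) h.b₀ hB₀ hB₀' (Ne.symm hzx)

theorem NoShortSplit.false_of_shifted (h3 : ∀ g : G, g + g + g = 0)
    (hN : NoShortSplit 4 U V) (hU : MinZeroSum id U)
    (hV : MinZeroSum id V) {p c d e e' q : G}
    (hUe : U = {p} + {c} + {d} + ({p} + {q}) + ({d} + {e}))
    (hVe : V = {p} + {c} + {d} + ({p} + {q}) + ({c} + {e'})) (he : e = p + c) (he' : e' = p + d)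
    (hq : q = c + d) : False := by
  have := h3 p
  exact hN.false_of_four hU hV (X₁ := {e} + {p} + {p}) (X₂ := {d}) (X₃ := {c} + {d}) (X₄ := {q})
    (Y₁ := {c}) (Y₂ := {e'} + {p} + {p}) (Y₃ := {q}) (Y₄ := {c} + {d})
    (by rw [hUe]; abel) (by rw [hVe]; abel) (by simp; grind) (by simp; grind) (by simp [hq])
    (by simp [hq]) (by simp) (by simp) (by simp) (by simp)
    (by simp [SmallPiece]) (by simp [SmallPiece]) (by simp [SmallPiece]) (by simp [SmallPiece])

theorem NoShortSplit.false_of_crossed (h3 : ∀ g : G, g + g + g = 0)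
    (hN : NoShortSplit 4 U V) (hU : MinZeroSum id U)
    (hV : MinZeroSum id V) {x y d e e' : G}
    (hUe : U = {x} + {y} + {d} + ({x} + {e}) + ({y} + {e'}))
    (hVe : V = {x} + {y} + {d} + ({x} + {e}) + ({y} + {e'})) (he : e = y + d) (he' : e' = x + d) :
    False := by
  have hc : 3 < U.card := by rw [hUe]; simp
  have hd0 : d ≠ 0 := hU.not_zero_mem (by omega) (by rw [hUe]; simp)
  have h1 : e ≠ x := by
    rintro rfl
    exact hU.not_three h3 hc (x := e) (R := {y} + {d} + {y} + {e'}) (by rw [hUe]; abel)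
  have h2 : e ≠ y := fun h => hd0 (by grind)
  have h4 : e' ≠ x := fun h => hd0 (by grind)
  have h5 : e' ≠ y := by
    rintro rfl
    exact hU.not_three h3 hc (x := e') (R := {x} + {d} + {x} + {e}) (by rw [hUe]; abel)
  have h6 : d ≠ x := by
    rintro rfl
    exact hU.not_three h3 hc (x := d) (R := {y} + {y} + {e} + {e'}) (by rw [hUe]; abel)
  have h7 : d ≠ y := by
    rintro rfl
    exact hU.not_three h3 hc (x := d) (R := {x} + {x} + {e} + {e'}) (by rw [hUe]; abel)
  have := h3 d
  refine hN.false_of_four hU hV (X₁ := {e} + {e'} + {d}) (X₂ := {x} + {y}) (X₃ := {x}) (X₄ := {y})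
    (Y₁ := {x} + {y}) (Y₂ := {e} + {e'} + {d}) (Y₃ := {x}) (Y₄ := {y})
    (by rw [hUe]; abel) (by rw [hVe]; abel) (by simp; grind)
    (by simp; grind) rfl rfl (by simp) (by simp) (by simp) (by simp)
    (by simp [SmallPiece, h1, h2, h4, h5, h6, h7])
    (by simp [SmallPiece, h1.symm, h2.symm, h4.symm, h5.symm, h6.symm, h7.symm])
    (by simp [SmallPiece]) (by simp [SmallPiece])

theorem TriSplit.not_common {A₀ A₁ A₂ B₀ B₁ B₂ : Multiset G} {s : G}
    (h : TriSplit U V A₀ A₁ A₂ B₀ B₁ B₂ s) (hA : 2 ≤ A₀.card) (hm : splitMin A₀ B₀ = 1) {x : G}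
    (h1 : x ∈ A₀) (h2 : x ∈ B₀) : False :=
  (hm ▸ splits_splitMin (h.a₀.trans h.b₀.symm)).not_common hA h1 h2

theorem TriSplit.not_mem_three (h3 : ∀ g : G, g + g + g = 0)
    {A₀ A₁ A₂ B₀ B₁ B₂ : Multiset G} {s : G}
    (h : TriSplit U V A₀ A₁ A₂ B₀ B₁ B₂ s) (hU : MinZeroSum id U) (hc : 3 < U.card) {x : G}
    (h0 : x ∈ A₀) (h1 : x ∈ A₁) (h2 : x ∈ A₂) : False := by
  obtain ⟨C₀, rfl⟩ := exists_singleton_add_of_mem h0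
  obtain ⟨C₁, rfl⟩ := exists_singleton_add_of_mem h1
  obtain ⟨C₂, rfl⟩ := exists_singleton_add_of_mem h2
  exact hU.not_three h3 (x := x) (R := C₀ + C₁ + C₂) hc (by rw [h.eqU]; abel)

/-- The matching inequalities force `splitMin A₀ B₀ = 3` whatever `splitMin A₁ B₁` is, so `A₀ = B₀`
is a triple. Tracing which of its elements occur in the four pairs leaves only the configurations of
`false_of_shifted` and `false_of_crossed`. -/
theorem TriSplit.false_of_splitMin_eq_one (h3 : ∀ g : G, g + g + g = 0)
    {A₀ A₁ A₂ B₀ B₁ B₂ : Multiset G} {s : G}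
    (h : TriSplit U V A₀ A₁ A₂ B₀ B₁ B₂ s) (hU : MinZeroSum id U) (hV : MinZeroSum id V)
    (hN : NoShortSplit 4 U V) (hA₀ : A₀.card ≤ 3) (hA₀' : 2 ≤ A₀.card) (hA₁ : A₁.card = 2)
    (hA₂ : A₂.card = 2) (hB₀ : B₀.card ≤ 3) (hB₀' : 2 ≤ B₀.card) (hB₁ : B₁.card = 2)
    (hB₂ : B₂.card = 2) (hm : splitMin A₂ B₂ = 1) : False := by
  have hb := h.bounds hU hV
  have hl := h.lt_sums hN
  have hc := h.card_eq
  have hUc : 3 < U.card := by omega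
  have hVc : 3 < V.card := by omega
  obtain ⟨p, hpA₁, hpB₀⟩ := h.swap₀₁.exists_common hU hV (by omega)
  obtain ⟨p', hpA₀, hpB₁⟩ := h.swap₀₁'.exists_common hU hV (by omega)
  by_cases hm11 : splitMin A₁ B₁ = 2
  · have e1 : A₁ = B₁ := h.swap₀₁.swap₀₁'.eq_of_card_le hU hV (by omega) (by omega)
    have hm12 : splitMin A₁ B₂ ≠ 2 := fun hm12 => by
      have e2 : A₁ = B₂ := h.swap₀₁.swap₁₂'.swap₀₁'.eq_of_card_le hU hV (by omega) (by omega)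
      exact h.symm.not_mem_three h3 hV hVc hpB₀ (e1 ▸ hpA₁) (e2 ▸ hpA₁)
    have hm21 : splitMin A₂ B₁ ≠ 2 := fun hm21 => by
      have e2 : A₂ = B₁ := h.swap₁₂.swap₀₁.swap₀₁'.eq_of_card_le hU hV (by omega) (by omega)
      exact h.not_mem_three h3 hU hUc hpA₀ (e1 ▸ hpB₁) (e2 ▸ hpB₁)
    have e0 : A₀ = B₀ := h.eq_of_card_le hU hV (by omega) (by omega)
    have hA3 : A₀.card = 3 := by omega
    obtain ⟨d, hdA₂, hdB₀⟩ := h.swap₁₂.swap₀₁.exists_common hU hV (by omega)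
    obtain ⟨c, hcA₀, hcB₂⟩ := h.swap₁₂'.swap₀₁'.exists_common hU hV (by omega)
    subst e0 e1
    have hdp : d ≠ p := by
      rintro rfl
      exact h.not_mem_three h3 hU hUc hdB₀ hpA₁ hdA₂
    have hcp : c ≠ p := by
      rintro rfl
      exact h.symm.not_mem_three h3 hV hVc hcA₀ hpA₁ hcB₂
    have hcd : c ≠ d := by
      rintro rfl
      exact h.swap₁₂.swap₀₁.swap₁₂'.swap₀₁'.not_common (by omega) hm hdA₂ hcB₂
    obtain ⟨D, rfl⟩ := exists_singleton_add_of_mem hpB₀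
    rw [Multiset.mem_add, Multiset.mem_singleton] at hdB₀ hcA₀
    have hDc : D.card = 2 := by
      rw [Multiset.card_add, Multiset.card_singleton] at hA3; omega
    obtain ⟨t, rfl, ht⟩ := exists_eq_pair_of_mem (s := s - p) (hdB₀.resolve_left hdp) hDc (by
      have := h.a₀
      rw [Multiset.sum_add, Multiset.sum_singleton] at this
      grind)
    have hc' := hcA₀.resolve_left hcp
    rw [Multiset.mem_add, Multiset.mem_singleton, Multiset.mem_singleton] at hc'
    obtain rfl := hc'.resolve_left hcd
    obtain ⟨q, rfl, hq⟩ := exists_eq_pair_of_mem hpA₁ hA₁ h.a₁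
    obtain ⟨e, rfl, he⟩ := exists_eq_pair_of_mem hdA₂ hA₂ h.a₂
    obtain ⟨e', rfl, he'⟩ := exists_eq_pair_of_mem hcB₂ hB₂ h.b₂
    exact hN.false_of_shifted h3 hU hV (p := p) (c := c) (d := d) (e := e) (e' := e') (q := q)
      (by rw [h.eqU]; abel) (by rw [h.eqV]; abel) (by grind) (by grind) (by grind)
  · have e0 : A₀ = B₀ := h.eq_of_card_le hU hV (by omega) (by omega)
    have hA3 : A₀.card = 3 := by omega
    obtain ⟨y, hyA₂, hyB₀⟩ := h.swap₁₂.swap₀₁.exists_common hU hV (by omega)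
    obtain ⟨w, hwA₀, hwB₂⟩ := h.swap₁₂'.swap₀₁'.exists_common hU hV (by omega)
    subst e0
    rename' p => x, hpA₁ => hxA₁, hpB₀ => hxB₀, p' => z, hpA₀ => hzA₀, hpB₁ => hzB₁
    have hyx : y ≠ x := by
      rintro rfl
      exact h.not_mem_three h3 hU hUc hyB₀ hxA₁ hyA₂
    have hwz : w ≠ z := by
      rintro rfl
      exact h.symm.not_mem_three h3 hV hVc hzA₀ hzB₁ hwB₂
    have hzx : z ≠ x := by
      rintro rfl
      exact h.swap₀₁.swap₀₁'.not_common (by omega) (by omega) hxA₁ hzB₁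
    have hwy : w ≠ y := by
      rintro rfl
      exact h.swap₁₂.swap₀₁.swap₁₂'.swap₀₁'.not_common (by omega) hm hyA₂ hwB₂
    obtain ⟨D, rfl⟩ := exists_singleton_add_of_mem hxB₀
    have hDc : D.card = 2 := by
      rw [Multiset.card_add, Multiset.card_singleton] at hA3; omega
    rw [Multiset.mem_add, Multiset.mem_singleton] at hyB₀ hzA₀ hwA₀
    obtain ⟨d, rfl, hd⟩ := exists_eq_pair_of_mem (s := s - x) (hyB₀.resolve_left hyx) hDc (by
      have := h.a₀
      rw [Multiset.sum_add, Multiset.sum_singleton] at this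
      grind)
    rw [Multiset.mem_add, Multiset.mem_singleton, Multiset.mem_singleton] at hzA₀ hwA₀
    obtain ⟨e₁, rfl, he₁⟩ := exists_eq_pair_of_mem hxA₁ hA₁ h.a₁
    obtain ⟨e₂, rfl, he₂⟩ := exists_eq_pair_of_mem hyA₂ hA₂ h.a₂
    obtain ⟨e₃, rfl, he₃⟩ := exists_eq_pair_of_mem hzB₁ hB₁ h.b₁
    obtain ⟨e₄, rfl, he₄⟩ := exists_eq_pair_of_mem hwB₂ hB₂ h.b₂
    rcases hzA₀.resolve_left hzx with rfl | rfl
    · obtain rfl : e₂ = e₃ := add_left_cancel (he₂.trans he₃.symm)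
      rcases hwA₀ with rfl | rfl | rfl
      · obtain rfl : e₁ = e₄ := add_left_cancel (he₁.trans he₄.symm)
        exact hN.false_of_crossed h3 hU hV (x := w) (y := z) (d := d) (e := e₁) (e' := e₂)
          (by rw [h.eqU]; abel) (by rw [h.eqV]; abel) (by grind) (by grind)
      · exact absurd rfl hwy
      · exact hN.false_of_shifted h3 hU hV (p := z) (c := w) (d := x) (e := e₁) (e' := e₄)
          (q := e₂) (by rw [h.eqU]; abel) (by rw [h.eqV]; abel) (by grind) (by grind) (by grind)
    · rcases hwA₀ with rfl | rfl | rfl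
      · obtain rfl : e₁ = e₄ := add_left_cancel (he₁.trans he₄.symm)
        exact hN.false_of_shifted h3 hU hV (p := w) (c := z) (d := y) (e := e₂) (e' := e₃)
          (q := e₁) (by rw [h.eqU]; abel) (by rw [h.eqV]; abel) (by grind) (by grind) (by grind)
      · exact absurd rfl hwy
      · exact absurd rfl hwz

/-- All matchings have total at least 5. After sorting, the cases are whether the smallest part on
each side is a singleton. If neither is, both size patterns are `(2, 2, 2)` or `(3, 2, 2)`; once no
entry between the pairs is 1, all pairs coincide and some element occurs three times. -/
theorem TriSplit.false_of_card_le_seven (h3 : ∀ g : G, g + g + g = 0)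
    {A₀ A₁ A₂ B₀ B₁ B₂ : Multiset G} {s : G}
    (h : TriSplit U V A₀ A₁ A₂ B₀ B₁ B₂ s) (hU : MinZeroSum id U) (hV : MinZeroSum id V)
    (hN : NoShortSplit 4 U V) (hUc : U.card ≤ 7) (hVc : V.card ≤ 7) : False := by
  refine TriSplit.false_of_sorted (fun A₀ A₁ A₂ B₀ B₁ B₂ h hA hA' hB hB' => ?_) h
  have hb := h.bounds hU hV
  have hl := h.lt_sums hN
  have hc := h.card_eq
  by_cases hA₂ : A₂.card = 1
  · by_cases hB₂ : B₂.card = 1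
    · have e1 : A₀ = B₀ := h.eq_of_card_le hU hV (by omega) (by omega)
      have e2 : A₀ = B₁ := h.swap₀₁'.eq_of_card_le hU hV (by omega) (by omega)
      have e3 : A₁ = B₀ := h.swap₀₁.eq_of_card_le hU hV (by omega) (by omega)
      have e4 := exists_eq_singleton hA₂ h.a₂
      have e5 := exists_eq_singleton hB₂ h.b₂
      obtain ⟨p, q, r, hpqr, hs⟩ := exists_eq_triple (show A₀.card = 3 by omega) h.a₀
      have hUe := h.eqU
      have hVe := h.eqV
      rw [e3, ← e1, hpqr, e4] at hUe
      rw [← e1, ← e2, hpqr, e5] at hVe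
      exact hN.false_of_double_triple h3 hU hV hUe hVe hs
    · by_cases hA₁ : A₁.card = 2
      · exact h.false_of_two_one h3 hU hV hN hA₁ hA₂ (by omega) (by omega) (by omega)
      · exact h.false_of_three_one h3 hU hV hN (by omega) (by omega) hA₂ (by omega) (by omega)
          (by omega) (by omega)
  · by_cases hB₂ : B₂.card = 1
    · by_cases hB₁ : B₁.card = 2
      · exact h.symm.false_of_two_one h3 hV hU hN.symm hB₁ hB₂ (by omega) (by omega) (by omega)
      · exact h.symm.false_of_three_one h3 hV hU hN.symm (by omega) (by omega) hB₂ (by omega)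
          (by omega) (by omega) (by omega)
    · have key : ∀ A₁ A₂ B₁ B₂ : Multiset G, TriSplit U V A₀ A₁ A₂ B₀ B₁ B₂ s → A₁.card = 2 →
          A₂.card = 2 → B₁.card = 2 → B₂.card = 2 → splitMin A₂ B₂ ≠ 1 :=
        fun A₁ A₂ B₁ B₂ h h1 h2 h4 h5 hm => h.false_of_splitMin_eq_one h3 hU hV hN (by omega)
          (by omega) h1 h2 (by omega) (by omega) h4 h5 hm
      have k1 := key A₁ A₂ B₁ B₂ h (by omega) (by omega) (by omega) (by omega)
      have k2 := key A₂ A₁ B₁ B₂ h.swap₁₂ (by omega) (by omega) (by omega) (by omega)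
      have k3 := key A₁ A₂ B₂ B₁ h.swap₁₂' (by omega) (by omega) (by omega) (by omega)
      have k4 := key A₂ A₁ B₂ B₁ h.swap₁₂.swap₁₂' (by omega) (by omega) (by omega) (by omega)
      have e1 : A₁ = B₁ := h.swap₀₁.swap₀₁'.eq_of_card_le hU hV (by omega) (by omega)
      have e2 : A₁ = B₂ := h.swap₀₁.swap₁₂'.swap₀₁'.eq_of_card_le hU hV (by omega) (by omega)
      have e3 : A₂ = B₁ := h.swap₁₂.swap₀₁.swap₀₁'.eq_of_card_le hU hV (by omega) (by omega)
      by_cases hm : splitMin A₀ B₁ = 1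
      · obtain ⟨x, hx, hx'⟩ := h.swap₀₁.exists_common hU hV (by omega)
        exact h.symm.not_mem_three h3 hV (by omega) hx' (e1 ▸ hx) (e2 ▸ hx)
      · obtain ⟨x, hx, hx'⟩ := h.swap₀₁'.exists_common hU hV (by omega)
        exact h.not_mem_three h3 hU (by omega) hx (e1 ▸ hx') (e3 ▸ hx')

end ExponentThree

/-! ### Elementary three-groups of small rank -/

section ZModThree

variable {G : Type*} [AddCommGroup G] {U V : Multiset G}

theorem IsFac.exists_pieces {z : Multiset (Multiset G)} (hz : IsFac id z) (hU : MinZeroSum id U)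
    (hV : MinZeroSum id V) (hs : z.sum = U + V.map fun g => -g) (h3 : 3 ≤ z.card) :
    ∃ w : Multiset (Multiset G × Multiset G), w.card = z.card ∧
      U = (w.map Prod.fst).sum ∧ V = (w.map Prod.snd).sum ∧
      ∀ p ∈ w, p.1 ≠ 0 ∧ p.1.sum = p.2.sum := by
  obtain ⟨w, rfl, hw1, hw2⟩ := exists_split_of_sum_eq_add hs
  refine ⟨w.map fun p => (p.1, p.2.map fun g => -g), by simp, by simpa using hw1, ?_, ?_⟩
  · rw [← map_neg_map_neg V, hw2]
    have := map_multiset_sum (Multiset.mapAddMonoidHom fun g : G => -g) (w.map Prod.snd)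
    simp only [Multiset.coe_mapAddMonoidHom, Multiset.map_map] at this
    rw [this, Multiset.map_map]
    rfl
  · intro q hq
    obtain ⟨p, hp, rfl⟩ := Multiset.mem_map.1 hq
    have hatom := hz _ (Multiset.mem_map_of_mem _ hp)
    refine ⟨fun h0 => ?_, by rw [← zeroSum_add_map_neg, map_neg_map_neg]; exact hatom.2.1⟩
    -- An atom taken only from `-V` is all of `-V`, so the rest is `U` and `z` has length 2,
    -- contrary to `h3`.
    have h0 : p.1 = 0 := h0
    have hle : p.2 ≤ V.map fun g => -g := by
      rw [hw2]; exact le_sum_map_of_mem Prod.snd hp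
    rw [h0, zero_add] at hatom
    have hpV := hatom.eq_of_le (minZeroSum_map_neg hV) hle
    obtain ⟨w', rfl⟩ := Multiset.exists_cons_of_mem hp
    rw [Multiset.map_cons, Multiset.sum_cons, h0, hpV, zero_add, add_comm,
      add_left_inj] at hs
    have := (hz.mono (Multiset.map_le_map (Multiset.le_cons_self w' p))).card_eq_one (hs ▸ hU)
    simp only [Multiset.card_map, Multiset.card_cons] at this h3
    omega

theorem add_add_eq_zero_of_module [Module (ZMod 3) G] (g : G) : g + g + g = 0 := by
  have h : ((3 : ℕ) : ZMod 3) • g = 0 := by rw [ZMod.natCast_self, zero_smul]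
  rw [Nat.cast_smul_eq_nsmul] at h
  rw [← h]
  abel

theorem sum_eq_add_add_of_zmod_three {ι M : Type*} [Fintype ι] [AddCommMonoid M] (c : ι → ZMod 3)
    (F : ι → M) : ∑ i, F i = ∑ i with c i = 0, F i + ∑ i with c i = 1, F i +
      ∑ i with c i = 2, F i := by
  rw [← Finset.sum_fiberwise Finset.univ c F]
  exact Fin.sum_univ_three fun k : ZMod 3 => ∑ i with c i = k, F i

/-- One piece `p` is set aside; the sums of the other pieces, at least `finrank + 1` of them, are
linearly dependent. Let `σₖ` be the total over the pieces with coefficient `k`, with `p` counted at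
`k = 0`. The relation `σ₁ + 2σ₂ = 0` gives `σ₁ = σ₂`, and `σ₀ + σ₁ + σ₂ = 0` gives `σ₀ = σ₁`. -/
theorem exists_triSplit [Module (ZMod 3) G] [Module.Finite (ZMod 3) G] {z : Multiset (Multiset G)}
    (hz : IsFac id z) (hU : MinZeroSum id U) (hV : MinZeroSum id V)
    (hs : z.sum = U + V.map fun g => -g) (h3 : 3 ≤ z.card)
    (hr : Module.finrank (ZMod 3) G + 2 ≤ z.card) :
    ∃ A₀ A₁ A₂ B₀ B₁ B₂ s, TriSplit U V A₀ A₁ A₂ B₀ B₁ B₂ s := by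
  obtain ⟨w, hwc, hw1, hw2, hw⟩ := hz.exists_pieces hU hV hs h3
  obtain ⟨p, hp⟩ := Multiset.card_pos_iff_exists_mem.1 (show 0 < w.card by omega)
  obtain ⟨w', rfl⟩ := Multiset.exists_cons_of_mem hp
  obtain ⟨q, hq⟩ := exists_fin_map_eq w'
  have hdep : ¬ LinearIndependent (ZMod 3) fun i => (q i).1.sum := fun h => by
    have := h.fintype_card_le_finrank
    rw [Fintype.card_fin] at this
    rw [Multiset.card_cons] at hwc
    omega
  have hqm : ∀ i, q i ∈ p ::ₘ w' := fun i => by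
    rw [hq]
    exact Multiset.mem_cons_of_mem (Multiset.mem_map_of_mem _ (Finset.mem_univ i))
  obtain ⟨c, hc, j, hj⟩ := Fintype.not_linearIndependent_iff.1 hdep
  have hwq : ∀ F : Multiset G × Multiset G → Multiset G, (w'.map F).sum = ∑ i, F (q i) :=
    fun F => (congrArg (fun v => (v.map F).sum) hq).trans (by rw [Multiset.map_map]; rfl)
  have e1 : U = p.1 + ∑ i, (q i).1 := by
    rw [hw1, Multiset.map_cons, Multiset.sum_cons, hwq]
  have e2 : V = p.2 + ∑ i, (q i).2 := by
    rw [hw2, Multiset.map_cons, Multiset.sum_cons, hwq]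
  clear hw1 hw2
  rw [sum_eq_add_add_of_zmod_three c] at e1 e2 hc
  have hsum : ∀ (k : ZMod 3) (F : Fin w'.card → Multiset G),
      (∑ i with c i = k, F i).sum = ∑ i with c i = k, (F i).sum := fun k F =>
    map_sum Multiset.sumAddMonoidHom F _
  have hy : ∀ k : ZMod 3, ∑ i with c i = k, (q i).2.sum = ∑ i with c i = k, (q i).1.sum :=
    fun k => Finset.sum_congr rfl fun i _ => ((hw _ (hqm i)).2).symm
  have hx : ∀ k : ZMod 3, ∑ i with c i = k, c i • (q i).1.sum =
      k • ∑ i with c i = k, (q i).1.sum := fun k => by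
    rw [Finset.smul_sum]
    exact Finset.sum_congr rfl fun i hi => by rw [(Finset.mem_filter.1 hi).2]
  rw [hx, hx, hx, zero_smul, one_smul, two_smul, zero_add] at hc
  have hU0 := hU.sum_eq_zero
  rw [e1] at hU0
  simp only [Multiset.sum_add, hsum] at hU0
  have t2 := add_add_eq_zero_of_module (∑ i with c i = 2, (q i).1.sum)
  have t1 := add_add_eq_zero_of_module (∑ i with c i = 1, (q i).1.sum)
  have h12 : ∑ i with c i = 1, (q i).1.sum = ∑ i with c i = 2, (q i).1.sum := by grind
  have h02 : p.1.sum + ∑ i with c i = 0, (q i).1.sum = ∑ i with c i = 2, (q i).1.sum := by grind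
  have hp2 := (hw p (Multiset.mem_cons_self _ _)).2
  refine ⟨p.1 + ∑ i with c i = 0, (q i).1, ∑ i with c i = 1, (q i).1, ∑ i with c i = 2, (q i).1,
    p.2 + ∑ i with c i = 0, (q i).2, ∑ i with c i = 1, (q i).2, ∑ i with c i = 2, (q i).2,
    ∑ i with c i = 2, (q i).1.sum, ?_, ?_, ?_, ?_, ?_, ?_, ?_, ?_, ?_⟩
  · rw [e1]; abel
  · rw [e2]; abel
  · rw [Multiset.sum_add, hsum, h02]
  · rw [hsum, h12]
  · rw [hsum]
  · rw [Multiset.sum_add, hsum, hy, ← hp2, h02]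
  · rw [hsum, hy, h12]
  · rw [hsum, hy]
  -- The first part of `U` contains `p.1 ≠ 0` and misses the piece `j` with nonzero coefficient. It
  -- is therefore a proper nonempty part of an atom.
  · rw [← h02, ← hsum, ← Multiset.sum_add]
    have hXj : ∀ k, (q j).1 ≤ ∑ i with c i = k, (q i).1 ∨ c j ≠ k := fun k => by
      by_cases h : c j = k
      · exact Or.inl (Finset.single_le_sum (f := fun i => (q i).1) (fun _ _ => zero_le)
          (by simp [h]))
      · exact Or.inr h
    have hj0 : 0 < (q j).1.card := Multiset.card_pos.2 (hw _ (hqm j)).1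
    have hlt : 0 < (∑ i with c i = 1, (q i).1).card ∨ 0 < (∑ i with c i = 2, (q i).1).card := by
      have h012 : ∀ k : ZMod 3, k ≠ 0 → k = 1 ∨ k = 2 := by decide
      rcases h012 _ hj with h | h
      · exact Or.inl (hj0.trans_le (Multiset.card_le_card ((hXj 1).resolve_right (by simp [h]))))
      · exact Or.inr (hj0.trans_le (Multiset.card_le_card ((hXj 2).resolve_right (by simp [h]))))
    refine hU.sum_ne_zero (Multiset.le_iff_exists_add.2
      ⟨∑ i with c i = 1, (q i).1 + ∑ i with c i = 2, (q i).1, by rw [e1]; abel⟩) (fun h => ?_) ?_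
    · exact (hw p (Multiset.mem_cons_self _ _)).1 (add_eq_zero.1 h).1
    · have := congrArg Multiset.card e1
      simp only [Multiset.card_add] at this ⊢
      omega

theorem dalethLE_of_noShortSplit {N : ℕ} (h : ∀ U V : Multiset G, MinZeroSum id U →
    MinZeroSum id V → NoShortSplit N U V → ∀ z, IsFac id z → z.sum = U + (V.map fun g => -g) →
      N < z.card → False) : DalethLE (id : G → G) N := by
  intro U V hU hV z hz hs h3
  by_contra! hcon
  have hV' : U + V = U + (V.map fun g => -g).map fun g => -g := by rw [map_neg_map_neg]
  refine h U (V.map fun g => -g) hU (minZeroSum_map_neg hV) ?_ z hz (hs.trans hV')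
    (hcon z hz hs h3)
  rintro n hn hnN ⟨z', hz', hs', rfl⟩
  exact absurd (hcon z' hz' (hs'.trans hV'.symm) hn) (not_lt.2 hnN)

theorem dalethLE_three [Module (ZMod 3) G] [Module.Finite (ZMod 3) G]
    (hr : Module.finrank (ZMod 3) G = 2) : DalethLE (id : G → G) 3 := by
  refine dalethLE_of_noShortSplit fun U V hU hV hN z hz hs hc => ?_
  obtain ⟨A₀, A₁, A₂, B₀, B₁, B₂, s, h⟩ := exists_triSplit hz hU hV hs (by omega) (by omega)
  have hD := davenportLE_finrank (f := (id : G → G)) 3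
  rw [hr] at hD
  exact h.false_of_card_le_five add_add_eq_zero_of_module hU hV hN (hD.card_le hU) (hD.card_le hV)

theorem dalethLE_four [Module (ZMod 3) G] [Module.Finite (ZMod 3) G]
    (hr : Module.finrank (ZMod 3) G = 3) : DalethLE (id : G → G) 4 := by
  refine dalethLE_of_noShortSplit fun U V hU hV hN z hz hs hc => ?_
  obtain ⟨A₀, A₁, A₂, B₀, B₁, B₂, s, h⟩ := exists_triSplit hz hU hV hs (by omega) (by omega)
  have hD := davenportLE_finrank (f := (id : G → G)) 3
  rw [hr] at hD
  exact h.false_of_card_le_seven add_add_eq_zero_of_module hU hV hN (hD.card_le hU) (hD.card_le hV)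

end ZModThree

/-! ### The group `C₂ ⊕ C₄` -/

section ZModTwoFour

/-- The reduction `C₂ ⊕ C₄ → C₂ ⊕ C₂`. -/
def reduceTwoFour : ZMod 2 × ZMod 4 →+ ZMod 2 × ZMod 2 :=
  AddMonoidHom.prodMap (AddMonoidHom.id _) (ZMod.castHom (show 2 ∣ 4 by decide) (ZMod 2)).toAddMonoidHom

theorem eq_zero_or_eq_of_reduceTwoFour_eq_zero :
    ∀ a, reduceTwoFour a = 0 → a = 0 ∨ a = (0, 2) := by
  decide

theorem exists_pair_of_reduceTwoFour {S : Multiset (ZMod 2 × ZMod 4)} (hS : 5 ≤ S.card) :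
    ∃ x y R, S = {x} + {y} + R ∧ reduceTwoFour x = reduceTwoFour y := by
  by_contra! hcon
  have hnd : (S.map reduceTwoFour).Nodup := by
    rw [Multiset.nodup_iff_le]
    intro a ha
    obtain ⟨T, hT, hTa⟩ := exists_map_eq_of_le_map ha
    have hc : T.card = 2 := by rw [← Multiset.card_map reduceTwoFour, hTa]; rfl
    obtain ⟨x, y, rfl⟩ := Multiset.card_eq_two.1 hc
    obtain ⟨R, rfl⟩ := Multiset.le_iff_exists_add.1 hT
    have h : reduceTwoFour x ∈ a ::ₘ a ::ₘ 0 := by rw [← hTa]; simp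
    have h' : reduceTwoFour y ∈ a ::ₘ a ::ₘ 0 := by rw [← hTa]; simp
    simp only [Multiset.mem_cons, Multiset.notMem_zero, or_false, or_self] at h h'
    exact hcon x y R rfl (h.trans h'.symm)
  have := Multiset.card_le_card (Multiset.le_iff_subset hnd |>.2 fun a _ => Finset.mem_univ_val a)
  simp at this
  omega

/-- Modulo the kernel `{0, (0, 2)}` two elements coincide, and the other three contain a zero-sum
part. Both sums lie in the kernel, so one of them or their total vanishes. -/
theorem davenportLE_five : DavenportLE (id : ZMod 2 × ZMod 4 → ZMod 2 × ZMod 4) 5 := by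
  intro S hS
  obtain ⟨x, y, R, rfl, hxy⟩ := exists_pair_of_reduceTwoFour hS
  have hD := davenportLE_finrank (f := reduceTwoFour) 2
  obtain ⟨T, hT, hT0, hTz⟩ := hD R (by simp at hS ⊢; omega)
  have h1 := eq_zero_or_eq_of_reduceTwoFour_eq_zero (x + y) (by
    rw [map_add, hxy]; generalize reduceTwoFour y = a; revert a; decide)
  have h2 := eq_zero_or_eq_of_reduceTwoFour_eq_zero T.sum (by rw [map_multiset_sum]; exact hTz)
  rcases h1 with h1 | h1
  · exact ⟨{x} + {y}, Multiset.le_add_right _ _, by simp, by simpa [ZeroSum] using h1⟩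
  rcases h2 with h2 | h2
  · exact ⟨T, hT.trans (Multiset.le_add_left _ _), hT0, by simpa [ZeroSum] using h2⟩
  refine ⟨{x} + {y} + T, by gcongr, by simp, ?_⟩
  simp only [ZeroSum, Multiset.map_id, Multiset.sum_add, Multiset.sum_singleton, h1, h2]
  decide

theorem NoShortSplit.false_of_add_mem {G : Type*} [AddCommGroup G] {U R : Multiset G}
    (hN : NoShortSplit 4 U U) (hU : MinZeroSum id U) {i j : G}
    (h : U = {i} + {j} + {i + j} + R) (hR : R.card = 2) : False := by
  obtain ⟨l, m, rfl⟩ := Multiset.card_eq_two.1 hR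
  rw [Multiset.insert_eq_cons, ← Multiset.singleton_add] at h
  exact hN.false_of_four hU hU (X₁ := {i} + {j}) (X₂ := {i + j}) (X₃ := {l}) (X₄ := {m})
    (Y₁ := {i + j}) (Y₂ := {i} + {j}) (Y₃ := {l}) (Y₄ := {m}) (by rw [h]; abel) (by rw [h]; abel)
    (by simp) (by simp) rfl rfl (by simp) (by simp) (by simp) (by simp)
    (by simp [SmallPiece]) (by simp [SmallPiece]) (by simp [SmallPiece]) (by simp [SmallPiece])

theorem eq_or_eq_or_eq_of_ne_zero {a b c d : ZMod 2 × ZMod 2} (ha : a ≠ 0) (hb : b ≠ 0) (hc : c ≠ 0)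
    (hd : d ≠ 0) (hab : a ≠ b) (hac : a ≠ c) (hbc : b ≠ c) : d = a ∨ d = b ∨ d = c := by
  have h : ({0, a, b, c} : Finset (ZMod 2 × ZMod 2)).card = 4 := by
    rw [Finset.card_insert_of_notMem (by simp [ha.symm, hb.symm, hc.symm]),
      Finset.card_insert_of_notMem (by simp [hab, hac]), Finset.card_pair hbc]
  have hmem : d ∈ ({0, a, b, c} : Finset (ZMod 2 × ZMod 2)) := by
    rw [Finset.eq_univ_of_card _ (h.trans (by simp))]
    exact Finset.mem_univ d
  simpa [hd] using hmem

/-- Let `x`, `y` have the same reduction, so `x + y = (0, 2)`. If another element reduces to 0, it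
equals `(0, 2) = x + y`. Otherwise the other three have distinct nonzero reductions, one of which is
that of `x`; that element equals `y`, and the remaining two sum to `x`. -/
theorem MinZeroSum.exists_add_mem {U : Multiset (ZMod 2 × ZMod 4)} (hU : MinZeroSum id U)
    (hc : U.card = 5) : ∃ i j R, U = {i} + {j} + {i + j} + R := by
  obtain ⟨x, y, R, hUe, hxy⟩ := exists_pair_of_reduceTwoFour hc.ge
  have pair : ∀ a b R', U = {a} + {b} + R' → reduceTwoFour a = reduceTwoFour b →
      a + b = (0, 2) := by
    intro a b R' h hab
    refine (eq_zero_or_eq_of_reduceTwoFour_eq_zero (a + b) (by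
      rw [map_add, hab]; generalize reduceTwoFour b = a; revert a; decide)).resolve_left ?_
    simpa using hU.sum_ne_zero (X := {a} + {b}) (h ▸ Multiset.le_add_right _ _) (by simp)
      (by rw [hc]; simp)
  have single : ∀ a R', U = {a} + R' → reduceTwoFour a = 0 → a = (0, 2) := by
    intro a R' h ha
    refine (eq_zero_or_eq_of_reduceTwoFour_eq_zero a ha).resolve_left ?_
    simpa using hU.sum_ne_zero (X := {a}) (h ▸ Multiset.le_add_right _ _) (by simp)
      (by rw [hc]; simp)
  have hs := pair x y R hUe hxy
  have hRc : R.card = 3 := by rw [hUe] at hc; simp at hc; omega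
  obtain ⟨r₁, r₂, r₃, rfl⟩ := Multiset.card_eq_three.1 hRc
  simp only [Multiset.insert_eq_cons, ← Multiset.singleton_add] at hUe
  have hz : ∀ a b c, U = {x} + {y} + ({a} + ({b} + {c})) → reduceTwoFour a = 0 →
      ∃ i j R, U = {i} + {j} + {i + j} + R := fun a b c h ha =>
    ⟨x, y, {b} + {c}, by rw [hs, ← single a ({x} + {y} + {b} + {c}) (by rw [h]; abel) ha, h]; abel⟩
  have he : ∀ a b c, U = {x} + {y} + ({a} + ({b} + {c})) → reduceTwoFour a ≠ reduceTwoFour b := by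
    intro a b c h hab
    refine hU.sum_ne_zero (X := {x} + {y} + ({a} + {b}))
      (Multiset.le_iff_exists_add.2 ⟨{c}, by rw [h]; abel⟩) (by simp) (by rw [hc]; simp) ?_
    rw [Multiset.sum_add, Multiset.sum_add, Multiset.sum_add]
    simp only [Multiset.sum_singleton]
    rw [hs, pair a b ({x} + {y} + {c}) (by rw [h]; abel) hab]
    decide
  have hx : ∀ a b c, U = {x} + {y} + ({a} + ({b} + {c})) → reduceTwoFour x = reduceTwoFour a →
      ∃ i j R, U = {i} + {j} + {i + j} + R := by
    intro a b c h hxa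
    have h1 := pair x a ({y} + {b} + {c}) (by rw [h]; abel) hxa
    obtain rfl : y = a := add_left_cancel (hs.trans h1.symm)
    have h0 := hU.sum_eq_zero
    rw [h] at h0
    simp only [Multiset.sum_add, Multiset.sum_singleton] at h0
    have h4 : ((0, 2) : ZMod 2 × ZMod 4) + (0, 2) = 0 := by decide
    exact ⟨b, c, {y} + {y}, by rw [show b + c = x by grind, h]; abel⟩
  have p1 : U = {x} + {y} + ({r₂} + ({r₁} + {r₃})) := by rw [hUe]; abel
  have p2 : U = {x} + {y} + ({r₃} + ({r₁} + {r₂})) := by rw [hUe]; abel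
  have p3 : U = {x} + {y} + ({r₁} + ({r₃} + {r₂})) := by rw [hUe]; abel
  have p4 : U = {x} + {y} + ({r₂} + ({r₃} + {r₁})) := by rw [hUe]; abel
  by_cases h1 : reduceTwoFour r₁ = 0
  · exact hz _ _ _ hUe h1
  by_cases h2 : reduceTwoFour r₂ = 0
  · exact hz _ _ _ p1 h2
  by_cases h3 : reduceTwoFour r₃ = 0
  · exact hz _ _ _ p2 h3
  have hx0 : reduceTwoFour x ≠ 0 := fun h => by
    have h1 := single x ({y} + ({r₁} + ({r₂} + {r₃}))) (by rw [hUe]; abel) h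
    have h2 := single y ({x} + ({r₁} + ({r₂} + {r₃}))) (by rw [hUe]; abel) (hxy ▸ h)
    rw [h1, h2] at hs
    exact absurd hs (by decide)
  rcases eq_or_eq_or_eq_of_ne_zero h1 h2 h3 hx0 (he _ _ _ hUe) (he _ _ _ p3) (he _ _ _ p4)
    with h | h | h
  · exact hx _ _ _ hUe h
  · exact hx _ _ _ p1 h
  · exact hx _ _ _ p2 h

theorem IsFac.eq_of_card_le {G : Type*} [AddCommGroup G] {U V : Multiset G}
    {z : Multiset (Multiset G)} (hz : IsFac id z) (hU : MinZeroSum id U) (hV : MinZeroSum id V)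
    (hs : z.sum = U + V.map fun g => -g) (h3 : 3 ≤ z.card) (hUz : U.card ≤ z.card)
    (hVz : V.card ≤ z.card) : U = V ∧ U.card = z.card := by
  obtain ⟨w, hwc, hw1, hw2, hw⟩ := hz.exists_pieces hU hV hs h3
  have h2 : ∀ p ∈ w, p.1.card = 1 := fun p hp => by
    have h1 : ∀ q ∈ w, 1 ≤ q.1.card := fun q hq => Multiset.card_pos.2 (hw q hq).1
    obtain ⟨w', rfl⟩ := Multiset.exists_cons_of_mem hp
    have := card_le_sum_map (k := 1) fun q hq => h1 q (Multiset.mem_cons_of_mem hq)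
    have h1p := h1 p hp
    rw [hw1, card_sum_map, Multiset.map_cons, Multiset.sum_cons] at hUz
    rw [Multiset.card_cons] at hwc
    omega
  have hUc : U.card = z.card := by
    rw [hw1, card_sum_map, Multiset.map_congr rfl h2]
    simpa using hwc
  have hne : ∀ p ∈ w, p.2 ≠ 0 := fun p hp h0 => by
    have hle : p.1 ≤ U := by rw [hw1]; exact le_sum_map_of_mem Prod.fst hp
    have := h2 p hp
    exact hU.sum_ne_zero hle (hw p hp).1 (by omega) (by rw [(hw p hp).2, h0]; rfl)
  have h4 : ∀ p ∈ w, p.2.card = 1 := fun p hp => by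
    have h1 : ∀ q ∈ w, 1 ≤ q.2.card := fun q hq => Multiset.card_pos.2 (hne q hq)
    obtain ⟨w', rfl⟩ := Multiset.exists_cons_of_mem hp
    have := card_le_sum_map (k := 1) fun q hq => h1 q (Multiset.mem_cons_of_mem hq)
    have h1p := h1 p hp
    rw [hw2, card_sum_map, Multiset.map_cons, Multiset.sum_cons] at hVz
    rw [Multiset.card_cons] at hwc
    omega
  refine ⟨?_, hUc⟩
  rw [hw1, hw2]
  congr 1
  refine Multiset.map_congr rfl fun p hp => ?_
  rw [exists_eq_singleton (h4 p hp) rfl, ← (hw p hp).2]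
  exact exists_eq_singleton (h2 p hp) rfl

/-- A length above 4 with `|U|, |V| ≤ 5` makes every piece a pair, so `U = V` has five elements.
Exchanging `i, j` with `i + j` then gives length 4. -/
theorem dalethLE_four_of_zmod_two_four :
    DalethLE (id : ZMod 2 × ZMod 4 → ZMod 2 × ZMod 4) 4 := by
  refine dalethLE_of_noShortSplit fun U V hU hV hN z hz hs hc => ?_
  have h1 := davenportLE_five.card_le hU
  have h2 := davenportLE_five.card_le hV
  obtain ⟨rfl, hcz⟩ := hz.eq_of_card_le hU hV hs (by omega) (by omega) (by omega)
  obtain ⟨i, j, R, h⟩ := hU.exists_add_mem (by omega)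
  have hUc : U.card = 5 := by omega
  refine hN.false_of_add_mem hU h ?_
  rw [h] at hUc
  simp at hUc
  omega

end ZModTwoFour

/-! ### Finite groups with small invariants -/

section Classification

variable {G : Type*} [AddCommGroup G]

theorem exists_dissociated_card_of_le_finrank (p : ℕ) [Fact p.Prime] [Module (ZMod p) G]
    [Module.Finite (ZMod p) G] {n : ℕ} (hn : n ≤ Module.finrank (ZMod p) G) :
    ∃ S : Multiset G, Dissociated S ∧ S.card = n := by
  classical
  induction n with
  | zero => exact ⟨0, dissociated_zero, rfl⟩
  | succ n ih =>
    obtain ⟨S, hS, hc⟩ := ih (by omega)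
    -- Fewer than `finrank` elements do not span. An element outside the span stays outside after
    -- multiplication by 2, unless that kills it.
    have hlt : Submodule.span (ZMod p) (S.toFinset : Set G) ≠ ⊤ := fun h => by
      have h1 := finrank_span_finset_le_card (R := ZMod p) S.toFinset
      rw [Set.finrank, h, finrank_top] at h1
      have := Multiset.toFinset_card_le S
      omega
    obtain ⟨g, -, hg⟩ := SetLike.exists_of_lt (lt_top_iff_ne_top.2 hlt)
    refine ⟨S + {g}, hS.add_singleton_of_notMem
      (K := (Submodule.span (ZMod p) (S.toFinset : Set G)).toAddSubgroup)
      (fun x hx => Submodule.subset_span (by simpa using hx)) hg fun h => ?_, by simp [hc]⟩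
    by_contra h2
    rw [← Nat.cast_smul_eq_nsmul (ZMod p)] at h h2
    exact hg ((Submodule.smul_mem_iff _ fun h0 => h2 (by rw [h0, zero_smul])).1 h)

theorem nsmul_eq_zero_of_addOrderOf_eq_three (h1 : ∀ g : G, 0 < addOrderOf g ∧ addOrderOf g ≤ 4)
    {g : G} (hg : addOrderOf g = 3) (x : G) : 3 • x = 0 := by
  have hx := h1 x
  rw [← addOrderOf_dvd_iff_nsmul_eq_zero]
  by_contra h
  have hcop : (addOrderOf x).Coprime (addOrderOf g) := by
    rw [hg]
    exact ((Nat.Prime.coprime_iff_not_dvd Nat.prime_three).2 fun h' => h (by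
      obtain ⟨k, hk⟩ := h'
      rw [show k = 1 by omega] at hk
      rw [hk])).symm
  have := (AddCommute.all x g).addOrderOf_add_eq_mul_addOrderOf_of_coprime hcop
  rw [hg] at this
  have := h1 (x + g)
  have : addOrderOf x ≠ 1 := fun h' => h (by rw [h']; exact one_dvd _)
  omega

/-- The homomorphism from a cyclic group given by an element of suitable order. -/
def zmodHom (n : ℕ) (g : G) (h : n • g = 0) : ZMod n →+ G :=
  ZMod.lift n ⟨zmultiplesHom G g, by simpa using h⟩

theorem zmodHom_intCast {n : ℕ} {g : G} (h : n • g = 0) (m : ℤ) :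
    zmodHom n g h m = m • g := by
  rw [zmodHom, ZMod.lift_coe, zmultiplesHom_apply]

theorem nonempty_addEquiv_zmod_two_four {e g : G} (he : addOrderOf e = 4) (hg : 2 • g = 0)
    (hge : g ∉ AddSubgroup.zmultiples e)
    (htop : AddSubgroup.zmultiples e ⊔ AddSubgroup.zmultiples g = ⊤) :
    Nonempty (G ≃+ ZMod 2 × ZMod 4) := by
  have he' : 4 • e = 0 := he ▸ addOrderOf_nsmul_eq_zero e
  refine ⟨(AddEquiv.ofBijective ((zmodHom 2 g hg).coprod (zmodHom 4 e he')) ⟨?_, ?_⟩).symm⟩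
  · rw [injective_iff_map_eq_zero]
    rintro ⟨a, b⟩ h
    obtain ⟨b, rfl⟩ := ZMod.intCast_surjective b
    rw [AddMonoidHom.coprod_apply, zmodHom_intCast] at h
    have ha : ∀ a : ZMod 2, a = 0 ∨ a = (1 : ℤ) := by decide
    rcases ha a with rfl | rfl
    · rw [map_zero, zero_add, ← addOrderOf_dvd_iff_zsmul_eq_zero, he] at h
      rw [(ZMod.intCast_zmod_eq_zero_iff_dvd b 4).2 h]
      rfl
    · rw [zmodHom_intCast, one_zsmul] at h
      exact absurd (AddSubgroup.mem_zmultiples_iff.2 ⟨-b, by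
        rw [neg_zsmul, eq_neg_of_add_eq_zero_left h]⟩) hge
  · rw [← AddMonoidHom.range_eq_top, eq_top_iff, ← htop, sup_le_iff,
      AddSubgroup.zmultiples_le, AddSubgroup.zmultiples_le]
    exact ⟨⟨(0, (1 : ℤ)), by rw [AddMonoidHom.coprod_apply, zmodHom_intCast]; simp⟩,
      ⟨((1 : ℤ), 0), by rw [AddMonoidHom.coprod_apply, zmodHom_intCast]; simp⟩⟩

theorem nonempty_addEquiv_of_addOrderOf_eq_four (h4 : ∀ x : G, 4 • x = 0)
    (h2 : ∀ S : Multiset G, Dissociated S → S.card ≤ 3) {e : G} (he : addOrderOf e = 4) :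
    Nonempty (G ≃+ ZMod 4) ∨ Nonempty (G ≃+ ZMod 2 × ZMod 4) := by
  set K := AddSubgroup.zmultiples e with hK
  have he2 : 2 • e ≠ 0 := fun h => by
    have := addOrderOf_dvd_iff_nsmul_eq_zero.2 h
    rw [he] at this
    omega
  have heK : e ∈ K := AddSubgroup.mem_zmultiples e
  have hee : Dissociated (Multiset.replicate 2 e) := by
    simpa using dissociated_zero.add_pair_of_notMem (K := ⊥) (by simp) (g := e)
      (by simpa using he2) (h4 e)
  have heeK : ∀ x ∈ Multiset.replicate 2 e, x ∈ K := fun x hx => Multiset.eq_of_mem_replicate hx ▸ heK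
  -- For `g ∉ L`, `2g ∉ K` would make `e, e, g, g` dissociated. So `2g = m e`, and `4g = 0` makes `m
  -- = 2k` even; then `g - k e` has order 2 and still lies outside `L`.
  have key : ∀ L : AddSubgroup G, K ≤ L → L ≠ ⊤ → ∃ g ∉ L, 2 • g = 0 := by
    intro L hKL hL
    obtain ⟨g, -, hg⟩ := SetLike.exists_of_lt (lt_top_iff_ne_top.2 hL)
    have hgK : 2 • g ∈ K := by
      by_contra h
      have := h2 _ (hee.add_pair_of_notMem heeK h (h4 g))
      simp at this
    obtain ⟨m, hm⟩ := AddSubgroup.mem_zmultiples_iff.1 hgK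
    have h8 : (2 * m) • e = 0 := by rw [mul_zsmul, hm, ← h4 g]; abel
    obtain ⟨k, hk⟩ := addOrderOf_dvd_iff_zsmul_eq_zero.2 h8
    rw [he] at hk
    obtain rfl : m = 2 * k := by push_cast at hk; omega
    refine ⟨g - k • e, fun h => hg ?_, ?_⟩
    · simpa using L.add_mem h (L.zsmul_mem (hKL heK) k)
    · rw [nsmul_sub, ← hm, mul_zsmul]
      abel
  by_cases hKt : K = ⊤
  · left
    have hcyc : IsAddCyclic G := ⟨e, fun x => by
      change x ∈ K; rw [hKt]; exact AddSubgroup.mem_top x⟩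
    have hcard : Nat.card G = 4 := by
      rw [← he, ← Nat.card_zmultiples, ← hK, hKt, AddSubgroup.card_top]
    exact ⟨(hcard ▸ zmodAddCyclicAddEquiv hcyc).symm⟩
  · right
    obtain ⟨g, hg, hg2⟩ := key K le_rfl hKt
    refine nonempty_addEquiv_zmod_two_four he hg2 hg ?_
    -- A further involution `h` would make `e, e, g, h` dissociated with four elements.
    by_contra hL
    obtain ⟨h, hh, hh2⟩ := key _ le_sup_left hL
    have h3 := hee.add_singleton_of_notMem heeK hg fun _ => hg2
    have := h2 _ (h3.add_singleton_of_notMem (fun x hx => ?_) hh fun _ => hh2)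
    · simp at this
    · rw [Multiset.mem_add, Multiset.mem_singleton] at hx
      rcases hx with hx | rfl
      · exact le_sup_left (a := K) (heeK x hx)
      · exact le_sup_right (a := K) (AddSubgroup.mem_zmultiples x)

theorem classification [Finite G] (h1 : ∀ g : G, addOrderOf g ≤ 4)
    (h2 : ∀ S : Multiset G, Dissociated S → S.card ≤ 3) :
    ENat.card G ≤ 2 ∨
    (Nonempty (G ≃+ ZMod 3) ∨ Nonempty (G ≃+ ZMod 2 × ZMod 2) ∨ Nonempty (G ≃+ ZMod 3 × ZMod 3)) ∨
    (Nonempty (G ≃+ ZMod 4) ∨ Nonempty (G ≃+ ZMod 2 × ZMod 4) ∨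
      Nonempty (G ≃+ ZMod 2 × ZMod 2 × ZMod 2) ∨ Nonempty (G ≃+ ZMod 3 × ZMod 3 × ZMod 3)) := by
  have h1' : ∀ g : G, 0 < addOrderOf g ∧ addOrderOf g ≤ 4 := fun g => ⟨addOrderOf_pos g, h1 g⟩
  have hcard1 : Subsingleton G → ENat.card G ≤ 2 := fun h =>
    ((ENat.card_le_one_iff_subsingleton G).2 h).trans (by norm_num)
  by_cases h3 : ∃ g : G, addOrderOf g = 3
  · obtain ⟨g, hg⟩ := h3
    let _ : Module (ZMod 3) G :=
      AddCommGroup.zmodModule (nsmul_eq_zero_of_addOrderOf_eq_three h1' hg)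
    obtain ⟨S, hS, hc⟩ := exists_dissociated_card_of_le_finrank (G := G) 3 le_rfl
    have := h2 S hS
    rw [hc] at this
    interval_cases hr : Module.finrank (ZMod 3) G
    · exact Or.inl (hcard1 (Module.finrank_zero_iff.1 hr))
    · exact Or.inr (Or.inl (Or.inl
        ⟨(LinearEquiv.ofFinrankEq (R := ZMod 3) G (ZMod 3) (by simp [hr])).toAddEquiv⟩))
    · exact Or.inr (Or.inl (Or.inr (Or.inr
        ⟨(LinearEquiv.ofFinrankEq (R := ZMod 3) G (ZMod 3 × ZMod 3) (by simp [hr])).toAddEquiv⟩)))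
    · exact Or.inr (Or.inr (Or.inr (Or.inr (Or.inr
        ⟨(LinearEquiv.ofFinrankEq (R := ZMod 3) G (ZMod 3 × ZMod 3 × ZMod 3)
          (by simp [hr])).toAddEquiv⟩))))
  by_cases h4 : ∃ g : G, addOrderOf g = 4
  · obtain ⟨g, hg⟩ := h4
    have h4 : ∀ x : G, 4 • x = 0 := fun x => by
      have := h1' x
      have h3x : addOrderOf x ≠ 3 := fun h => h3 ⟨x, h⟩
      rw [← addOrderOf_dvd_iff_nsmul_eq_zero]
      rcases (show addOrderOf x = 1 ∨ addOrderOf x = 2 ∨ addOrderOf x = 4 by omega) with h | h | h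
        <;> simp [h]
    rcases nonempty_addEquiv_of_addOrderOf_eq_four h4 h2 hg with h | h
    · exact Or.inr (Or.inr (Or.inl h))
    · exact Or.inr (Or.inr (Or.inr (Or.inl h)))
  · have h2' : ∀ x : G, 2 • x = 0 := fun x => by
      have := h1' x
      have h3x : addOrderOf x ≠ 3 := fun h => h3 ⟨x, h⟩
      have h4x : addOrderOf x ≠ 4 := fun h => h4 ⟨x, h⟩
      rw [← addOrderOf_dvd_iff_nsmul_eq_zero]
      rcases (show addOrderOf x = 1 ∨ addOrderOf x = 2 by omega) with h | h <;> simp [h]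
    let _ : Module (ZMod 2) G := AddCommGroup.zmodModule h2'
    obtain ⟨S, hS, hc⟩ := exists_dissociated_card_of_le_finrank (G := G) 2 le_rfl
    have := h2 S hS
    rw [hc] at this
    interval_cases hr : Module.finrank (ZMod 2) G
    · exact Or.inl (hcard1 (Module.finrank_zero_iff.1 hr))
    · refine Or.inl ?_
      rw [ENat.card_congr (LinearEquiv.ofFinrankEq (R := ZMod 2) G (ZMod 2) (by simp [hr])).toEquiv,
        ENat.card_eq_coe_natCard]
      simp
    · exact Or.inr (Or.inl (Or.inr (Or.inl
        ⟨(LinearEquiv.ofFinrankEq (R := ZMod 2) G (ZMod 2 × ZMod 2) (by simp [hr])).toAddEquiv⟩)))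
    · exact Or.inr (Or.inr (Or.inr (Or.inr (Or.inl
        ⟨(LinearEquiv.ofFinrankEq (R := ZMod 2) G (ZMod 2 × ZMod 2 × ZMod 2)
          (by simp [hr])).toAddEquiv⟩))))

end Classification

/-! ### The values of the catenary degree -/

section Values

variable {H P : Type*} [CommMonoid H] {φ : H →* FreeMon P}

theorem surjective_classMap (hP : ∀ g : ClGroup φ, ∃ p : P, divisorClass φ (prime p) = g)
    {G : Type*} [AddCommGroup G] (ψ : ClGroup φ ≃+ G) : Function.Surjective (classMap φ ψ) := by
  intro g
  obtain ⟨p, hp⟩ := hP (ψ.symm g)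
  exact ⟨p, by rw [classMap, hp, AddEquiv.apply_symm_apply]⟩

variable [IsCancelMul H] {G : Type*} [AddCommGroup G]

theorem finrank_lt_daleth (hφ : IsDivisorTheory φ) {ψ : ClGroup φ ≃+ G}
    (hsurj : Function.Surjective (classMap φ ψ)) (p : ℕ) [Fact p.Prime] [Module (ZMod p) G]
    [Module.Finite (ZMod p) G] (h : 2 ≤ Module.finrank (ZMod p) G) :
    ((Module.finrank (ZMod p) G + 1 : ℕ) : ℕ∞) ≤ daleth H := by
  obtain ⟨S, hS, hc⟩ := exists_dissociated_card_of_le_finrank (G := G) p le_rfl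
  rw [← hc] at h ⊢
  exact hS.card_lt_daleth hφ hsurj h

theorem finite_of_daleth_lt_top (hφ : IsDivisorTheory φ) {ψ : ClGroup φ ≃+ G}
    (hsurj : Function.Surjective (classMap φ ψ)) (h : daleth H < ⊤) : Finite G := by
  rw [← not_infinite_iff_finite]
  intro _
  exact h.ne (daleth_eq_top_of_infinite hφ hsurj)

theorem catenaryDegree_lt_top [Finite G] (hφ : IsDivisorTheory φ) (ψ : ClGroup φ ≃+ G) :
    catenaryDegree H < ⊤ :=
  (catenaryDegree_le_of_davenportLE hφ ψ (le_max_left 2 (Nat.card G))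
    (davenportLE_natCard.mono (le_max_right _ _))).trans_lt (ENat.natCast_lt_top _)

theorem catenaryDegree_le_two (hφ : IsDivisorTheory φ) (ψ : ClGroup φ ≃+ G)
    (h : ENat.card G ≤ 2) : catenaryDegree H ≤ 2 := by
  have : Finite G := ENat.card_lt_top.1 (h.trans_lt (by exact ENat.natCast_lt_top 2))
  rw [ENat.card_eq_coe_natCard] at h
  exact catenaryDegree_le_of_davenportLE hφ ψ le_rfl
    (davenportLE_natCard.mono (by exact_mod_cast h))

theorem classification_of_daleth_le_four (hφ : IsDivisorTheory φ) {ψ : ClGroup φ ≃+ G}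
    (hsurj : Function.Surjective (classMap φ ψ)) (h : daleth H ≤ 4) :
    ENat.card G ≤ 2 ∨
    (Nonempty (G ≃+ ZMod 3) ∨ Nonempty (G ≃+ ZMod 2 × ZMod 2) ∨ Nonempty (G ≃+ ZMod 3 × ZMod 3)) ∨
    (Nonempty (G ≃+ ZMod 4) ∨ Nonempty (G ≃+ ZMod 2 × ZMod 4) ∨
      Nonempty (G ≃+ ZMod 2 × ZMod 2 × ZMod 2) ∨ Nonempty (G ≃+ ZMod 3 × ZMod 3 × ZMod 3)) := by
  have : Finite G := finite_of_daleth_lt_top hφ hsurj (h.trans_lt (ENat.natCast_lt_top 4))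
  refine classification (fun g => ?_) fun S hS => ?_
  · by_contra hg
    have := (addOrderOf_le_daleth hφ hsurj g (by omega)).trans h
    exact hg (by exact_mod_cast this)
  · by_contra hc
    have := (hS.card_lt_daleth hφ hsurj (by omega)).trans h
    have : S.card + 1 ≤ 4 := by exact_mod_cast this
    omega

theorem le_catenaryDegree_of_addOrderOf (hφ : IsDivisorTheory φ)
    (hP : ∀ g : ClGroup φ, ∃ p : P, divisorClass φ (prime p) = g)
    (ψ : ClGroup φ ≃+ G) {n : ℕ} (hn : 3 ≤ n) {g : G}
    (hg : addOrderOf g = n) : (n : ℕ∞) ≤ catenaryDegree H :=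
  (hg ▸ addOrderOf_le_daleth hφ (surjective_classMap hP ψ) g (by omega)).trans
    (daleth_le_catenaryDegree hφ)

theorem le_catenaryDegree_of_finrank (hφ : IsDivisorTheory φ)
    (hP : ∀ g : ClGroup φ, ∃ p : P, divisorClass φ (prime p) = g)
    (ψ : ClGroup φ ≃+ G) (p : ℕ) [Fact p.Prime]
    [Module (ZMod p) G] [Module.Finite (ZMod p) G] {n : ℕ} (hn : 2 ≤ n)
    (h : Module.finrank (ZMod p) G = n) : ((n + 1 : ℕ) : ℕ∞) ≤ catenaryDegree H :=
  (h ▸ finrank_lt_daleth hφ (surjective_classMap hP ψ) p (by omega)).trans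
    (daleth_le_catenaryDegree hφ)

theorem catenaryDegree_eq_three (hφ : IsDivisorTheory φ)
    (hP : ∀ g : ClGroup φ, ∃ p : P, divisorClass φ (prime p) = g)
    (h : Nonempty (ClGroup φ ≃+ ZMod 3) ∨ Nonempty (ClGroup φ ≃+ ZMod 2 × ZMod 2) ∨
      Nonempty (ClGroup φ ≃+ ZMod 3 × ZMod 3)) : catenaryDegree H = 3 := by
  rcases h with ⟨⟨ψ⟩⟩ | ⟨⟨ψ⟩⟩ | ⟨⟨ψ⟩⟩
  · refine le_antisymm (catenaryDegree_le_of_davenportLE hφ ψ (N := 3) (by norm_num) ?_)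
      (le_catenaryDegree_of_addOrderOf hφ hP ψ (n := 3) le_rfl (g := 1) (ZMod.addOrderOf_one 3))
    simpa using davenportLE_natCard (f := (id : ZMod 3 → ZMod 3))
  · refine le_antisymm (catenaryDegree_le_of_davenportLE hφ ψ (N := 3) (by norm_num) ?_)
      (le_catenaryDegree_of_finrank hφ hP ψ 2 (n := 2) le_rfl (by simp))
    simpa using davenportLE_finrank (f := (id : ZMod 2 × ZMod 2 → ZMod 2 × ZMod 2)) 2
  · refine le_antisymm (catenaryDegree_le hφ ψ (N := 3) (by norm_num) ?_ (dalethLE_three (by simp)))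
      (le_catenaryDegree_of_finrank hφ hP ψ 3 (n := 2) le_rfl (by simp))
    exact (davenportLE_finrank 3).mono (by simp)

theorem catenaryDegree_eq_four (hφ : IsDivisorTheory φ)
    (hP : ∀ g : ClGroup φ, ∃ p : P, divisorClass φ (prime p) = g)
    (h : Nonempty (ClGroup φ ≃+ ZMod 4) ∨ Nonempty (ClGroup φ ≃+ ZMod 2 × ZMod 4) ∨
      Nonempty (ClGroup φ ≃+ ZMod 2 × ZMod 2 × ZMod 2) ∨
      Nonempty (ClGroup φ ≃+ ZMod 3 × ZMod 3 × ZMod 3)) : catenaryDegree H = 4 := by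
  rcases h with ⟨⟨ψ⟩⟩ | ⟨⟨ψ⟩⟩ | ⟨⟨ψ⟩⟩ | ⟨⟨ψ⟩⟩
  · refine le_antisymm (catenaryDegree_le_of_davenportLE hφ ψ (N := 4) (by norm_num) ?_)
      (le_catenaryDegree_of_addOrderOf hφ hP ψ (n := 4) (by norm_num) (g := 1)
        (ZMod.addOrderOf_one 4))
    simpa using davenportLE_natCard (f := (id : ZMod 4 → ZMod 4))
  · exact le_antisymm (catenaryDegree_le hφ ψ (N := 4) (by norm_num)
      (davenportLE_five.mono (by norm_num)) dalethLE_four_of_zmod_two_four)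
      (le_catenaryDegree_of_addOrderOf hφ hP ψ (n := 4) (by norm_num) (g := (0, 1)) (by
        rw [Prod.addOrderOf_mk, ZMod.addOrderOf_one, addOrderOf_zero, Nat.lcm_one_left]))
  · refine le_antisymm (catenaryDegree_le_of_davenportLE hφ ψ (N := 4) (by norm_num) ?_)
      (le_catenaryDegree_of_finrank hφ hP ψ 2 (n := 3) (by norm_num) (by simp))
    exact (davenportLE_finrank 2).mono (by simp)
  · refine le_antisymm (catenaryDegree_le hφ ψ (N := 4) (by norm_num) ?_ (dalethLE_four (by simp)))
      (le_catenaryDegree_of_finrank hφ hP ψ 3 (n := 3) (by norm_num) (by simp))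
    exact (davenportLE_finrank 3).mono (by simp)

end Values

end KrullMonoid

theorem corollary5p6 {H : Type*} [CommMonoid H] [IsCancelMul H] {P : Type*}
    (φ : H →* KrullMonoid.FreeMon P) (hφ : KrullMonoid.IsDivisorTheory φ)
    (hP : ∀ g : KrullMonoid.ClGroup φ, ∃ p : P,
      KrullMonoid.divisorClass φ (KrullMonoid.prime p) = g) :
    (KrullMonoid.daleth H < ⊤ ↔ KrullMonoid.catenaryDegree H < ⊤) ∧
    (KrullMonoid.catenaryDegree H < ⊤ ↔ Finite (KrullMonoid.ClGroup φ)) ∧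
    (KrullMonoid.catenaryDegree H ≤ 2 ↔ ENat.card (KrullMonoid.ClGroup φ) ≤ 2) ∧
    (KrullMonoid.catenaryDegree H = 3 ↔
      Nonempty (KrullMonoid.ClGroup φ ≃+ ZMod 3) ∨
      Nonempty (KrullMonoid.ClGroup φ ≃+ ZMod 2 × ZMod 2) ∨
      Nonempty (KrullMonoid.ClGroup φ ≃+ ZMod 3 × ZMod 3)) ∧
    (KrullMonoid.catenaryDegree H = 4 ↔
      Nonempty (KrullMonoid.ClGroup φ ≃+ ZMod 4) ∨
      Nonempty (KrullMonoid.ClGroup φ ≃+ ZMod 2 × ZMod 4) ∨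
      Nonempty (KrullMonoid.ClGroup φ ≃+ ZMod 2 × ZMod 2 × ZMod 2) ∨
      Nonempty (KrullMonoid.ClGroup φ ≃+ ZMod 3 × ZMod 3 × ZMod 3)) := by
  have hsurj := KrullMonoid.surjective_classMap hP (AddEquiv.refl _)
  have hle := KrullMonoid.daleth_le_catenaryDegree hφ
  have hfin : Finite (KrullMonoid.ClGroup φ) → KrullMonoid.catenaryDegree H < ⊤ := fun _ =>
    KrullMonoid.catenaryDegree_lt_top hφ (AddEquiv.refl _)
  have hfin' := KrullMonoid.finite_of_daleth_lt_top hφ hsurj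
  have h2 := KrullMonoid.catenaryDegree_le_two hφ (AddEquiv.refl _)
  have h3 := KrullMonoid.catenaryDegree_eq_three hφ hP
  have h4 := KrullMonoid.catenaryDegree_eq_four hφ hP
  have hclass : KrullMonoid.catenaryDegree H ≤ 4 → _ := fun h =>
    KrullMonoid.classification_of_daleth_le_four hφ hsurj (hle.trans h)
  have h23 : ¬ (3 : ℕ∞) ≤ 2 := by norm_num
  have h24 : ¬ (4 : ℕ∞) ≤ 2 := by norm_num
  have h34 : (3 : ℕ∞) ≠ 4 := by norm_num
  refine ⟨⟨fun h => hfin (hfin' h), hle.trans_lt⟩, ⟨fun h => hfin' (hle.trans_lt h), hfin⟩,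
    ⟨fun h => ?_, h2⟩, ⟨fun h => ?_, h3⟩, ⟨fun h => ?_, h4⟩⟩
  · rcases hclass (h.trans (by norm_num)) with h' | h' | h'
    · exact h'
    · exact absurd (h3 h' ▸ h) h23
    · exact absurd (h4 h' ▸ h) h24
  · rcases hclass (h.le.trans (by norm_num)) with h' | h' | h'
    · exact absurd (h ▸ h2 h') h23
    · exact h'
    · exact absurd (h.symm.trans (h4 h')) h34
  · rcases hclass h.le with h' | h' | h'
    · exact absurd (h ▸ h2 h') h24
    · exact absurd ((h3 h').symm.trans h) h34
    · exact h'
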